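/- For a nonzero integer $n$ let $T_{2n}$ be the twist knot with two left-handed vertical crossings (the clasp) and $2n$ right-handed horizontal crossings ($-2n$ left-handed ones if $n<0$); so $T_2$ is the figure-eight knot and $T_{-2}$ is the right-handed trefoil. Fix the standard meridian $\mu$ and longitude $\lambda$ of $T_{2n}$. Consider all pairs $(L,M)\in\mathbb C^2$ for which some representation $\rho$ of the knot group in $SL(2,\mathbb C)$ sends $\mu$ and $\lambda$ to upper triangular matrices with upper left entries $M$ and $L$. The A-polynomial $A_{2n}(L,M)\in\mathbb Z[L,M]$ is the primitive polynomial such that $(L-1)A_{2n}$ is a defining polynomial without repeated factors of the union of the one-dimensional components of the Zariski closure of the set of these pairs. It exists and is unique up to sign; its sign can be, and is, chosen so that the coefficient of $M^{4n}$ is $-1$ if $n>0$, and the constant term is $1$ if $n<0$. The Newton polygon of $A_{2n}$ is the convex hull of the points $(i,j)$ such that $L^iM^j$ occurs in $A_{2n}$. For an edge (of positive length) of slope $a/b$, in lowest terms with $b>0$, the edge polynomial is obtained from the sum of the terms of $A_{2n}$ along the edge by dividing by the monomial of the left end point and putting $t$ for $L^bM^a$. **Theorem.** If $n>0$, every edge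 of the Newton polygon of $A_{2n}$ has slope $0$, $-4n$ or $4$, and * the edge polynomials of the edges of slope $-4n$ are exactly $t-1$ and $-(t-1)$; * the edge polynomials of the edges of slope $4$ are exactly $(t-1)^n$ and $-(t-1)^n$ if $n$ is odd, and only $-(t-1)^n$ if $n$ is even. If $n<0$, every edge of the Newton polygon of $A_{2n}$ has slope $0$, $-4n+2$ or $4$, and * the only edge polynomial of the edges of slope $-4n+2$ is $t+1$; * if $n<-1$, the edge polynomials of the edges of slope $4$ are exactly $(t-1)^{-n-1}$ and $-(t-1)^{-n-1}$ if $n$ is even, and only $(t-1)^{-n-1}$ if $n$ is odd. If $n=-1$, the Newton polygon is a segment of slope $-4n+2=6$, and this segment is its only edge. -/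

import Mathlib

noncomputable section

/-- The combinatorial data of an oriented knot diagram with `N` crossings that enter the
Wirtinger presentation of its knot group. The arcs (from one undercrossing to the next one) are
numbered `0, 1, …, N - 1` in the order in which the knot runs through them; the end of arc `i`,
where it turns into arc `i + 1` (cyclically), is the undercrossing number `i`. There the knot
passes under the arc `overArc i`, and `sign i = ±1` is the usual sign of this crossing (a right-handed
crossing is positive). -/
structure KnotDiagram (N : ℕ) where
  overArc : Fin N → Fin N
  sign : Fin N → ℤˣ

namespace KnotDiagram

variable {N : ℕ} [NeZero N] (D : KnotDiagram N)

/-- The Wirtinger relator `x_o ^ ε * x_{i+1} * x_o ^ (-ε) * x_i⁻¹` of the `i`-th crossing, where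
`o = overArc i` and `ε = sign i`; that is, `x_{i+1} = x_o ^ (-ε) * x_i * x_o ^ ε`. -/
def relator (i : Fin N) : FreeGroup (Fin N) :=
  FreeGroup.of (D.overArc i) ^ (D.sign i : ℤ) * FreeGroup.of (i + 1) *
    FreeGroup.of (D.overArc i) ^ (-(D.sign i : ℤ)) * (FreeGroup.of i)⁻¹

/-- The knot group (the fundamental group of the knot exterior), by the Wirtinger presentation. -/
abbrev KnotGroup : Type := PresentedGroup (Set.range D.relator)

/-- The meridian of the arc `i`. -/
def arc (i : Fin N) : D.KnotGroup := PresentedGroup.of i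

/-- The preferred meridian, that of arc `0`. -/
def meridian : D.KnotGroup := D.arc 0

/-- The preferred (null-homologous) longitude that commutes with the meridian of arc `0`:
run once along the knot from arc `0`, collect the meridian of the overcrossing arc at every
undercrossing, with the sign of the crossing as exponent, and correct by the writhe. -/
def longitude : D.KnotGroup :=
  (List.ofFn fun i : Fin N => D.arc (D.overArc i) ^ (D.sign i : ℤ)).prod *
    D.meridian ^ (-∑ i, (D.sign i : ℤ))

/-- The pairs `(L, M)` (coordinate `0` is `L`, coordinate `1` is `M`) for which some representation
of the knot group in `SL(2, ℂ)` sends meridian and longitude to upper triangular matrices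
with upper left entries `M` and `L`. -/
def eigenvalueSet : Set (Fin 2 → ℂ) :=
  {x | ∃ ρ : D.KnotGroup →* Matrix.SpecialLinearGroup (Fin 2) ℂ,
    (ρ D.longitude).1 1 0 = 0 ∧ (ρ D.meridian).1 1 0 = 0 ∧
    (ρ D.longitude).1 0 0 = x 0 ∧ (ρ D.meridian).1 0 0 = x 1}

/-- `A ∈ ℤ[L, M]` (variable `0` is `L`, variable `1` is `M`) is an A-polynomial of the knot,
in the normalization without the factor `L - 1` of the abelian representations:
`A` is primitive, and `(L - 1) * A` is, over `ℂ`, a defining polynomial without repeated factors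
of the union of the one-dimensional components of the Zariski closure of the eigenvalue set.
So its irreducible factors are the `f` whose plane curve `f = 0` lies in this closure.
This determines `A` up to sign. -/
def IsAPolynomial (A : MvPolynomial (Fin 2) ℤ) : Prop :=
  (∀ c : ℤ, MvPolynomial.C c ∣ A → IsUnit c) ∧
  Squarefree (MvPolynomial.map (Int.castRingHom ℂ) ((MvPolynomial.X 0 - 1) * A)) ∧
  ∀ f : MvPolynomial (Fin 2) ℂ, Irreducible f →
    (f ∣ MvPolynomial.map (Int.castRingHom ℂ) ((MvPolynomial.X 0 - 1) * A) ↔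
      {x : Fin 2 → ℂ | MvPolynomial.eval x f = 0} ⊆
        MvPolynomial.zeroLocus ℂ (MvPolynomial.vanishingIdeal ℂ D.eigenvalueSet))

end KnotDiagram

/-- The twist knot `T_{2n}`, with two left-handed vertical crossings (the clasp) and `2n`
right-handed horizontal crossings (`-2n` left-handed ones if `n < 0`).

Let `k = |n|`. Run along the knot. The first strand goes through the horizontal crossings
`1, …, 2k`, then through the two clasp crossings `a, b`; the second strand comes back through the
horizontal crossings `2k, …, 1`, and finally through the clasp crossings `b, a`.
Both strands of the horizontal part and both strands of the clasp are antiparallel, so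
the clasp crossings are positive and the horizontal ones have the sign of `-n`.
On each strand the horizontal crossings are passed alternately over and under. In
Gauss code (`O` over, `U` under) the knot is
`O1 U2 O3 … U(2k), Oa Ub, O(2k) U(2k-1) … U1, Ob Ua` if `n > 0` and
`U1 O2 U3 … O(2k), Oa Ub, U(2k) O(2k-1) … O1, Ob Ua` if `n < 0`.
Arc `0` begins after the undercrossing at `a`. Thus arc `k` ends at `b` under arc `2k + 1`, arc
`2k + 1` ends at `a` under arc `k`, and every other arc `i` ends at a horizontal crossing, under
arc `2k - i` if `n > 0`, under arc `2k + 1 - i` if `n < 0`. -/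
def twistKnot (n : ℤ) : KnotDiagram (2 * n.natAbs + 2) where
  overArc i :=
    ⟨if (i : ℕ) = n.natAbs then 2 * n.natAbs + 1
      else if (i : ℕ) = 2 * n.natAbs + 1 then n.natAbs
      else if 0 < n then 2 * n.natAbs - i
      else 2 * n.natAbs + 1 - i, by split_ifs <;> omega⟩
  sign i :=
    if (i : ℕ) = n.natAbs ∨ (i : ℕ) = 2 * n.natAbs + 1 then 1
      else if 0 < n then -1
      else 1

/-- The exponent of the monomial `L ^ i * M ^ j` as the point `(i, j)` of the plane. -/
def exponentPoint (m : Fin 2 →₀ ℕ) : ℝ × ℝ := (m 0, m 1)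

/-- The Newton polygon of a polynomial in `L` and `M`. -/
def newtonPolygon (A : MvPolynomial (Fin 2) ℤ) : Set (ℝ × ℝ) :=
  convexHull ℝ (exponentPoint '' (A.support : Set (Fin 2 →₀ ℕ)))

/-- The segment from `p` to `q` is an edge (a nondegenerate side) of the Newton polygon of `A`.
If the Newton polygon is itself a segment, then that segment is its only edge. -/
def IsNewtonEdge (A : MvPolynomial (Fin 2) ℤ) (p q : Fin 2 →₀ ℕ) : Prop :=
  p ≠ q ∧ IsExposed ℝ (newtonPolygon A) (segment ℝ (exponentPoint p) (exponentPoint q))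

/-- The edge from `p` to `q` has slope `r`, with `L`-exponents drawn horizontally and
`M`-exponents vertically. -/
def HasSlope (p q : Fin 2 →₀ ℕ) (r : ℚ) : Prop :=
  p 0 ≠ q 0 ∧ ((q 1 : ℚ) - p 1) = r * ((q 0 : ℚ) - p 0)

open Classical in
/-- `f` is the edge polynomial of an edge of slope `r = a / b` (in lowest terms, `b > 0`) of
the Newton polygon of `A`: in the sum of the terms of `A` along the edge, divided by the monomial of
the left end point `p`, put `t` for `L ^ b * M ^ a`. A term with exponent `m` on the edge thus gives
its coefficient times `t ^ ((m 0 - p 0) / b)`. -/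
def IsEdgePolynomial (A : MvPolynomial (Fin 2) ℤ) (r : ℚ) (f : Polynomial ℤ) : Prop :=
  ∃ p q : Fin 2 →₀ ℕ, IsNewtonEdge A p q ∧ HasSlope p q r ∧ p 0 < q 0 ∧
    f = ∑ m ∈ A.support with exponentPoint m ∈ segment ℝ (exponentPoint p) (exponentPoint q),
      Polynomial.monomial ((m 0 - p 0) / r.den) (MvPolynomial.coeff m A)

end

/-! A representation of the knot group of `T_{2n}` amounts to two meridians `a`, `b` with `w^n b = a
w^n`, where `w = b a⁻¹ b⁻¹ a`; the longitude is `w(a,b)^n w(b,a)^n` (`twistKnot_relation_of_hom` and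
its converse `exists_hom_of_twistKnot_relation`). Reducible pairs only give `L = 1`. Otherwise `a`
can be made upper and `b` lower triangular with the same diagonal. By Cayley–Hamilton `w^n` is
linear in `w` with Chebyshev coefficients, and the whole matrix relation collapses to one scalar
equation `riley n s X = 0`, where `s = tr (a b⁻¹) - 1` and `X = M² + M⁻²`. On its zeros `s (1 + L
M²) = L + M²`, so `s` is a Möbius function of `L`. Eliminating `s` and clearing denominators gives
the explicit polynomial `twistAPoly`, built from the recursion `Q_{j+2} = T Q_{j+1} - W² Q_j`.

To see that this is the A-polynomial, compare zero sets away from finitely many `M` and apply the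
Nullstellensatz; no irreducible factor is lost, since none has the form `M - b`. Repeated factors
are excluded by specializing to `X = -2`. There, with `s + 1 = ζ + ζ⁻¹`, the Riley polynomial
becomes `(ζ^(2n+1) - ζ^(-2n)) / (ζ - 1)` and has only simple roots, so by a resultant it has simple
roots in `s` for all but finitely many `X`. The Möbius substitution carries this over to `L`.
Primitivity, and uniqueness up to sign, come from a coefficient `±1`.

For the Newton polygon, initial forms for a pair of weights are multiplicative. For the weights
normal to the sides of slope 4 (and for the top side), `W²` has less than twice the weight of `T`.
The recursion then degenerates to powers of the initial form of `T`, which is a binomial; hence the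
powers of `t - 1`. In the first and last columns the recursion has, up to scaling, the
characteristic roots `1` and `M^4`, and each column reduces to one monomial. Together these facts
enclose the support in a hexagon with three pairs of parallel sides, whose steep sides carry just
two monomials. A normal cone argument shows that there are no other edges. For `n = -1` the hexagon
collapses to a segment. -/

/-! ### Wirtinger relations and homomorphisms. -/

namespace KnotDiagram

variable {N : ℕ} [NeZero N] (D : KnotDiagram N)

theorem arc_add_one (i : Fin N) :
    D.arc (i + 1) = D.arc (D.overArc i) ^ (-(D.sign i : ℤ)) * D.arc i *
      D.arc (D.overArc i) ^ (D.sign i : ℤ) := by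
  have h : (PresentedGroup.mk (Set.range D.relator)) (D.relator i) = 1 :=
    PresentedGroup.one_of_mem ⟨i, rfl⟩
  rw [relator] at h
  simp only [map_mul, map_zpow, map_inv] at h
  change D.arc (D.overArc i) ^ (D.sign i : ℤ) * D.arc (i + 1) *
    D.arc (D.overArc i) ^ (-(D.sign i : ℤ)) * (D.arc i)⁻¹ = 1 at h
  rw [mul_inv_eq_one] at h
  rw [← h]
  group

theorem exists_hom_of_wirtinger {G : Type*} [Group G] (x : Fin N → G)
    (hx : ∀ i, x (i + 1) = x (D.overArc i) ^ (-(D.sign i : ℤ)) * x i *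
      x (D.overArc i) ^ (D.sign i : ℤ)) :
    ∃ ρ : D.KnotGroup →* G, ∀ i, ρ (D.arc i) = x i := by
  have h : ∀ r ∈ Set.range D.relator, FreeGroup.lift x r = 1 := by
    rintro _ ⟨i, rfl⟩
    simp only [relator, map_mul, map_zpow, map_inv, FreeGroup.lift_apply_of, hx i]
    group
  exact ⟨PresentedGroup.toGroup h, fun i => PresentedGroup.toGroup.of h⟩

end KnotDiagram

/-! ### Word identities for the clasp commutator and for twist regions. -/

section GroupWords

variable {G : Type*} [Group G]

/-- The commutator word `b a⁻¹ b⁻¹ a` of the two clasp meridians `a`, `b` of a twist knot. -/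
def twistWord (a b : G) : G := b * a⁻¹ * b⁻¹ * a

theorem map_twistWord {H : Type*} [Group H] (f : G →* H) (a b : G) :
    f (twistWord a b) = twistWord (f a) (f b) := by
  simp [twistWord]

/-- `w(b,a)` is a cyclic rotation of `w(a,b)⁻¹`. It can be reached by rotating in either direction,
and both conjugators are needed: comparing them is how `a` is shown to commute with the longitude.
-/
theorem twistWord_swap_zpow (a b : G) (n : ℤ) :
    twistWord b a ^ n = (b⁻¹ * a) * (twistWord a b ^ n)⁻¹ * (b⁻¹ * a)⁻¹ := by
  rw [← inv_zpow, ← conj_zpow]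
  congr 1
  simp only [twistWord]
  group

theorem twistWord_swap_zpow' (a b : G) (n : ℤ) :
    twistWord b a ^ n = (a * b⁻¹) * (twistWord a b ^ n)⁻¹ * (a * b⁻¹)⁻¹ := by
  rw [← inv_zpow, ← conj_zpow]
  congr 1
  simp only [twistWord]
  group

/-- The left side is the longitude as read off the diagram, with its writhe correction `a ^ (2n -
2)`. The relation makes `a` commute with `w(a,b)^n w(b,a)^n`, so that powers of `a` can be moved
around that word and cancelled. -/
theorem twist_longitude_eq {a b : G} {n : ℤ}
    (h : twistWord a b ^ n * b = a * twistWord a b ^ n) :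
    a ^ (-n) * twistWord a b ^ n * (b * a * b⁻¹) * (twistWord a b ^ n)⁻¹ * (b * a * b⁻¹) ^ (-n) * b *
      a ^ (2 * n - 2) = twistWord a b ^ n * twistWord b a ^ n := by
  have hcomm : a * (twistWord a b ^ n * twistWord b a ^ n) =
      twistWord a b ^ n * twistWord b a ^ n * a := by
    have h1 : b * twistWord b a ^ n = twistWord b a ^ n * a := by
      have e1 := twistWord_swap_zpow a b n
      have e2 := twistWord_swap_zpow' a b n
      have h2 : b⁻¹ * (twistWord a b ^ n)⁻¹ = (twistWord a b ^ n)⁻¹ * a⁻¹ := by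
        rw [← mul_inv_rev, ← mul_inv_rev, h]
      generalize twistWord a b ^ n = c at *
      calc b * twistWord b a ^ n = a * (c⁻¹ * a⁻¹) * b := by rw [e1]; group
        _ = _ := by rw [← h2, e2]; group
    rw [← mul_assoc, ← h, mul_assoc, h1, mul_assoc]
  have h3 : twistWord b a ^ n = _ := twistWord_swap_zpow' a b n
  have h4 : (b * a * b⁻¹) ^ (-n) * b = b * a ^ (-n) := by
    rw [conj_zpow]; group
  have h5 : Commute a (twistWord a b ^ n * twistWord b a ^ n) := hcomm
  -- By `hcomm` this conjugate is the longitude word itself; the point is to write it in the shape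
  -- that occurs in the diagram word.
  have h6 : a * (twistWord a b ^ n * twistWord b a ^ n) * a⁻¹ =
      twistWord a b ^ n * (b * a * b⁻¹) * (twistWord a b ^ n)⁻¹ * b * a ^ (-2 : ℤ) := by
    rw [h3]
    generalize twistWord a b ^ n = c at *
    have hc : b = c⁻¹ * a * c := by rw [mul_assoc, ← h]; group
    rw [hc]; group
  calc _ = a ^ (-n) * (twistWord a b ^ n * (b * a * b⁻¹) * (twistWord a b ^ n)⁻¹ *
        ((b * a * b⁻¹) ^ (-n) * b)) * a ^ (2 * n - 2) := by simp only [mul_assoc]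
    _ = a ^ (-n) * (twistWord a b ^ n * (b * a * b⁻¹) * (twistWord a b ^ n)⁻¹ * b *
        a ^ (-2 : ℤ)) * a ^ n := by
      rw [h4]
      have : a ^ (2 * n - 2) = a ^ n * a ^ (-2 : ℤ) * a ^ n := by
        rw [← zpow_add, ← zpow_add]; congr 1; ring
      rw [this, zpow_neg]
      group
    _ = a ^ (-n) * (twistWord a b ^ n * twistWord b a ^ n) * a ^ n := by
      rw [← h6, hcomm, mul_inv_cancel_right]
    _ = _ := by
      rw [mul_assoc, ← (h5.zpow_left n).eq, ← mul_assoc, zpow_neg, inv_mul_cancel, one_mul]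

/-- The arcs of a positive twist region with antiparallel strands. -/
theorem pos_twist_arcs {k : ℕ} {x : ℕ → G}
    (h1 : ∀ i < k, x (i + 1) = x (2 * k - i) * x i * (x (2 * k - i))⁻¹)
    (h2 : ∀ i < k, x (2 * k + 1 - i) = x i * x (2 * k - i) * (x i)⁻¹) :
    ∀ i ≤ k, x i = (((x (2 * k + 1))⁻¹ * x 0) ^ i)⁻¹ * x 0 * ((x (2 * k + 1))⁻¹ * x 0) ^ i ∧
      x (2 * k + 1 - i) = (((x (2 * k + 1))⁻¹ * x 0) ^ i)⁻¹ * x (2 * k + 1) *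
        ((x (2 * k + 1))⁻¹ * x 0) ^ i := by
  intro i hi
  induction i with
  | zero => simp
  | succ i ih =>
    obtain ⟨e1, e2⟩ := ih (by omega)
    have e3 := h2 i (by omega)
    have e4 := h1 i (by omega)
    have e5 : x (2 * k - i) = (x i)⁻¹ * x (2 * k + 1 - i) * x i := by rw [e3]; group
    have e6 : 2 * k + 1 - (i + 1) = 2 * k - i := by omega
    rw [e6, e4, e5, e1, e2, pow_succ']
    generalize ((x (2 * k + 1))⁻¹ * x 0) ^ i = c
    constructor <;> group

/-- The arcs of a negative twist region with antiparallel strands. -/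
theorem neg_twist_arcs {k : ℕ} {x : ℕ → G}
    (h1 : ∀ i < k, x (i + 1) = (x (2 * k + 1 - i))⁻¹ * x i * x (2 * k + 1 - i))
    (h2 : ∀ i < k, x (2 * k + 1 - i) = (x (i + 1))⁻¹ * x (2 * k - i) * x (i + 1)) :
    ∀ i ≤ k, x i = ((x (2 * k + 1))⁻¹ * x 0) ^ i * x 0 * (((x (2 * k + 1))⁻¹ * x 0) ^ i)⁻¹ ∧
      x (2 * k + 1 - i) = ((x (2 * k + 1))⁻¹ * x 0) ^ i * x (2 * k + 1) *
        (((x (2 * k + 1))⁻¹ * x 0) ^ i)⁻¹ := by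
  intro i hi
  induction i with
  | zero => simp
  | succ i ih =>
    obtain ⟨e1, e2⟩ := ih (by omega)
    have e3 := h2 i (by omega)
    have e4 := h1 i (by omega)
    have e5 : x (2 * k - i) = x (i + 1) * x (2 * k + 1 - i) * (x (i + 1))⁻¹ := by rw [e3]; group
    have e6 : 2 * k + 1 - (i + 1) = 2 * k - i := by omega
    rw [e6, e5, e4, e1, e2, pow_succ]
    generalize ((x (2 * k + 1))⁻¹ * x 0) ^ i = c
    constructor <;> group

end GroupWords

/-! ### The knot group of a twist knot: two generators, one relation, and the longitude. -/

section TwistKnotGroup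

variable {G : Type*} [Group G]

theorem list_ofFn_fin_eq {α : Type*} {N : ℕ} (f : ℕ → α) :
    (List.ofFn fun i : Fin N => f i) = (List.range N).map f := by
  apply List.ext_getElem <;> simp

/-- This and the next three lemmas collect the horizontal crossings in the longitude, for the first
and (primed) second strand and for either sign of `n`. With `v = q⁻¹ p`, neighbouring factors are
conjugates by consecutive powers of `v`, so the product telescopes to a power of `p` or `q` times
powers of `v`. -/
theorem prod_range_pos {k : ℕ} {p q : G} {f : ℕ → G}
    (hf : ∀ i < k, f i = ((q⁻¹ * p) ^ (i + 1))⁻¹ * q⁻¹ * (q⁻¹ * p) ^ (i + 1)) :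
    ∀ j ≤ k, ((List.range j).map f).prod = (p ^ j)⁻¹ * (q⁻¹ * p) ^ j := by
  intro j hj
  induction j with
  | zero => simp
  | succ j ih =>
    rw [List.prod_range_succ, ih (by omega), hf j (by omega), pow_succ' (q⁻¹ * p), pow_succ' p]
    generalize (q⁻¹ * p) ^ j = c
    group

theorem prod_range_pos' {k : ℕ} {p q : G} {f : ℕ → G}
    (hf : ∀ i < k, f i = ((q⁻¹ * p) ^ (k - 1 - i))⁻¹ * p⁻¹ * (q⁻¹ * p) ^ (k - 1 - i)) :
    ∀ j ≤ k, ((List.range j).map f).prod =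
      ((q⁻¹ * p) ^ k)⁻¹ * (q ^ j)⁻¹ * (q⁻¹ * p) ^ (k - j) := by
  intro j hj
  induction j with
  | zero => simp
  | succ j ih =>
    rw [List.prod_range_succ, ih (by omega), hf j (by omega),
      show k - j = k - 1 - j + 1 by omega, show k - (j + 1) = k - 1 - j by omega,
      pow_succ' (q⁻¹ * p) (k - 1 - j), pow_succ' q]
    generalize (q⁻¹ * p) ^ (k - 1 - j) = c
    group

theorem prod_range_neg {k : ℕ} {p q : G} {f : ℕ → G}
    (hf : ∀ i < k, f i = (q⁻¹ * p) ^ i * q * ((q⁻¹ * p) ^ i)⁻¹) :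
    ∀ j ≤ k, ((List.range j).map f).prod = p ^ j * ((q⁻¹ * p) ^ j)⁻¹ := by
  intro j hj
  induction j with
  | zero => simp
  | succ j ih =>
    rw [List.prod_range_succ, ih (by omega), hf j (by omega), pow_succ (q⁻¹ * p), pow_succ p]
    generalize (q⁻¹ * p) ^ j = c
    group

theorem prod_range_neg' {k : ℕ} {p q : G} {f : ℕ → G}
    (hf : ∀ i < k, f i = (q⁻¹ * p) ^ (k - i) * p * ((q⁻¹ * p) ^ (k - i))⁻¹) :
    ∀ j ≤ k, ((List.range j).map f).prod =
      (q⁻¹ * p) ^ k * q ^ j * ((q⁻¹ * p) ^ (k - j))⁻¹ := by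
  intro j hj
  induction j with
  | zero => simp
  | succ j ih =>
    rw [List.prod_range_succ, ih (by omega), hf j (by omega),
      show k - j = k - (j + 1) + 1 by omega,
      pow_succ (q⁻¹ * p) (k - (j + 1)), pow_succ q]
    generalize (q⁻¹ * p) ^ (k - (j + 1)) = c
    group

/-- The crossings in the order of the knot: first strand, clasp crossing `k`, second strand, clasp
crossing `2k + 1`. -/
theorem range_two_mul_add_two (k : ℕ) :
    List.range (2 * k + 2) =
      List.range k ++ [k] ++ (List.range k).map (k + 1 + ·) ++ [2 * k + 1] := by
  rw [List.range_succ, show 2 * k + 1 = k + 1 + k by omega, List.range_add, List.range_succ]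

/-- The number of the overcrossing arc at a crossing of a twist knot. -/
def twistOver (n : ℤ) (i : ℕ) : ℕ :=
  if i = n.natAbs then 2 * n.natAbs + 1
  else if i = 2 * n.natAbs + 1 then n.natAbs
  else if 0 < n then 2 * n.natAbs - i
  else 2 * n.natAbs + 1 - i

/-- The sign of a crossing of a twist knot. -/
def twistSign (n : ℤ) (i : ℕ) : ℤ :=
  if i = n.natAbs ∨ i = 2 * n.natAbs + 1 then 1 else if 0 < n then -1 else 1

theorem twistKnot_overArc_val (n : ℤ) (i : Fin (2 * n.natAbs + 2)) :
    (((twistKnot n).overArc i : Fin _) : ℕ) = twistOver n i := rfl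

theorem twistKnot_sign_coe (n : ℤ) (i : Fin (2 * n.natAbs + 2)) :
    (((twistKnot n).sign i : ℤˣ) : ℤ) = twistSign n i := by
  simp only [twistKnot, twistSign]
  split_ifs <;> simp

theorem sum_twistSign {n : ℤ} (hn : n ≠ 0) :
    ∑ i : Fin (2 * n.natAbs + 2), ((twistKnot n).sign i : ℤ) = 2 - 2 * n := by
  simp_rw [twistKnot_sign_coe]
  rw [Fin.sum_univ_eq_sum_range (twistSign n), Finset.sum_range_succ,
    show 2 * n.natAbs + 1 = n.natAbs + 1 + n.natAbs by omega, Finset.sum_range_add,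
    Finset.sum_range_succ]
  have h1 : ∀ i ∈ Finset.range n.natAbs, twistSign n i = if 0 < n then -1 else 1 := by
    intro i hi
    have := Finset.mem_range.1 hi
    rw [twistSign, if_neg (by omega)]
  have h2 : ∀ i ∈ Finset.range n.natAbs,
      twistSign n (n.natAbs + 1 + i) = if 0 < n then -1 else 1 := by
    intro i hi
    have := Finset.mem_range.1 hi
    rw [twistSign, if_neg (by omega)]
  rw [Finset.sum_congr rfl h1, Finset.sum_congr rfl h2]
  have h3 : twistSign n n.natAbs = 1 := by simp [twistSign]
  have h4 : twistSign n (n.natAbs + 1 + n.natAbs) = 1 := by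
    rw [twistSign, if_pos (by omega)]
  rw [h3, h4]
  simp only [Finset.sum_const, Finset.card_range, nsmul_eq_mul]
  split_ifs with h
  · rw [Int.natCast_natAbs, abs_of_pos h]; ring
  · rw [Int.natCast_natAbs, abs_of_neg (by omega)]; ring

/-- Elements `x i` of a group satisfying the Wirtinger relations of the twist knot. -/
def IsTwistColoring (n : ℤ) (x : ℕ → G) : Prop :=
  (∀ i < 2 * n.natAbs + 1,
    x (i + 1) = x (twistOver n i) ^ (-twistSign n i) * x i * x (twistOver n i) ^ twistSign n i) ∧
  -- The last clasp crossing, kept apart because there the cyclic numbering of the arcs returns to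
  -- `0`.
  x 0 = (x n.natAbs)⁻¹ * x (2 * n.natAbs + 1) * x n.natAbs

theorem isTwistColoring_of_hom {n : ℤ} (ρ : (twistKnot n).KnotGroup →* G) :
    IsTwistColoring n fun i => ρ ((twistKnot n).arc (Fin.ofNat _ i)) := by
  have key : ∀ i, i < 2 * n.natAbs + 2 →
      ρ ((twistKnot n).arc (Fin.ofNat _ (i + 1))) =
      ρ ((twistKnot n).arc (Fin.ofNat _ (twistOver n i))) ^ (-twistSign n i) *
      ρ ((twistKnot n).arc (Fin.ofNat _ i)) *
      ρ ((twistKnot n).arc (Fin.ofNat _ (twistOver n i))) ^ twistSign n i := by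
    intro i hi
    have h := congrArg ρ ((twistKnot n).arc_add_one ⟨i, hi⟩)
    simp only [map_mul, map_zpow, twistKnot_sign_coe] at h
    have e1 : (⟨i, hi⟩ : Fin (2 * n.natAbs + 2)) = Fin.ofNat _ i := by
      ext; simp [Nat.mod_eq_of_lt hi]
    have e2 : (⟨i, hi⟩ : Fin (2 * n.natAbs + 2)) + 1 = Fin.ofNat _ (i + 1) := by
      ext; simp [Fin.val_add]
    have e3 : (twistKnot n).overArc ⟨i, hi⟩ = Fin.ofNat _ (twistOver n i) := by
      ext
      rw [twistKnot_overArc_val, Fin.val_ofNat, Nat.mod_eq_of_lt]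
      rw [← twistKnot_overArc_val n ⟨i, hi⟩]
      exact Fin.is_lt _
    rw [e2, e3, e1] at h
    exact h
  refine ⟨fun i hi => key i (by omega), ?_⟩
  have h := key (2 * n.natAbs + 1) (by omega)
  have e : (Fin.ofNat (2 * n.natAbs + 2) (2 * n.natAbs + 1 + 1)) = Fin.ofNat _ 0 := by
    ext; simp
  have e1 : twistOver n (2 * n.natAbs + 1) = n.natAbs := by
    rw [twistOver, if_neg (by omega), if_pos rfl]
  have e2 : twistSign n (2 * n.natAbs + 1) = 1 := by simp [twistSign]
  rw [e, e1, e2] at h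
  simpa using h

theorem exists_hom_of_isTwistColoring {n : ℤ} {x : ℕ → G} (hx : IsTwistColoring n x) :
    ∃ ρ : (twistKnot n).KnotGroup →* G, ∀ i, ρ ((twistKnot n).arc i) = x i := by
  apply (twistKnot n).exists_hom_of_wirtinger
  intro i
  rw [twistKnot_sign_coe, twistKnot_overArc_val]
  have hi := i.2
  rcases Nat.lt_or_ge (i : ℕ) (2 * n.natAbs + 1) with h | h
  · rw [← hx.1 i h, Fin.val_add_one_of_lt' (by omega)]
  · have hi' : (i : ℕ) = 2 * n.natAbs + 1 := by omega
    have e1 : twistOver n (2 * n.natAbs + 1) = n.natAbs := by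
      rw [twistOver, if_neg (by omega), if_pos rfl]
    have e2 : twistSign n (2 * n.natAbs + 1) = 1 := by simp [twistSign]
    have e3 : ((i + 1 : Fin (2 * n.natAbs + 2)) : ℕ) = 0 := by
      simp [Fin.val_add, hi']
    rw [hi', e1, e2, e3, hx.2]
    simp

theorem longitude_eq_of_hom {n : ℤ} (hn : n ≠ 0) {x : ℕ → G} (ρ : (twistKnot n).KnotGroup →* G)
    (hρ : ∀ i : Fin _, ρ ((twistKnot n).arc i) = x i) :
    ρ (twistKnot n).longitude =
      ((List.range (2 * n.natAbs + 2)).map fun i => x (twistOver n i) ^ twistSign n i).prod *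
        x 0 ^ (2 * n - 2) := by
  rw [KnotDiagram.longitude, sum_twistSign hn, map_mul, map_zpow, KnotDiagram.meridian, hρ,
    map_list_prod, List.map_ofFn, ← list_ofFn_fin_eq]
  congr 2
  · congr 1
    ext i
    simp [hρ, twistKnot_overArc_val, twistKnot_sign_coe]
  · ring

theorem prod_twist (k : ℕ) (f : ℕ → G) :
    ((List.range (2 * k + 2)).map f).prod = ((List.range k).map f).prod * f k *
      ((List.range k).map fun j => f (k + 1 + j)).prod * f (2 * k + 1) := by
  rw [range_two_mul_add_two]
  simp [Function.comp_def, mul_assoc]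

/-- The last clasp crossing gives `q = b a b⁻¹` for arc `2k + 1`, so the conjugating element `q⁻¹ a`
of the twist region is the clasp commutator. Following the first strand through all `k` crossings
then says that `w^n` conjugates `a` to `b`, which is the relation. -/
theorem IsTwistColoring.relation {n : ℤ} (hn : n ≠ 0) {x : ℕ → G} (hx : IsTwistColoring n x) :
    twistWord (x 0) (x n.natAbs) ^ n * x n.natAbs = x 0 * twistWord (x 0) (x n.natAbs) ^ n ∧
    ((List.range (2 * n.natAbs + 2)).map fun i => x (twistOver n i) ^ twistSign n i).prod *
        x 0 ^ (2 * n - 2) =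
      twistWord (x 0) (x n.natAbs) ^ n * twistWord (x n.natAbs) (x 0) ^ n := by
  obtain ⟨hx, h0⟩ := hx
  have hq : x (2 * n.natAbs + 1) = x n.natAbs * x 0 * (x n.natAbs)⁻¹ := by rw [h0]; group
  have hv : (x (2 * n.natAbs + 1))⁻¹ * x 0 = twistWord (x 0) (x n.natAbs) := by
    rw [hq, twistWord]; group
  have o1 : twistOver n n.natAbs = 2 * n.natAbs + 1 := by simp [twistOver]
  have o2 : twistOver n (2 * n.natAbs + 1) = n.natAbs := by
    rw [twistOver, if_neg (by omega), if_pos rfl]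
  have s1 : twistSign n n.natAbs = 1 := by simp [twistSign]
  have s2 : twistSign n (2 * n.natAbs + 1) = 1 := by simp [twistSign]
  rcases lt_or_gt_of_ne hn with hn | hn
  · have hO : ∀ i, i ≠ n.natAbs → i ≠ 2 * n.natAbs + 1 →
        twistOver n i = 2 * n.natAbs + 1 - i := by
      intro i h1 h2
      rw [twistOver, if_neg h1, if_neg h2, if_neg (by omega)]
    have hS : ∀ i, twistSign n i = 1 := by
      intro i
      rw [twistSign, if_neg (show ¬ 0 < n by omega), ite_self]
    have arcs := neg_twist_arcs (k := n.natAbs) (x := x)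
      (fun i hi => by
        rw [hx i (by omega), hO i (by omega) (by omega), hS]; simp)
      (fun i hi => by
        have := hx (2 * n.natAbs - i) (by omega)
        rw [hO _ (by omega) (by omega), hS,
          show 2 * n.natAbs - i + 1 = 2 * n.natAbs + 1 - i by omega,
          show 2 * n.natAbs + 1 - (2 * n.natAbs - i) = i + 1 by omega] at this
        rw [this]; simp)
    have hp : twistWord (x 0) (x n.natAbs) ^ n = (twistWord (x 0) (x n.natAbs) ^ n.natAbs)⁻¹ := by
      rw [← zpow_natCast, ← zpow_neg, Int.natCast_natAbs, abs_of_neg hn, neg_neg]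
    have rel : twistWord (x 0) (x n.natAbs) ^ n * x n.natAbs =
        x 0 * twistWord (x 0) (x n.natAbs) ^ n := by
      have := (arcs n.natAbs le_rfl).1
      rw [hv] at this
      rw [hp]
      generalize twistWord (x 0) (x n.natAbs) ^ n.natAbs = c at this ⊢
      rw [this]
      group
    refine ⟨rel, ?_⟩
    rw [← twist_longitude_eq rel, prod_twist, o1, o2, s1, s2, zpow_one, zpow_one,
      prod_range_neg (k := n.natAbs) (p := x 0) (q := x (2 * n.natAbs + 1)) _ _ le_rfl,
      prod_range_neg' (k := n.natAbs) (p := x 0) (q := x (2 * n.natAbs + 1)) _ _ le_rfl]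
    · rw [hv, hp, Nat.sub_self, pow_zero, ← hq]
      have e1 : ∀ g : G, g ^ (-n) = g ^ n.natAbs := by
        intro g; rw [← zpow_natCast, Int.natCast_natAbs, abs_of_neg hn]
      rw [e1, e1]
      group
    · intro i hi
      rw [hS, zpow_one, hO _ (by omega) (by omega),
        show 2 * n.natAbs + 1 - (n.natAbs + 1 + i) = n.natAbs - i by omega]
      exact (arcs _ (by omega)).1
    · intro i hi
      rw [hS, zpow_one, hO _ (by omega) (by omega)]
      exact (arcs i (by omega)).2
  · have hO : ∀ i, i ≠ n.natAbs → i ≠ 2 * n.natAbs + 1 → twistOver n i = 2 * n.natAbs - i := by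
      intro i h1 h2
      rw [twistOver, if_neg h1, if_neg h2, if_pos hn]
    have hS : ∀ i, i ≠ n.natAbs → i ≠ 2 * n.natAbs + 1 → twistSign n i = -1 := by
      intro i h1 h2
      rw [twistSign, if_neg (by omega), if_pos hn]
    have arcs := pos_twist_arcs (k := n.natAbs) (x := x)
      (fun i hi => by
        rw [hx i (by omega), hO i (by omega) (by omega), hS i (by omega) (by omega)]; simp)
      (fun i hi => by
        have := hx (2 * n.natAbs - i) (by omega)
        rw [hO _ (by omega) (by omega), hS _ (by omega) (by omega),
          show 2 * n.natAbs - i + 1 = 2 * n.natAbs + 1 - i by omega,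
          show 2 * n.natAbs - (2 * n.natAbs - i) = i by omega] at this
        rw [this]; simp)
    have hp : twistWord (x 0) (x n.natAbs) ^ n = twistWord (x 0) (x n.natAbs) ^ n.natAbs := by
      rw [← zpow_natCast, Int.natCast_natAbs, abs_of_pos hn]
    have rel : twistWord (x 0) (x n.natAbs) ^ n * x n.natAbs =
        x 0 * twistWord (x 0) (x n.natAbs) ^ n := by
      have := (arcs n.natAbs le_rfl).1
      rw [hv] at this
      rw [hp]
      generalize twistWord (x 0) (x n.natAbs) ^ n.natAbs = c at this ⊢
      rw [this]
      group
    refine ⟨rel, ?_⟩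
    rw [← twist_longitude_eq rel, prod_twist, o1, o2, s1, s2, zpow_one, zpow_one,
      prod_range_pos (k := n.natAbs) (p := x 0) (q := x (2 * n.natAbs + 1)) _ _ le_rfl,
      prod_range_pos' (k := n.natAbs) (p := x 0) (q := x (2 * n.natAbs + 1)) _ _ le_rfl]
    · rw [hv, hp, Nat.sub_self, pow_zero, ← hq]
      have e1 : ∀ g : G, g ^ (-n) = (g ^ n.natAbs)⁻¹ := by
        intro g; rw [← zpow_natCast, Int.natCast_natAbs, abs_of_pos hn, zpow_neg]
      rw [e1, e1]
      group
    · intro i hi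
      rw [hS _ (by omega) (by omega), hO _ (by omega) (by omega), zpow_neg_one,
        show 2 * n.natAbs - (n.natAbs + 1 + i) = n.natAbs - 1 - i by omega,
        (arcs (n.natAbs - 1 - i) (by omega)).1]
      group
    · intro i hi
      rw [hS _ (by omega) (by omega), hO _ (by omega) (by omega), zpow_neg_one,
        show 2 * n.natAbs - i = 2 * n.natAbs + 1 - (i + 1) by omega,
        (arcs (i + 1) (by omega)).2]
      group

/-- The arc formulas of the twist regions serve as the definition of the coloring. The horizontal
crossings then hold automatically; the relation is needed only to identify arc `k` with `b` at the
clasp. -/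
theorem exists_isTwistColoring {n : ℤ} (hn : n ≠ 0) {a b : G}
    (h : twistWord a b ^ n * b = a * twistWord a b ^ n) :
    ∃ x : ℕ → G, IsTwistColoring n x ∧ x 0 = a ∧ x n.natAbs = b := by
  obtain ⟨v, hv⟩ : ∃ v, v = twistWord a b := ⟨_, rfl⟩
  obtain ⟨q, hq⟩ : ∃ q, q = b * a * b⁻¹ := ⟨_, rfl⟩
  rw [← hv] at h
  have hvq : v = q⁻¹ * a := by rw [hv, hq, twistWord]; group
  -- The crossing at the end of arc `k`: the next arc is a conjugate of `q = a v⁻¹` by `v ^ n`, and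
  -- hence equals `b v⁻¹`.
  have hclasp : b * v⁻¹ = q⁻¹ * b * q := by rw [hv, hq, twistWord]; group
  have hb : b = (v ^ n)⁻¹ * a * v ^ n := by rw [mul_assoc, ← h]; group
  have hqv : q = a * v⁻¹ := by rw [hvq]; group
  have hb0 : a = b⁻¹ * q * b := by rw [hq]; group
  rcases lt_or_gt_of_ne hn with hn | hn
  · have hb' : b = v ^ n.natAbs * a * (v ^ n.natAbs)⁻¹ := by
      rw [← zpow_natCast, ← zpow_neg, Int.natCast_natAbs, abs_of_neg hn, neg_neg, zpow_neg]
      exact hb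
    have hv0 : (v ^ 0 * q * (v ^ 0)⁻¹) = q := by simp
    refine ⟨fun i => if i ≤ n.natAbs then v ^ i * a * (v ^ i)⁻¹ else
      v ^ (2 * n.natAbs + 1 - i) * q * (v ^ (2 * n.natAbs + 1 - i))⁻¹, ⟨?_, ?_⟩, by simp, ?_⟩
    · intro i hi
      have hs : twistSign n i = 1 := by
        rw [twistSign, if_neg (show ¬ 0 < n by omega), ite_self]
      simp only [hs, zpow_one, zpow_neg_one]
      rcases lt_trichotomy i n.natAbs with h1 | h1 | h1
      · have ho : twistOver n i = 2 * n.natAbs + 1 - i := by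
          rw [twistOver, if_neg (by omega), if_neg (by omega), if_neg (by omega)]
        rw [ho, if_pos (by omega), if_neg (by omega), if_pos (by omega),
          show 2 * n.natAbs + 1 - (2 * n.natAbs + 1 - i) = i by omega, pow_succ, hqv]
        group
      · have ho : twistOver n i = 2 * n.natAbs + 1 := by rw [twistOver, if_pos h1]
        rw [ho, if_neg (by omega), if_neg (by omega), if_pos (by omega), Nat.sub_self, hv0, h1,
          show 2 * n.natAbs + 1 - (n.natAbs + 1) = n.natAbs by omega, ← hb', ← hclasp, hqv]
        conv_rhs => rw [hb']
        group
      · have ho : twistOver n i = 2 * n.natAbs + 1 - i := by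
          rw [twistOver, if_neg (by omega), if_neg (by omega), if_neg (by omega)]
        rw [ho, if_neg (by omega), if_pos (by omega), if_neg (by omega),
          show 2 * n.natAbs + 1 - i = 2 * n.natAbs + 1 - (i + 1) + 1 by omega, pow_succ, hqv]
        group
    · simp only [Nat.zero_le, if_true, le_refl, Nat.sub_self]
      rw [if_neg (by omega), hv0, ← hb', ← hb0]
      simp
    · simp only [le_refl, if_true]
      exact hb'.symm
  · have hb' : b = (v ^ n.natAbs)⁻¹ * a * v ^ n.natAbs := by
      rw [← zpow_natCast, Int.natCast_natAbs, abs_of_pos hn]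
      exact hb
    have hv0 : ((v ^ 0)⁻¹ * q * v ^ 0) = q := by simp
    refine ⟨fun i => if i ≤ n.natAbs then (v ^ i)⁻¹ * a * v ^ i else
      (v ^ (2 * n.natAbs + 1 - i))⁻¹ * q * v ^ (2 * n.natAbs + 1 - i), ⟨?_, ?_⟩, by simp, ?_⟩
    · intro i hi
      rcases lt_trichotomy i n.natAbs with h1 | h1 | h1
      · have hs : twistSign n i = -1 := by rw [twistSign, if_neg (by omega), if_pos hn]
        have ho : twistOver n i = 2 * n.natAbs - i := by
          rw [twistOver, if_neg (by omega), if_neg (by omega), if_pos hn]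
        simp only [hs, zpow_neg_one, neg_neg, zpow_one]
        rw [ho, if_pos (by omega), if_neg (by omega), if_pos (by omega),
          show 2 * n.natAbs + 1 - (2 * n.natAbs - i) = i + 1 by omega, pow_succ', hqv]
        group
      · have hs : twistSign n i = 1 := by simp [twistSign, h1]
        have ho : twistOver n i = 2 * n.natAbs + 1 := by rw [twistOver, if_pos h1]
        simp only [hs, zpow_one, zpow_neg_one]
        rw [ho, if_neg (by omega), if_neg (by omega), if_pos (by omega), Nat.sub_self, hv0, h1,
          show 2 * n.natAbs + 1 - (n.natAbs + 1) = n.natAbs by omega, ← hb', ← hclasp, hqv]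
        conv_rhs => rw [hb']
        group
      · have hs : twistSign n i = -1 := by rw [twistSign, if_neg (by omega), if_pos hn]
        have ho : twistOver n i = 2 * n.natAbs - i := by
          rw [twistOver, if_neg (by omega), if_neg (by omega), if_pos hn]
        simp only [hs, zpow_neg_one, neg_neg, zpow_one]
        rw [ho, if_neg (by omega), if_pos (by omega), if_neg (by omega),
          show 2 * n.natAbs + 1 - i = 2 * n.natAbs - i + 1 by omega,
          show 2 * n.natAbs + 1 - (i + 1) = 2 * n.natAbs - i by omega, pow_succ', hqv]
        group
    · simp only [Nat.zero_le, if_true, le_refl, Nat.sub_self]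
      rw [if_neg (by omega), hv0, ← hb', ← hb0]
      simp
    · simp only [le_refl, if_true]
      exact hb'.symm

/-- A homomorphism from the knot group of a twist knot gives two elements `a`, `b` satisfying a
single relation; meridian and longitude are words in `a` and `b`. -/
theorem twistKnot_relation_of_hom {n : ℤ} (hn : n ≠ 0) (ρ : (twistKnot n).KnotGroup →* G) :
    ∃ a b : G, twistWord a b ^ n * b = a * twistWord a b ^ n ∧ ρ (twistKnot n).meridian = a ∧
      ρ (twistKnot n).longitude = twistWord a b ^ n * twistWord b a ^ n := by
  have hc := isTwistColoring_of_hom ρ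
  have hr := hc.relation hn
  refine ⟨_, _, hr.1, rfl, ?_⟩
  rw [← hr.2]
  apply longitude_eq_of_hom hn (x := fun i => ρ ((twistKnot n).arc (Fin.ofNat _ i)))
  intro i
  simp

theorem exists_hom_of_twistKnot_relation {n : ℤ} (hn : n ≠ 0) {a b : G}
    (h : twistWord a b ^ n * b = a * twistWord a b ^ n) :
    ∃ ρ : (twistKnot n).KnotGroup →* G, ρ (twistKnot n).meridian = a ∧
      ρ (twistKnot n).longitude = twistWord a b ^ n * twistWord b a ^ n := by
  obtain ⟨x, hx, rfl, rfl⟩ := exists_isTwistColoring hn h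
  obtain ⟨ρ, hρ⟩ := exists_hom_of_isTwistColoring hx
  refine ⟨ρ, hρ 0, ?_⟩
  rw [← (hx.relation hn).2]
  exact longitude_eq_of_hom hn ρ hρ

end TwistKnotGroup

/-! ### The Riley equation for pairs of matrices in `SL(2)`. -/

section Riley

open Polynomial Matrix

/-- The trace of the clasp commutator of a twist knot, in terms of `s = tr (a b⁻¹) - 1` and
`X = M² + M⁻²`. -/
noncomputable def claspTrace {R : Type*} [CommRing R] (s X : R) : R := s ^ 2 - s * X + X + 1

/-- The value of the Riley polynomial of the twist knot at `s = tr (a b⁻¹) - 1` and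
`X = M² + M⁻²`. -/
noncomputable def riley {R : Type*} [CommRing R] (n : ℤ) (s X : R) : R :=
  (Chebyshev.S R n).eval (claspTrace s X) - (X - s) * (Chebyshev.S R (n - 1)).eval (claspTrace s X)

variable {K : Type*} [Field K]

theorem sl2_sq (V : Matrix.SpecialLinearGroup (Fin 2) K) :
    (V.1 * V.1 : Matrix (Fin 2) (Fin 2) K) = V.1.trace • V.1 - 1 := by
  have h := V.1.aeval_self_charpoly
  rw [Matrix.charpoly_fin_two, V.2] at h
  simp only [map_add, map_sub, map_mul, map_pow, aeval_X, aeval_C, map_one] at h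
  rw [Algebra.algebraMap_eq_smul_one, smul_mul_assoc, one_mul] at h
  rw [pow_two] at h
  rw [← sub_eq_zero, ← h]
  abel

/-- By Cayley–Hamilton, powers of `V` satisfy the Chebyshev recursion with parameter `tr V`. As `S`
is indexed by `ℤ`, one formula serves both signs of the exponent. -/
theorem sl2_zpow (V : Matrix.SpecialLinearGroup (Fin 2) K) (n : ℤ) :
    (V ^ n).1 = (Chebyshev.S K (n - 1)).eval V.1.trace • V.1 -
      (Chebyshev.S K (n - 2)).eval V.1.trace • (1 : Matrix (Fin 2) (Fin 2) K) := by
  have hsq := sl2_sq V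
  have hinv : (V⁻¹).1 = V.1.trace • (1 : Matrix (Fin 2) (Fin 2) K) - V.1 := by
    have h1 : (V⁻¹).1 * V.1 = 1 := by
      rw [← Matrix.SpecialLinearGroup.coe_mul, inv_mul_cancel, Matrix.SpecialLinearGroup.coe_one]
    have h2 : V.1 * (V⁻¹).1 = 1 := by
      rw [← Matrix.SpecialLinearGroup.coe_mul, mul_inv_cancel, Matrix.SpecialLinearGroup.coe_one]
    have h3 : (V.1 * V.1) * (V⁻¹).1 = (V.1.trace • V.1 - 1) * (V⁻¹).1 := by rw [hsq]
    rw [mul_assoc, h2, mul_one, sub_mul, smul_mul_assoc, h2, one_mul] at h3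
    exact eq_sub_of_add_eq' (eq_sub_iff_add_eq.1 h3)
  induction n with
  | zero => simp [Chebyshev.S_neg_one, Chebyshev.S_neg_two]
  | succ n ih =>
    have hS : (Chebyshev.S K (n + 1 - 1)).eval V.1.trace =
        V.1.trace * (Chebyshev.S K (n - 1)).eval V.1.trace -
          (Chebyshev.S K (n - 2)).eval V.1.trace := by
      have := congrArg (eval V.1.trace) (Chebyshev.S_eq K (n : ℤ))
      simpa using this
    rw [_root_.zpow_add_one, Matrix.SpecialLinearGroup.coe_mul, ih, hS, sub_mul, smul_mul_assoc, hsq,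
      show (n : ℤ) + 1 - 2 = n - 1 by ring]
    simp only [smul_mul_assoc, one_mul, sub_smul, smul_sub, mul_smul]
    rw [smul_comm]
    abel
  | pred n ih =>
    have hS : (Chebyshev.S K (-(n : ℤ) - 1 - 2)).eval V.1.trace =
        V.1.trace * (Chebyshev.S K (-(n : ℤ) - 2)).eval V.1.trace -
          (Chebyshev.S K (-(n : ℤ) - 1)).eval V.1.trace := by
      have := congrArg (eval V.1.trace) (Chebyshev.S_sub_two K (-(n : ℤ) - 1))
      rw [show -(n : ℤ) - 1 - 1 = -(n : ℤ) - 2 by ring] at this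
      simpa using this
    rw [_root_.zpow_sub_one, Matrix.SpecialLinearGroup.coe_mul, ih, hS, hinv,
      show -(n : ℤ) - 1 - 1 = -n - 2 by ring]
    simp only [mul_sub, sub_mul, smul_mul_assoc, mul_smul_comm, one_mul, mul_one, hsq, sub_smul,
      smul_sub, mul_smul]
    rw [smul_comm V.1.trace]
    abel_nf

theorem smul_fin_two_sub_smul_one (α β x y z w : K) :
    α • !![x, y; z, w] - β • (1 : Matrix (Fin 2) (Fin 2) K) =
      !![α * x - β, α * y; α * z, α * w - β] := by
  ext i j
  fin_cases i <;> fin_cases j <;> simp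

variable {M g r : K} {a b : Matrix.SpecialLinearGroup (Fin 2) K}

/-- In Riley's normal form `tr (a b⁻¹) = 2 - g r`, so `1 - g r` is the quantity called `s`
elsewhere. -/
theorem twistWord_val (hM : M ≠ 0) (ha : a.1 = !![M, g; 0, M⁻¹]) (hb : b.1 = !![M, 0; r, M⁻¹]) :
    (twistWord a b).1 = !![1 + g * r * M ^ 2, g * (M⁻¹ - M * (1 - g * r));
      r * (M⁻¹ - (1 - g * r) * M), g * r * M⁻¹ ^ 2 + (1 - g * r) ^ 2] ∧
    (twistWord b a).1 = !![(1 - g * r) ^ 2 + g * r * M ^ 2, g * (M - (1 - g * r) * M⁻¹);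
      r * (M - M⁻¹ * (1 - g * r)), 1 + g * r * M⁻¹ ^ 2] := by
  simp only [twistWord, Matrix.SpecialLinearGroup.coe_mul, Matrix.SpecialLinearGroup.coe_inv, ha, hb,
    adjugate_fin_two_of, Matrix.mul_fin_two]
  constructor <;>
  · ext i j
    fin_cases i <;> fin_cases j <;> simp <;> field_simp <;> ring

theorem trace_twistWord (hM : M ≠ 0) (ha : a.1 = !![M, g; 0, M⁻¹]) (hb : b.1 = !![M, 0; r, M⁻¹]) :
    (twistWord a b).1.trace = claspTrace (1 - g * r) (M ^ 2 + M⁻¹ ^ 2) ∧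
    (twistWord b a).1.trace = claspTrace (1 - g * r) (M ^ 2 + M⁻¹ ^ 2) := by
  obtain ⟨h1, h2⟩ := twistWord_val hM ha hb
  rw [h1, h2, trace_fin_two_of, trace_fin_two_of, claspTrace]
  constructor <;> ring

/-- Riley's observation that four matrix equations are one: `w^n` is a combination of `w` and `1`,
and for both of these the difference `w b - a w`, respectively `b - a`, is a scalar multiple of `a -
b`. -/
theorem twist_relation_sub (hM : M ≠ 0) (ha : a.1 = !![M, g; 0, M⁻¹])
    (hb : b.1 = !![M, 0; r, M⁻¹]) (n : ℤ) :
    (twistWord a b ^ n * b).1 - (a * twistWord a b ^ n).1 =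
      (-riley n (1 - g * r) (M ^ 2 + M⁻¹ ^ 2)) • (a.1 - b.1) := by
  have hS : (Chebyshev.S K n).eval (claspTrace (1 - g * r) (M ^ 2 + M⁻¹ ^ 2)) =
      claspTrace (1 - g * r) (M ^ 2 + M⁻¹ ^ 2) *
        (Chebyshev.S K (n - 1)).eval (claspTrace (1 - g * r) (M ^ 2 + M⁻¹ ^ 2)) -
        (Chebyshev.S K (n - 2)).eval (claspTrace (1 - g * r) (M ^ 2 + M⁻¹ ^ 2)) := by
    rw [Chebyshev.S_eq K n]; simp
  rw [Matrix.SpecialLinearGroup.coe_mul, Matrix.SpecialLinearGroup.coe_mul, sl2_zpow,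
    (trace_twistWord hM ha hb).1, riley, hS]
  generalize (Chebyshev.S K (n - 1)).eval (claspTrace (1 - g * r) (M ^ 2 + M⁻¹ ^ 2)) = α
  generalize (Chebyshev.S K (n - 2)).eval (claspTrace (1 - g * r) (M ^ 2 + M⁻¹ ^ 2)) = β
  rw [(twistWord_val hM ha hb).1, ha, hb, claspTrace, smul_fin_two_sub_smul_one,
    Matrix.mul_fin_two, Matrix.mul_fin_two]
  ext i j
  fin_cases i <;> fin_cases j <;> simp <;> field_simp <;> ring

theorem twist_relation_iff (hM : M ≠ 0) (hg : g ≠ 0) (ha : a.1 = !![M, g; 0, M⁻¹])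
    (hb : b.1 = !![M, 0; r, M⁻¹]) (n : ℤ) :
    twistWord a b ^ n * b = a * twistWord a b ^ n ↔
      riley n (1 - g * r) (M ^ 2 + M⁻¹ ^ 2) = 0 := by
  have h := twist_relation_sub hM ha hb n
  constructor
  · intro e
    rw [e, sub_self] at h
    have := congrFun (congrFun h 0) 1
    simpa [ha, hb, hg] using this
  · intro e
    rw [e, neg_zero, zero_smul, sub_eq_zero] at h
    exact Subtype.ext h

/-- Two consecutive Chebyshev values `α`, `β` satisfy a quadratic identity, and the Riley equation
makes `β` a multiple of `α`. So `α²` is an explicit rational function of `s` and `M`, and the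
longitude entries involve `α` only through `α²`. -/
theorem twist_longitude_val (hM : M ≠ 0) (ha : a.1 = !![M, g; 0, M⁻¹])
    (hb : b.1 = !![M, 0; r, M⁻¹]) {n : ℤ}
    (h : riley n (1 - g * r) (M ^ 2 + M⁻¹ ^ 2) = 0) :
    (twistWord a b ^ n * twistWord b a ^ n).1 1 0 = 0 ∧
    (twistWord a b ^ n * twistWord b a ^ n).1 0 0 * (M ^ 2 * (1 - g * r) - 1) =
      M ^ 2 - (1 - g * r) ∧
    M ^ 2 * (1 - g * r) - 1 ≠ 0 := by
  obtain ⟨s, hs⟩ : ∃ s, s = 1 - g * r := ⟨_, rfl⟩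
  have hS : (Chebyshev.S K n).eval (claspTrace s (M ^ 2 + M⁻¹ ^ 2)) =
      claspTrace s (M ^ 2 + M⁻¹ ^ 2) *
        (Chebyshev.S K (n - 1)).eval (claspTrace s (M ^ 2 + M⁻¹ ^ 2)) -
        (Chebyshev.S K (n - 2)).eval (claspTrace s (M ^ 2 + M⁻¹ ^ 2)) := by
    rw [Chebyshev.S_eq K n]; simp
  have hdet := congrArg (eval (claspTrace s (M ^ 2 + M⁻¹ ^ 2)))
    (Chebyshev.S_sq_add_S_sq K (n - 2))
  rw [show n - 2 + 1 = n - 1 by ring] at hdet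
  simp only [eval_add, eval_sub, eval_mul, eval_pow, eval_X, eval_one] at hdet
  obtain ⟨t1, t2⟩ := trace_twistWord hM ha hb
  obtain ⟨v1, v2⟩ := twistWord_val hM ha hb
  rw [Matrix.SpecialLinearGroup.coe_mul, sl2_zpow, sl2_zpow, t1, t2, v1, v2]
  rw [riley] at h
  rw [← hs] at h ⊢
  rw [hS] at h
  generalize (Chebyshev.S K (n - 1)).eval (claspTrace s (M ^ 2 + M⁻¹ ^ 2)) = α at *
  generalize (Chebyshev.S K (n - 2)).eval (claspTrace s (M ^ 2 + M⁻¹ ^ 2)) = β at *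
  have hβ : β = α * (claspTrace s (M ^ 2 + M⁻¹ ^ 2) - (M ^ 2 + M⁻¹ ^ 2 - s)) := by
    linear_combination -h
  rw [hβ, claspTrace] at hdet
  rw [hβ, claspTrace, smul_fin_two_sub_smul_one, smul_fin_two_sub_smul_one, Matrix.mul_fin_two]
  have hgr : g * r = 1 - s := by rw [hs]; ring
  -- The factored form also shows that `s M² - 1` cannot vanish, since the right side is nonzero.
  have hD : α ^ 2 * ((s + 1 - M ^ 2 - M⁻¹ ^ 2) * (s - M ^ 2) * (s * M ^ 2 - 1)) = M ^ 2 := by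
    have h1 : M * M⁻¹ = 1 := mul_inv_cancel₀ hM
    field_simp at hdet ⊢
    linear_combination hdet
  refine ⟨?_, ?_, ?_⟩
  · simp only [Matrix.of_apply, Matrix.cons_val', Matrix.cons_val_zero, Matrix.cons_val_one]
    rw [hgr]
    field_simp
    ring
  · simp only [Matrix.of_apply, Matrix.cons_val', Matrix.cons_val_zero]
    rw [hgr, show α * (g * (M⁻¹ - M * s)) * (α * (r * (M - M⁻¹ * s))) =
      α ^ 2 * (1 - s) * (M⁻¹ - M * s) * (M - M⁻¹ * s) by rw [← hgr]; ring]
    field_simp at hD ⊢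
    linear_combination (M ^ 2 - s) * hD
  · intro h0
    rw [show s * M ^ 2 - 1 = 0 by linear_combination h0, mul_zero, mul_zero] at hD
    exact pow_ne_zero 2 hM hD.symm

end Riley

/-! ### The eigenvalue set in terms of Riley points. -/

section EigenvalueSet

open Polynomial Matrix

variable {K : Type*} [Field K]

theorem sl2_zpow_of_upper {V : Matrix.SpecialLinearGroup (Fin 2) K} {y : K}
    (h : V.1 = !![1, y; 0, 1]) (n : ℤ) : (V ^ n).1 0 0 = 1 ∧ (V ^ n).1 1 0 = 0 := by
  rw [sl2_zpow, h, smul_fin_two_sub_smul_one, Matrix.trace_fin_two_of, one_add_one_eq_two,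
    Chebyshev.S_eval_two, Chebyshev.S_eval_two]
  constructor
  · simp
    ring
  · simp

theorem sl2_zpow_of_lower {V : Matrix.SpecialLinearGroup (Fin 2) K} {y : K}
    (h : V.1 = !![1, 0; y, 1]) (n : ℤ) : (V ^ n).1 0 0 = 1 ∧ (V ^ n).1 0 1 = 0 := by
  rw [sl2_zpow, h, smul_fin_two_sub_smul_one, Matrix.trace_fin_two_of, one_add_one_eq_two,
    Chebyshev.S_eval_two, Chebyshev.S_eval_two]
  constructor
  · simp
    ring
  · simp

theorem sl2_eq_of_upper {V : Matrix.SpecialLinearGroup (Fin 2) K} (h : V.1 1 0 = 0) :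
    V.1 0 0 ≠ 0 ∧ V.1 = !![V.1 0 0, V.1 0 1; 0, (V.1 0 0)⁻¹] := by
  have hd := V.2
  rw [Matrix.det_fin_two, h, mul_zero, sub_zero] at hd
  have h0 : V.1 0 0 ≠ 0 := left_ne_zero_of_mul_eq_one hd
  refine ⟨h0, ?_⟩
  rw [← eq_inv_of_mul_eq_one_right hd, ← h]
  exact Matrix.eta_fin_two _

theorem sl2_twistWord_of_upper {a b : Matrix.SpecialLinearGroup (Fin 2) K} (ha : a.1 1 0 = 0)
    (hb : b.1 1 0 = 0) : ∃ y, (twistWord a b).1 = !![1, y; 0, 1] := by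
  obtain ⟨ha0, ha⟩ := sl2_eq_of_upper ha
  obtain ⟨hb0, hb⟩ := sl2_eq_of_upper hb
  generalize a.1 0 0 = M at *
  generalize b.1 0 0 = N at *
  generalize a.1 0 1 = g at *
  generalize b.1 0 1 = h at *
  simp only [twistWord, Matrix.SpecialLinearGroup.coe_mul, Matrix.SpecialLinearGroup.coe_inv, ha, hb,
    Matrix.adjugate_fin_two_of, Matrix.mul_fin_two]
  refine ⟨N * M⁻¹ * N⁻¹ * g + (N * M⁻¹ * (-h) + (N * (-g) + h * M) * N) * M⁻¹, ?_⟩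
  ext i j
  fin_cases i <;> fin_cases j <;> simp <;> field_simp

/-- The points of the eigenvalue set of a twist knot that come from irreducible representations. -/
def IsRileyPoint (n : ℤ) (L M : K) : Prop :=
  ∃ s, riley n s (M ^ 2 + M⁻¹ ^ 2) = 0 ∧ s * (1 + L * M ^ 2) = L + M ^ 2

/-- If `a` and `b` can be made simultaneously triangular, their commutators are unipotent and the
longitude has eigenvalue `1`. Otherwise a conjugation fixing the upper triangular shape of `a` and
its diagonal leads to Riley's normal form. -/
theorem riley_of_relation {n : ℤ} {a b : Matrix.SpecialLinearGroup (Fin 2) K}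
    (h : twistWord a b ^ n * b = a * twistWord a b ^ n) (ha : a.1 1 0 = 0)
    (hl : (twistWord a b ^ n * twistWord b a ^ n).1 1 0 = 0) :
    (twistWord a b ^ n * twistWord b a ^ n).1 0 0 = 1 ∨
      IsRileyPoint n ((twistWord a b ^ n * twistWord b a ^ n).1 0 0) (a.1 0 0) := by
  by_cases hb : b.1 1 0 = 0
  · left
    obtain ⟨y, hy⟩ := sl2_twistWord_of_upper ha hb
    obtain ⟨z, hz⟩ := sl2_twistWord_of_upper hb ha
    obtain ⟨h1, h2⟩ := sl2_zpow_of_upper hy n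
    obtain ⟨h3, h4⟩ := sl2_zpow_of_upper hz n
    rw [Matrix.SpecialLinearGroup.coe_mul, Matrix.mul_apply, Fin.sum_univ_two, h1, h3, h4]
    simp
  · obtain ⟨M, hM⟩ : ∃ M, M = a.1 0 0 := ⟨_, rfl⟩
    obtain ⟨r, hr⟩ : ∃ r, r = b.1 1 0 := ⟨_, rfl⟩
    rw [← hr] at hb
    -- The upper right entry is chosen so that conjugation turns the first entry of `b` into `M`. As
    -- `a` and `b` are conjugate, the trace then gives `M⁻¹` as the last entry, and the determinant
    -- makes `b` lower triangular.
    let U : Matrix.SpecialLinearGroup (Fin 2) K :=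
      ⟨!![1, (b.1 0 0 - M) / r; 0, 1], by simp [Matrix.det_fin_two]⟩
    have hU : ∀ W : Matrix.SpecialLinearGroup (Fin 2) K, (MulAut.conj U⁻¹ W).1 =
        !![W.1 0 0 - (b.1 0 0 - M) / r * W.1 1 0,
          (W.1 0 0 - (b.1 0 0 - M) / r * W.1 1 0) * ((b.1 0 0 - M) / r) + W.1 0 1 -
            (b.1 0 0 - M) / r * W.1 1 1;
          W.1 1 0, W.1 1 0 * ((b.1 0 0 - M) / r) + W.1 1 1] := by
      intro W
      rw [MulAut.conj_apply, inv_inv, Matrix.SpecialLinearGroup.coe_mul,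
        Matrix.SpecialLinearGroup.coe_mul, Matrix.SpecialLinearGroup.coe_inv]
      simp only [U, Matrix.adjugate_fin_two_of]
      conv_lhs => rw [Matrix.eta_fin_two W.1]
      rw [Matrix.mul_fin_two, Matrix.mul_fin_two]
      ext i j
      fin_cases i <;> fin_cases j <;> simp <;> ring
    obtain ⟨hM0, ha'⟩ := sl2_eq_of_upper ha
    rw [← hM] at hM0 ha'
    have htr : b.1 0 0 + b.1 1 1 = M + M⁻¹ := by
      have e : b = (twistWord a b ^ n)⁻¹ * a * twistWord a b ^ n := by rw [mul_assoc, ← h]; group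
      have e1 : b.1.trace = a.1.trace := by
        conv_lhs => rw [e]
        rw [Matrix.SpecialLinearGroup.coe_mul, Matrix.SpecialLinearGroup.coe_mul,
          Matrix.trace_mul_cycle, ← Matrix.SpecialLinearGroup.coe_mul, mul_inv_cancel,
          Matrix.SpecialLinearGroup.coe_one, one_mul]
      rw [ha', Matrix.trace_fin_two, Matrix.trace_fin_two_of] at e1
      exact e1
    have hdb := b.2
    rw [Matrix.det_fin_two, ← hr] at hdb
    have hB : (MulAut.conj U⁻¹ b).1 = !![M, 0; r, M⁻¹] := by
      rw [hU, ← hr]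
      have h11 : b.1 1 1 = M + M⁻¹ - b.1 0 0 := by linear_combination htr
      have h01 : b.1 0 1 = (b.1 0 0 * b.1 1 1 - 1) / r := by
        field_simp
        linear_combination -hdb
      rw [h01, h11]
      ext i j
      fin_cases i <;> fin_cases j <;> simp <;> field_simp <;> ring
    obtain ⟨g, hA⟩ : ∃ g, (MulAut.conj U⁻¹ a).1 = !![M, g; 0, M⁻¹] := by
      rw [hU, ha']
      refine ⟨M * ((b.1 0 0 - M) / r) + a.1 0 1 - (b.1 0 0 - M) / r * M⁻¹, ?_⟩
      ext i j
      fin_cases i <;> fin_cases j <;> simp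
    have hrel : twistWord (MulAut.conj U⁻¹ a) (MulAut.conj U⁻¹ b) ^ n * (MulAut.conj U⁻¹ b) =
        (MulAut.conj U⁻¹ a) * twistWord (MulAut.conj U⁻¹ a) (MulAut.conj U⁻¹ b) ^ n := by
      have := congrArg (MulAut.conj U⁻¹).toMonoidHom h
      simp only [map_mul, map_zpow, map_twistWord] at this
      exact this
    have hlam : MulAut.conj U⁻¹ (twistWord a b ^ n * twistWord b a ^ n) =
        twistWord (MulAut.conj U⁻¹ a) (MulAut.conj U⁻¹ b) ^ n *
        twistWord (MulAut.conj U⁻¹ b) (MulAut.conj U⁻¹ a) ^ n := by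
      change (MulAut.conj U⁻¹).toMonoidHom (twistWord a b ^ n * twistWord b a ^ n) = _
      simp only [map_mul, map_zpow, map_twistWord]
      rfl
    have hl0 : (twistWord a b ^ n * twistWord b a ^ n).1 0 0 =
        (MulAut.conj U⁻¹ (twistWord a b ^ n * twistWord b a ^ n)).1 0 0 := by
      rw [hU, hl]
      simp
    rw [hl0, hlam, ← hM]
    generalize MulAut.conj U⁻¹ a = a' at *
    generalize MulAut.conj U⁻¹ b = b' at *
    by_cases hg : g = 0
    · left
      obtain ⟨v1, v2⟩ := twistWord_val hM0 hA hB
      rw [hg] at v1 v2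
      obtain ⟨h1, h2⟩ := sl2_zpow_of_lower (y := r * (M⁻¹ - M)) (V := twistWord a' b')
        (by rw [v1]; simp) n
      obtain ⟨h3, h4⟩ := sl2_zpow_of_lower (y := r * (M - M⁻¹)) (V := twistWord b' a')
        (by rw [v2]; simp) n
      rw [Matrix.SpecialLinearGroup.coe_mul, Matrix.mul_apply, Fin.sum_univ_two, h1, h2, h3]
      simp
    · right
      have hφ := (twist_relation_iff hM0 hg hA hB n).1 hrel
      obtain ⟨-, h2, -⟩ := twist_longitude_val hM0 hA hB hφ
      exact ⟨_, hφ, by linear_combination h2⟩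

theorem exists_relation_of_riley {n : ℤ} {L M : K} (hM : M ≠ 0) (h : IsRileyPoint n L M) :
    ∃ a b : Matrix.SpecialLinearGroup (Fin 2) K,
      twistWord a b ^ n * b = a * twistWord a b ^ n ∧ a.1 1 0 = 0 ∧ a.1 0 0 = M ∧
      (twistWord a b ^ n * twistWord b a ^ n).1 1 0 = 0 ∧
      (twistWord a b ^ n * twistWord b a ^ n).1 0 0 = L := by
  obtain ⟨s, hs, hL⟩ := h
  -- Riley's normal form with `g = 1` and `r = 1 - s`, so that `1 - g r = s`.
  let a : Matrix.SpecialLinearGroup (Fin 2) K :=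
    ⟨!![M, 1; 0, M⁻¹], by simp [Matrix.det_fin_two, hM]⟩
  let b : Matrix.SpecialLinearGroup (Fin 2) K :=
    ⟨!![M, 0; 1 - s, M⁻¹], by simp [Matrix.det_fin_two, hM]⟩
  have hφ : riley n (1 - 1 * (1 - s)) (M ^ 2 + M⁻¹ ^ 2) = 0 := by
    rw [one_mul, sub_sub_cancel]; exact hs
  obtain ⟨h1, h2, h3⟩ := twist_longitude_val (a := a) (b := b) hM rfl rfl hφ
  refine ⟨a, b, (twist_relation_iff hM one_ne_zero rfl rfl n).2 hφ, rfl, rfl, h1, ?_⟩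
  rw [one_mul, sub_sub_cancel] at h2 h3
  apply mul_right_cancel₀ h3
  rw [h2]
  linear_combination -hL

theorem mem_eigenvalueSet_twistKnot {n : ℤ} (hn : n ≠ 0) (x : Fin 2 → ℂ) :
    x ∈ (twistKnot n).eigenvalueSet ↔ x 1 ≠ 0 ∧ (x 0 = 1 ∨ IsRileyPoint n (x 0) (x 1)) := by
  constructor
  · rintro ⟨ρ, h1, h2, h3, h4⟩
    obtain ⟨a, b, hr, ha, hl⟩ := twistKnot_relation_of_hom hn ρ
    rw [hl] at h1 h3
    rw [ha] at h2 h4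
    rw [← h3, ← h4]
    exact ⟨(sl2_eq_of_upper h2).1, riley_of_relation hr h2 h1⟩
  · rintro ⟨h0, h | h⟩
    -- The abelian representation with both generators equal to a diagonal matrix; it accounts for
    -- the line `L = 1`.
    · let a : Matrix.SpecialLinearGroup (Fin 2) ℂ :=
        ⟨!![x 1, 0; 0, (x 1)⁻¹], by simp [Matrix.det_fin_two, h0]⟩
      have hw : twistWord a a = 1 := by simp [twistWord]
      obtain ⟨ρ, h1, h2⟩ := exists_hom_of_twistKnot_relation hn (a := a) (b := a) (by simp [hw])
      refine ⟨ρ, ?_, ?_, ?_, ?_⟩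
      · rw [h2, hw]; simp
      · rw [h1]; rfl
      · rw [h2, hw, h]; simp
      · rw [h1]; rfl
    · obtain ⟨a, b, hr, h1, h2, h3, h4⟩ := exists_relation_of_riley h0 h
      obtain ⟨ρ, h5, h6⟩ := exists_hom_of_twistKnot_relation hn hr
      exact ⟨ρ, by rw [h6, h3], by rw [h5, h1], by rw [h6, h4], by rw [h5, h2]⟩

end EigenvalueSet

/-! ### The explicit polynomial obtained by eliminating `s`. -/

section TwistAPoly

variable {R : Type*} [CommRing R]

/-- The numerator of the trace of the clasp commutator, as a function of the eigenvalues. -/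
def twistT (L M : R) : R :=
  (1 + M ^ 4) + L * (-1 + 2 * M ^ 2 + 2 * M ^ 4 + 2 * M ^ 6 - M ^ 8) + L ^ 2 * (M ^ 4 + M ^ 8)

/-- The denominator of the trace of the clasp commutator, as a function of the eigenvalues. -/
def twistW (L M : R) : R := M ^ 2 * (1 + L * M ^ 2) ^ 2

/-- Homogenized Chebyshev polynomials of the trace of the clasp commutator. -/
def twistQ (L M : R) : ℕ → R
  | 0 => 0
  | 1 => 1
  | j + 2 => twistT L M * twistQ L M (j + 1) - twistW L M ^ 2 * twistQ L M j

/-- The A-polynomial of a twist knot, evaluated at two elements of a commutative ring. -/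
def twistAPoly (n : ℤ) (L M : R) : R :=
  if 0 < n then -(twistQ L M (n.natAbs + 1) -
    (1 + L * M ^ 6) * (1 + L * M ^ 2) * twistQ L M n.natAbs)
  else (1 + L * M ^ 6) * twistQ L M n.natAbs -
    M ^ 4 * (1 + L * M ^ 2) ^ 3 * twistQ L M (n.natAbs - 1)

theorem twistQ_add_two (L M : R) (j : ℕ) : twistQ L M (j + 2) =
    twistT L M * twistQ L M (j + 1) - twistW L M ^ 2 * twistQ L M j := rfl

theorem map_twistQ {S : Type*} [CommRing S] (f : R →+* S) (L M : R) (j : ℕ) :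
    f (twistQ L M j) = twistQ (f L) (f M) j := by
  induction j using Nat.twoStepInduction with
  | zero => simp [twistQ]
  | one => simp [twistQ]
  | more j h1 h2 => simp [twistQ_add_two, h1, h2, twistT, twistW, map_ofNat]

theorem map_twistAPoly {S : Type*} [CommRing S] (f : R →+* S) (n : ℤ) (L M : R) :
    f (twistAPoly n L M) = twistAPoly n (f L) (f M) := by
  unfold twistAPoly
  split_ifs <;> simp [map_twistQ]

theorem twistQ_of_w_eq_zero {L M : R} (h : twistW L M = 0) (j : ℕ) :
    twistQ L M (j + 1) = twistT L M ^ j := by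
  induction j using Nat.twoStepInduction with
  | zero => simp [twistQ]
  | one => simp [twistQ]
  | more j h1 h2 => rw [twistQ_add_two, h2, h]; ring

/-- At `L = 0` the recursion has characteristic roots `1` and `M^4`; these are the two combinations
of consecutive terms that behave geometrically. They give the column `L = 0`, and after rescaling
also the last column. -/
theorem twistQ_zero_left (M : R) (j : ℕ) :
    twistQ 0 M (j + 1) - M ^ 4 * twistQ 0 M j = 1 ∧
      twistQ 0 M (j + 1) - twistQ 0 M j = M ^ (4 * j) := by
  induction j with
  | zero => simp [twistQ]
  | succ j ih =>
    obtain ⟨h1, h2⟩ := ih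
    have hT : twistT 0 M = 1 + M ^ 4 := by simp [twistT]
    have hW : twistW 0 M = M ^ 2 := by simp [twistW]
    rw [twistQ_add_two, hT, hW]
    constructor
    · linear_combination h1
    · rw [show M ^ (4 * (j + 1)) = M ^ 4 * M ^ (4 * j) by ring, ← h2]
      ring

theorem twistAPoly_zero_left_of_pos {n : ℤ} (hn : 0 < n) (M : R) :
    twistAPoly n 0 M = -M ^ (4 * n.natAbs) := by
  rw [twistAPoly, if_pos hn, ← (twistQ_zero_left M n.natAbs).2]
  ring

theorem twistAPoly_zero_left_of_neg {n : ℤ} (hn : n < 0) (M : R) : twistAPoly n 0 M = 1 := by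
  obtain ⟨j, hj⟩ : ∃ j, n.natAbs = j + 1 := ⟨n.natAbs - 1, by omega⟩
  rw [twistAPoly, if_neg (by omega), hj, Nat.add_sub_cancel]
  linear_combination (twistQ_zero_left M j).1

theorem twistW_zero_right (L : R) : twistW L 0 = 0 := by simp [twistW]

theorem twistAPoly_zero_right_of_pos {n : ℤ} (hn : 0 < n) (L : R) :
    twistAPoly n L 0 = L * (1 - L) ^ (n.natAbs - 1) := by
  obtain ⟨j, hj⟩ : ∃ j, n.natAbs = j + 1 := ⟨n.natAbs - 1, by omega⟩
  rw [twistAPoly, if_pos hn, hj, twistQ_of_w_eq_zero (twistW_zero_right L),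
    twistQ_of_w_eq_zero (twistW_zero_right L), Nat.add_sub_cancel]
  simp [twistT, pow_succ]
  ring

theorem twistAPoly_zero_right_of_neg {n : ℤ} (hn : n < 0) (L : R) :
    twistAPoly n L 0 = (1 - L) ^ (n.natAbs - 1) := by
  obtain ⟨j, hj⟩ : ∃ j, n.natAbs = j + 1 := ⟨n.natAbs - 1, by omega⟩
  rw [twistAPoly, if_neg (by omega), hj, twistQ_of_w_eq_zero (twistW_zero_right L),
    Nat.add_sub_cancel]
  simp [twistT]
  ring

section Field

open Polynomial

variable {K : Type*} [Field K]

/-- Clearing denominators: morally `Q_j = W^(j-1) S_{j-1}(T / W)`. The extra factor `W` avoids the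
exponent `-1` at `j = 0`. -/
theorem twistW_mul_twistQ {L M t : K} (ht : t * twistW L M = twistT L M) (j : ℕ) :
    twistW L M * twistQ L M j = twistW L M ^ j * (Chebyshev.S K (j - 1)).eval t := by
  induction j using Nat.twoStepInduction with
  | zero => simp [twistQ, Chebyshev.S_neg_one]
  | one => simp [twistQ]
  | more j h1 h2 =>
    have hS : (Chebyshev.S K ((j + 2 : ℕ) - 1)).eval t =
        t * (Chebyshev.S K ((j + 1 : ℕ) - 1)).eval t - (Chebyshev.S K (j - 1)).eval t := by
      have := congrArg (eval t) (Chebyshev.S_add_two K ((j : ℤ) - 1))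
      simp only [eval_sub, eval_mul, eval_X] at this
      push_cast
      rw [show (j : ℤ) + 2 - 1 = j - 1 + 2 by ring, this,
        show (j : ℤ) - 1 + 1 = j + 1 - 1 by ring]
    rw [twistQ_add_two, hS]
    linear_combination twistT L M * h2 - twistW L M ^ 2 * h1 -
      twistW L M ^ (j + 1) * (Chebyshev.S K ((j + 1 : ℕ) - 1)).eval t * ht

theorem twistAPoly_eq_riley_of_pos {n : ℤ} (hn : 0 < n) {L M s : K} (hM : M ≠ 0)
    (hD : 1 + L * M ^ 2 ≠ 0) (hs : s * (1 + L * M ^ 2) = L + M ^ 2) :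
    twistAPoly n L M = -M ^ (2 * n.natAbs) * (1 + L * M ^ 2) ^ (2 * n.natAbs) *
      riley n s (M ^ 2 + M⁻¹ ^ 2) := by
  have hs' : s = (L + M ^ 2) / (1 + L * M ^ 2) := by field_simp; exact hs
  have ht : claspTrace s (M ^ 2 + M⁻¹ ^ 2) * twistW L M = twistT L M := by
    rw [claspTrace, hs', twistW, twistT]
    field_simp
    ring
  have hm : M⁻¹ ^ 2 * M ^ 2 = 1 := by field_simp
  have he : (M ^ 2 + M⁻¹ ^ 2 - s) * twistW L M = (1 + L * M ^ 6) * (1 + L * M ^ 2) := by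
    rw [twistW]
    linear_combination (1 + L * M ^ 2) ^ 2 * hm - M ^ 2 * (1 + L * M ^ 2) * hs
  have hW : twistW L M ≠ 0 := mul_ne_zero (pow_ne_zero _ hM) (pow_ne_zero _ hD)
  have h1 := twistW_mul_twistQ ht (n.natAbs + 1)
  have h2 := twistW_mul_twistQ ht n.natAbs
  have hk : (n.natAbs : ℤ) = n := by rw [Int.natCast_natAbs, abs_of_pos hn]
  rw [Nat.cast_add, Nat.cast_one] at h1
  rw [hk, add_sub_cancel_right] at h1
  rw [hk] at h2
  have hWk : M ^ (2 * n.natAbs) * (1 + L * M ^ 2) ^ (2 * n.natAbs) = twistW L M ^ n.natAbs := by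
    rw [twistW, mul_pow, ← pow_mul, ← pow_mul]
  apply mul_left_cancel₀ hW
  rw [neg_mul, hWk, twistAPoly, if_pos hn, riley]
  linear_combination -h1 + (1 + L * M ^ 6) * (1 + L * M ^ 2) * h2 -
    twistW L M ^ n.natAbs * (Chebyshev.S K (n - 1)).eval (claspTrace s (M ^ 2 + M⁻¹ ^ 2)) * he

/-- For negative index the reflection `S_{-m-2} = -S_m` exchanges the roles of the two Chebyshev
terms. The term of larger index now carries the factor `X - s`, whose denominator is `M² (1 + L
M²)`; hence one factor `1 + L M²` less than for positive `n`. -/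
theorem twistAPoly_eq_riley_of_neg {n : ℤ} (hn : n < 0) {L M s : K} (hM : M ≠ 0)
    (hD : 1 + L * M ^ 2 ≠ 0) (hs : s * (1 + L * M ^ 2) = L + M ^ 2) :
    twistAPoly n L M = M ^ (2 * n.natAbs) * (1 + L * M ^ 2) ^ (2 * n.natAbs - 1) *
      riley n s (M ^ 2 + M⁻¹ ^ 2) := by
  have hs' : s = (L + M ^ 2) / (1 + L * M ^ 2) := by field_simp; exact hs
  have ht : claspTrace s (M ^ 2 + M⁻¹ ^ 2) * twistW L M = twistT L M := by
    rw [claspTrace, hs', twistW, twistT]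
    field_simp
    ring
  have hm : M⁻¹ ^ 2 * M ^ 2 = 1 := by field_simp
  have he : (M ^ 2 + M⁻¹ ^ 2 - s) * (M ^ 2 * (1 + L * M ^ 2)) = 1 + L * M ^ 6 := by
    linear_combination (1 + L * M ^ 2) * hm - M ^ 2 * hs
  have hW : twistW L M ≠ 0 := mul_ne_zero (pow_ne_zero _ hM) (pow_ne_zero _ hD)
  obtain ⟨j, hj⟩ : ∃ j, n.natAbs = j + 1 := ⟨n.natAbs - 1, by omega⟩
  have h1 := twistW_mul_twistQ ht (j + 1)
  have h2 := twistW_mul_twistQ ht j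
  have hk : n = -((j : ℤ) + 1) := by omega
  rw [Nat.cast_add, Nat.cast_one] at h1
  rw [add_sub_cancel_right] at h1
  have hS1 : Chebyshev.S K n = -Chebyshev.S K (j - 1) := by
    rw [hk, Chebyshev.S_neg]; congr 2; ring
  have hS2 : Chebyshev.S K (n - 1) = -Chebyshev.S K j := by
    rw [hk, show -((j : ℤ) + 1) - 1 = -j - 2 by ring, Chebyshev.S_neg_sub_two]
  have hWk : M ^ (2 * (j + 1)) * (1 + L * M ^ 2) ^ (2 * (j + 1) - 1) =
      twistW L M ^ j * (M ^ 2 * (1 + L * M ^ 2)) := by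
    rw [twistW, show 2 * (j + 1) - 1 = 2 * j + 1 by omega, mul_pow, ← pow_mul, ← pow_mul]
    ring
  apply mul_left_cancel₀ hW
  rw [hj, hWk, twistAPoly, if_neg (by omega), riley, hS1, hS2, hj, Nat.add_sub_cancel, eval_neg,
    eval_neg]
  have hW2 : M ^ 4 * (1 + L * M ^ 2) ^ 3 = M ^ 2 * (1 + L * M ^ 2) * twistW L M := by
    rw [twistW]; ring
  have h2' : M ^ 4 * (1 + L * M ^ 2) ^ 3 * (twistW L M * twistQ L M j) = M ^ 2 * (1 + L * M ^ 2) *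
      twistW L M * (twistW L M ^ j *
        (Chebyshev.S K (j - 1)).eval (claspTrace s (M ^ 2 + M⁻¹ ^ 2))) := by
    rw [h2, hW2]
  linear_combination (1 + L * M ^ 6) * h1 - h2' -
    twistW L M ^ (j + 1) * (Chebyshev.S K j).eval (claspTrace s (M ^ 2 + M⁻¹ ^ 2)) * he

theorem exists_twistAPoly_eq_riley (K : Type*) [Field K] {n : ℤ} (hn : n ≠ 0) :
    ∃ (ε : K) (p q : ℕ), ε ≠ 0 ∧ ∀ L M s : K, M ≠ 0 → 1 + L * M ^ 2 ≠ 0 →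
      s * (1 + L * M ^ 2) = L + M ^ 2 →
      twistAPoly n L M = ε * M ^ p * (1 + L * M ^ 2) ^ q * riley n s (M ^ 2 + M⁻¹ ^ 2) := by
  rcases lt_or_gt_of_ne hn with hn | hn
  · refine ⟨1, 2 * n.natAbs, 2 * n.natAbs - 1, one_ne_zero, fun L M s h1 h2 h3 => ?_⟩
    rw [twistAPoly_eq_riley_of_neg hn h1 h2 h3, one_mul]
  · refine ⟨-1, 2 * n.natAbs, 2 * n.natAbs, neg_ne_zero.2 one_ne_zero, fun L M s h1 h2 h3 => ?_⟩
    rw [twistAPoly_eq_riley_of_pos hn h1 h2 h3, neg_one_mul]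

/-- Besides the generic case there are the points with `1 + L M² = 0`, where `L` no longer
determines `s`. Then `M^4 = 1`: if `M² = 1`, all ingredients of the polynomial vanish; if `M² = -1`,
then `L = 1`, which is why the factor `L - 1` is included. -/
theorem twistAPoly_eq_zero_of_isRileyPoint {n : ℤ} (hn : n ≠ 0) {L M : K} (hM : M ≠ 0)
    (h : IsRileyPoint n L M) : (L - 1) * twistAPoly n L M = 0 := by
  obtain ⟨s, hs, hL⟩ := h
  by_cases hD : 1 + L * M ^ 2 = 0
  · rw [hD, mul_zero] at hL
    have hL' : L = -M ^ 2 := by linear_combination -hL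
    have hM4 : (M ^ 2 - 1) * (M ^ 2 + 1) = 0 := by rw [hL'] at hD; linear_combination -hD
    rcases mul_eq_zero.1 hM4 with h1 | h1
    · have hL1 : L = -1 := by linear_combination hL' - h1
      have hM2 : M ^ 2 = 1 := by linear_combination h1
      have hw : twistW L M = 0 := by rw [twistW, hD]; ring
      have hT : twistT L M = 0 := by
        rw [twistT, hL1, show M ^ 8 = (M ^ 2) ^ 4 by ring, show M ^ 6 = (M ^ 2) ^ 3 by ring,
          show M ^ 4 = (M ^ 2) ^ 2 by ring, hM2]
        ring
      have h6 : 1 + L * M ^ 6 = 0 := by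
        rw [hL1, show M ^ 6 = (M ^ 2) ^ 3 by ring, hM2]
        ring
      obtain ⟨j, hj⟩ : ∃ j, n.natAbs = j + 1 := ⟨n.natAbs - 1, by omega⟩
      rw [twistAPoly, hD, h6, hj, twistQ_of_w_eq_zero hw, hT]
      simp
    · rw [show L = 1 by linear_combination hL' - h1]; ring
  · obtain ⟨ε, p, q, -, h⟩ := exists_twistAPoly_eq_riley K hn
    rw [h L M s hM hD hL, hs]
    ring

/-- On `1 + L M² = 0` one has `W = 0` and `T = (M^4 - 1)² / M²`. So for `M^4 ≠ 1` the polynomial has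
no zero on this curve, and off it `s` can be recovered from `L`. -/
theorem isRileyPoint_of_twistAPoly_eq_zero {n : ℤ} (hn : n ≠ 0) {L M : K} (hM : M ≠ 0)
    (hM4 : M ^ 4 ≠ 1) (h : twistAPoly n L M = 0) : 1 + L * M ^ 2 ≠ 0 ∧ IsRileyPoint n L M := by
  have hD : 1 + L * M ^ 2 ≠ 0 := by
    intro hD
    have hw : twistW L M = 0 := by rw [twistW, hD]; ring
    have hL : L = -M⁻¹ ^ 2 := by
      field_simp
      linear_combination hD
    have hT : twistT L M ≠ 0 := by
      have : twistT L M = (M ^ 4 - 1) ^ 2 / M ^ 2 := by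
        rw [twistT, hL]
        field_simp
        ring
      rw [this]
      exact div_ne_zero (pow_ne_zero _ (sub_ne_zero.2 hM4)) (pow_ne_zero _ hM)
    obtain ⟨j, hj⟩ : ∃ j, n.natAbs = j + 1 := ⟨n.natAbs - 1, by omega⟩
    rw [twistAPoly, hD, hj, twistQ_of_w_eq_zero hw, twistQ_of_w_eq_zero hw] at h
    split_ifs at h
    · refine pow_ne_zero (j + 1) hT ?_
      linear_combination -h
    · have h6 : 1 + L * M ^ 6 ≠ 0 := by
        intro h6
        apply hM4
        rw [hL] at h6
        field_simp at h6
        linear_combination -h6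
      refine mul_ne_zero h6 (pow_ne_zero j hT) ?_
      linear_combination h
  refine ⟨hD, (L + M ^ 2) / (1 + L * M ^ 2), ?_, by field_simp⟩
  obtain ⟨ε, p, q, hε, h'⟩ := exists_twistAPoly_eq_riley K hn
  rw [h' L M ((L + M ^ 2) / (1 + L * M ^ 2)) hM hD (by field_simp)] at h
  exact (mul_eq_zero.1 h).resolve_left
    (mul_ne_zero (mul_ne_zero hε (pow_ne_zero _ hM)) (pow_ne_zero _ hD))

end Field

end TwistAPoly

/-! ### Simple roots for almost all `M`. -/

section Separability

open Polynomial

/-- The resultant of `Ψ` and its derivative is a polynomial in `ξ`. It is nonzero because it is so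
at `ξ₀`, and it vanishes wherever there is a double root. -/
theorem finite_setOf_common_root_derivative {Ψ : ℂ[X][X]} (hΨ : Ψ.Monic) {ξ₀ : ℂ}
    (h₀ : ∀ s, (Ψ.map (evalRingHom ξ₀)).eval s = 0 →
      (Ψ.map (evalRingHom ξ₀)).derivative.eval s ≠ 0) :
    {ξ : ℂ | ∃ s, (Ψ.map (evalRingHom ξ)).eval s = 0 ∧
      (Ψ.map (evalRingHom ξ)).derivative.eval s = 0}.Finite := by
  by_cases hd : Ψ.natDegree = 0
  · rw [eq_one_of_monic_natDegree_zero hΨ hd]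
    simp
  obtain ⟨p, q, -, -, hpq⟩ := exists_mul_add_mul_eq_C_resultant Ψ (derivative Ψ) le_rfl le_rfl
    (Or.inl hd)
  have hres : resultant Ψ (derivative Ψ) ≠ 0 := by
    intro h
    have h1 := resultant_map_map Ψ (derivative Ψ) Ψ.natDegree (derivative Ψ).natDegree
      (evalRingHom ξ₀)
    rw [h, map_zero] at h1
    have hm : (Ψ.map (evalRingHom ξ₀)).Monic := hΨ.map _
    have hdeg : (Ψ.map (evalRingHom ξ₀)).natDegree = Ψ.natDegree := hΨ.natDegree_map _
    -- The degree of the derivative might drop under specialization. As the first polynomial is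
    -- monic, this changes the resultant only by a power of `1`.
    obtain ⟨k, hk⟩ := Nat.exists_eq_add_of_le
      (natDegree_map_le (p := derivative Ψ) (f := evalRingHom ξ₀))
    rw [hk, resultant_add_right_deg _ _ _ _ _ le_rfl, ← hdeg, coeff_natDegree, hm.leadingCoeff,
      one_pow, one_mul] at h1
    refine resultant_ne_zero _ _ ?_ h1
    rw [isCoprime_iff_aeval_ne_zero_of_isAlgClosed ℂ ℂ]
    intro s
    rw [← derivative_map, coe_aeval_eq_eval]
    by_cases h : (Ψ.map (evalRingHom ξ₀)).eval s = 0
    · exact Or.inr (h₀ s h)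
    · exact Or.inl h
  refine ((resultant Ψ (derivative Ψ)).roots.toFinset.finite_toSet).subset ?_
  rintro ξ ⟨s, h1, h2⟩
  have h3 := congrArg (fun r => (r.map (evalRingHom ξ)).eval s) hpq
  simp only [Polynomial.map_add, Polynomial.map_mul, eval_add, eval_mul, map_C, eval_C] at h3
  rw [← derivative_map, h1, h2] at h3
  simp only [Finset.mem_coe, Multiset.mem_toFinset, mem_roots', IsRoot.def]
  refine ⟨hres, ?_⟩
  simpa using h3.symm

section RileyPolynomial

variable {R : Type*} [CommRing R]

theorem map_riley {S : Type*} [CommRing S] (f : R →+* S) (n : ℤ) (s x : R) :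
    f (riley n s x) = riley n (f s) (f x) := by
  have h : ∀ (m : ℤ) (t : R), f ((Chebyshev.S R m).eval t) = (Chebyshev.S S m).eval (f t) := by
    intro m t
    rw [← Chebyshev.map_S f, eval_map, eval₂_hom]
  simp [riley, h, claspTrace]

theorem riley_add_one (n : ℤ) (s x : R) :
    riley (n + 1) s x = claspTrace s x * riley n s x - riley (n - 1) s x := by
  have h1 := congrArg (eval (claspTrace s x)) (Chebyshev.S_add_one R n)
  have h2 := congrArg (eval (claspTrace s x)) (Chebyshev.S_add_one R (n - 1))
  simp only [eval_sub, eval_mul, eval_X] at h1 h2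
  rw [riley, riley, riley, h1, show n + 1 - 1 = n - 1 + 1 by ring, h2]
  ring

theorem riley_zero (s x : R) : riley 0 s x = 1 := by
  simp [riley, Chebyshev.S_neg_one]

theorem riley_neg_one (s x : R) : riley (-1) s x = x - s := by
  simp [riley, Chebyshev.S_neg_one, Chebyshev.S_neg_two]

/-- A sequence over `ℤ` satisfying the recursion of the Riley polynomials vanishes when two
consecutive terms do. -/
theorem eq_zero_of_recurrence {t : R} {F : ℤ → R} (hF : ∀ n, F (n + 1) = t * F n - F (n - 1))
    (h0 : F 0 = 0) (h1 : F (-1) = 0) (n : ℤ) : F n = 0 := by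
  suffices h : F n = 0 ∧ F (n - 1) = 0 from h.1
  induction n with
  | zero => exact ⟨h0, by simpa using h1⟩
  | succ n ih =>
    refine ⟨?_, by simpa using ih.1⟩
    rw [hF, ih.1, ih.2]; ring
  | pred n ih =>
    refine ⟨ih.2, ?_⟩
    have := hF (-(n : ℤ) - 1)
    rw [sub_add_cancel, ih.1, ih.2] at this
    linear_combination this

/-- At `s = 1` the clasp trace is `2`, so the recursion has linear solutions. As `L = 1` corresponds
to `s = 1`, this bounds the common zeros of `L - 1` and the polynomial. -/
theorem riley_one_left (n : ℤ) (x : R) : riley n 1 x = 2 * n + 1 - n * x := by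
  have := eq_zero_of_recurrence (t := 2) (F := fun n : ℤ => riley n 1 x - (2 * n + 1 - n * x))
    (fun n => by
      rw [riley_add_one, show claspTrace (1 : R) x = 2 by rw [claspTrace]; ring]
      push_cast
      ring) (by simp [riley_zero]) (by rw [riley_neg_one]; push_cast; ring) n
  linear_combination this

/-- The clasp trace is a monic quadratic in `s`, so each step of the recursion raises the degree by
two. Monicity is what the resultant argument needs. -/
theorem riley_monic [Nontrivial R] (x : R) (j : ℕ) :
    (riley (j : ℤ) (X : R[X]) (C x)).Monic ∧ (riley (j : ℤ) (X : R[X]) (C x)).natDegree = 2 * j ∧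
    (-riley (-(j : ℤ) - 1) (X : R[X]) (C x)).Monic ∧
      (-riley (-(j : ℤ) - 1) (X : R[X]) (C x)).natDegree = 2 * j + 1 := by
  have hts : claspTrace (X : R[X]) (C x) = X ^ 2 + C (-x) * X + C (x + 1) := by
    rw [claspTrace]; simp; ring
  have htd : (claspTrace (X : R[X]) (C x)).natDegree = 2 := by
    rw [hts]; compute_degree!
  have htm : (claspTrace (X : R[X]) (C x)).Monic := by
    rw [hts]; monicity!
  have step : ∀ {p q : R[X]} {d : ℕ}, p.Monic → p.natDegree = d → q.natDegree < d + 2 →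
      (claspTrace (X : R[X]) (C x) * p - q).Monic ∧
      (claspTrace (X : R[X]) (C x) * p - q).natDegree = d + 2 := by
    intro p q d hp hpd hqd
    have hd : (claspTrace (X : R[X]) (C x) * p).natDegree = d + 2 := by
      rw [htm.natDegree_mul hp, htd, hpd]; ring
    have hm : (claspTrace (X : R[X]) (C x) * p).Monic := htm.mul hp
    have hlt : q.natDegree < (claspTrace (X : R[X]) (C x) * p).natDegree := by omega
    exact ⟨hm.sub_of_left (degree_lt_degree hlt), by
      rw [natDegree_sub_eq_left_of_natDegree_lt hlt, hd]⟩
  have h0 : (-riley (-1) (X : R[X]) (C x)) = X - C x := by rw [riley_neg_one]; ring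
  have hsucc : ∀ j : ℕ, riley ((j + 2 : ℕ) : ℤ) (X : R[X]) (C x) =
      claspTrace (X : R[X]) (C x) * riley ((j + 1 : ℕ) : ℤ) X (C x) - riley (j : ℤ) X (C x) := by
    intro j
    have := riley_add_one ((j : ℤ) + 1) (X : R[X]) (C x)
    push_cast
    rw [show (j : ℤ) + 2 = j + 1 + 1 by ring, this, add_sub_cancel_right]
  have hpred : ∀ j : ℕ, -riley (-((j + 2 : ℕ) : ℤ) - 1) (X : R[X]) (C x) =
      claspTrace (X : R[X]) (C x) * (-riley (-((j + 1 : ℕ) : ℤ) - 1) X (C x)) -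
        (-riley (-(j : ℤ) - 1) X (C x)) := by
    intro j
    have := riley_add_one (-((j + 1 : ℕ) : ℤ) - 1) (X : R[X]) (C x)
    rw [show -((j + 1 : ℕ) : ℤ) - 1 + 1 = -j - 1 by push_cast; ring,
      show -((j + 1 : ℕ) : ℤ) - 1 - 1 = -((j + 2 : ℕ) : ℤ) - 1 by push_cast; ring] at this
    linear_combination -this
  have h1 : (-riley (-1) (X : R[X]) (C x)).natDegree = 1 := by rw [h0, natDegree_X_sub_C]
  induction j using Nat.twoStepInduction with
  | zero =>
    simp only [Nat.cast_zero, riley_zero, monic_one, natDegree_one, neg_zero, zero_sub, true_and]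
    rw [h0]
    simp [monic_X_sub_C]
  | one =>
    have e1 := riley_add_one 0 (X : R[X]) (C x)
    have e2 := riley_add_one (-1) (X : R[X]) (C x)
    norm_num at e1 e2
    have s1 := step (p := 1) (q := riley (-1) X (C x)) (d := 0) monic_one natDegree_one
      (by rw [← natDegree_neg, h1]; norm_num)
    have s2 := step (p := -riley (-1) X (C x)) (q := -1) (d := 1) (by rw [h0]; exact monic_X_sub_C x)
      h1 (by simp)
    rw [riley_zero] at e1 e2
    rw [show claspTrace (X : R[X]) (C x) * -riley (-1) X (C x) - -1 = -riley (-2) X (C x) by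
      linear_combination e2] at s2
    rw [mul_one] at e1 s1
    rw [← e1] at s1
    norm_num
    exact ⟨s1.1, s1.2, s2.1, by rw [← natDegree_neg]; exact s2.2⟩
  | more j ih1 ih2 =>
    obtain ⟨a1, a2, a3, a4⟩ := ih1
    obtain ⟨b1, b2, b3, b4⟩ := ih2
    rw [hsucc, hpred]
    obtain ⟨c1, c2⟩ := step b1 b2 (q := riley (j : ℤ) X (C x)) (by omega)
    obtain ⟨d1, d2⟩ := step b3 b4 (q := -riley (-(j : ℤ) - 1) X (C x)) (by omega)
    exact ⟨c1, by rw [c2]; ring, d1, by rw [d2]; ring⟩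

/-- At `X = -2` the clasp trace is `ζ² + ζ⁻²`, so the recursion is solved by powers of `ζ²` and
`ζ⁻²`; the right side vanishes exactly when `ζ^(4n+1) = 1`. -/
theorem riley_neg_two_mul {K : Type*} [Field K] (n : ℤ) {ζ : K} (hζ : ζ ≠ 0) :
    riley n (ζ + ζ⁻¹ - 1) (-2) * (ζ - 1) = ζ ^ (2 * n + 1) - ζ ^ (-(2 * n)) := by
  have := eq_zero_of_recurrence (t := ζ ^ 2 + ζ⁻¹ ^ 2)
    (F := fun n : ℤ => riley n (ζ + ζ⁻¹ - 1) (-2) * (ζ - 1) - (ζ ^ (2 * n + 1) - ζ ^ (-(2 * n))))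
    (fun n => by
      have hc : claspTrace (ζ + ζ⁻¹ - 1) (-2) = ζ ^ 2 + ζ⁻¹ ^ 2 := by
        rw [claspTrace]; field_simp; ring
      have e1 : ζ ^ (2 * (n + 1) + 1) = ζ ^ (2 * n + 1) * ζ ^ 2 := by
        rw [← zpow_natCast, ← zpow_add₀ hζ]; congr 1; push_cast; ring
      have e2 : ζ ^ (2 * (n - 1) + 1) = ζ ^ (2 * n + 1) * ζ⁻¹ ^ 2 := by
        rw [inv_pow, ← zpow_natCast, ← zpow_neg, ← zpow_add₀ hζ]; congr 1; push_cast; ring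
      have e3 : ζ ^ (-(2 * (n + 1))) = ζ ^ (-(2 * n)) * ζ⁻¹ ^ 2 := by
        rw [inv_pow, ← zpow_natCast, ← zpow_neg, ← zpow_add₀ hζ]; congr 1; push_cast; ring
      have e4 : ζ ^ (-(2 * (n - 1))) = ζ ^ (-(2 * n)) * ζ ^ 2 := by
        rw [← zpow_natCast, ← zpow_add₀ hζ]; congr 1; push_cast; ring
      rw [riley_add_one, hc, e1, e2, e3, e4]
      ring)
    (by simp [riley_zero])
    (by
      rw [riley_neg_one, show (2 : ℤ) * -1 + 1 = -1 by norm_num,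
        show -((2 : ℤ) * -1) = (2 : ℕ) by norm_num, zpow_neg_one, zpow_natCast]
      field_simp
      ring) n
  linear_combination this

end RileyPolynomial

theorem exists_add_inv_eq (c : ℂ) : ∃ ζ : ℂ, ζ ≠ 0 ∧ ζ + ζ⁻¹ = c := by
  obtain ⟨r, hr⟩ := IsAlgClosed.exists_pow_nat_eq (discrim 1 (-c) 1) (n := 2) (by norm_num)
  obtain ⟨ζ, hζ⟩ := exists_quadratic_eq_zero (a := (1 : ℂ)) (b := -c) (c := 1) one_ne_zero
    ⟨r, by rw [← hr, pow_two]⟩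
  have h0 : ζ ≠ 0 := by
    rintro rfl
    simp at hζ
  refine ⟨ζ, h0, ?_⟩
  field_simp
  linear_combination hζ

/-- A double root would kill the derivative in `ζ` of the left side of `riley_neg_two_mul`, while
that of the right side is then `(4n + 1) ζ^(-2n-1)`. The argument also covers `ζ = ±1`, where `ζ ↦
s` is ramified. -/
theorem riley_neg_two_separable (n : ℤ) (s : ℂ) (h : riley n s (-2) = 0) :
    (riley n (X : ℂ[X]) (C (-2))).derivative.eval s ≠ 0 := by
  intro h'
  obtain ⟨ζ, hζ, hs⟩ := exists_add_inv_eq (s + 1)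
  have hs' : ζ + ζ⁻¹ - 1 = s := by rw [hs]; ring
  have hp : ∀ u : ℂ, (riley n (X : ℂ[X]) (C (-2))).eval u = riley n u (-2) := by
    intro u
    have := map_riley (evalRingHom u) n (X : ℂ[X]) (C (-2))
    simpa using this
  have hd1 : HasDerivAt (fun ζ : ℂ => riley n (ζ + ζ⁻¹ - 1) (-2) * (ζ - 1))
      ((0 * (1 + -(ζ ^ 2)⁻¹)) * (ζ - 1) + riley n (ζ + ζ⁻¹ - 1) (-2) * 1) ζ := by
    have hc : HasDerivAt (fun ζ : ℂ => ζ + ζ⁻¹ - 1) (1 + -(ζ ^ 2)⁻¹) ζ :=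
      ((hasDerivAt_id ζ).add (hasDerivAt_inv hζ)).sub_const 1
    have hq := (riley n (X : ℂ[X]) (C (-2))).hasDerivAt (ζ + ζ⁻¹ - 1)
    rw [hs', h'] at hq
    rw [← hs'] at hq
    have := hq.comp ζ hc
    refine HasDerivAt.mul ?_ ((hasDerivAt_id ζ).sub_const 1)
    convert this using 1
    ext u
    exact (hp _).symm
  have hd2 : HasDerivAt (fun ζ : ℂ => ζ ^ (2 * n + 1) - ζ ^ (-(2 * n)))
      (((2 * n + 1 : ℤ) : ℂ) * ζ ^ (2 * n + 1 - 1) -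
        ((-(2 * n) : ℤ) : ℂ) * ζ ^ (-(2 * n) - 1)) ζ :=
    (hasDerivAt_zpow _ ζ (Or.inl hζ)).sub (hasDerivAt_zpow _ ζ (Or.inl hζ))
  have heq : (fun ζ : ℂ => riley n (ζ + ζ⁻¹ - 1) (-2) * (ζ - 1)) =ᶠ[nhds ζ]
      fun ζ : ℂ => ζ ^ (2 * n + 1) - ζ ^ (-(2 * n)) := by
    filter_upwards [isOpen_ne.mem_nhds hζ] with u hu
    exact riley_neg_two_mul n hu
  have h1 := hd1.unique (hd2.congr_of_eventuallyEq heq)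
  have h2 := riley_neg_two_mul n hζ
  rw [hs', h, zero_mul] at h2
  rw [hs', h, zpow_sub_one₀ hζ, zpow_sub_one₀ hζ] at h1
  have h3 : ((4 * n + 1 : ℤ) : ℂ) * ζ ^ (-(2 * n)) = 0 := by
    push_cast at h1 ⊢
    have h4 : ζ ^ (2 * n + 1) = ζ ^ (-(2 * n)) := by linear_combination -h2
    rw [h4] at h1
    have h5 : ζ⁻¹ * ζ = 1 := inv_mul_cancel₀ hζ
    linear_combination -ζ * h1 - (4 * n + 1) * ζ ^ (-(2 * n)) * h5
  rcases mul_eq_zero.1 h3 with h4 | h4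
  · have : (4 * n + 1 : ℤ) = 0 := by exact_mod_cast h4
    omega
  · exact zpow_ne_zero _ hζ h4

theorem finite_setOf_riley_common_root (n : ℤ) :
    {ξ : ℂ | ∃ s, riley n s ξ = 0 ∧
      (riley n (X : ℂ[X]) (C ξ)).derivative.eval s = 0}.Finite := by
  have hmap : ∀ ξ : ℂ, (riley n (X : ℂ[X][X]) (C X)).map (evalRingHom ξ) =
      riley n (X : ℂ[X]) (C ξ) := by
    intro ξ
    have := map_riley (mapRingHom (evalRingHom ξ)) n (X : ℂ[X][X]) (C X)
    simpa using this
  have heval : ∀ ξ s : ℂ, (riley n (X : ℂ[X]) (C ξ)).eval s = riley n s ξ := by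
    intro ξ s
    have := map_riley (evalRingHom s) n (X : ℂ[X]) (C ξ)
    simpa using this
  obtain ⟨j, hj⟩ : ∃ j : ℕ, n = j ∨ n = -(j : ℤ) - 1 := by
    rcases le_or_gt 0 n with h | h
    · exact ⟨n.toNat, by omega⟩
    · exact ⟨(-n - 1).toNat, by omega⟩
  have hm := riley_monic (X : ℂ[X]) j
  rcases hj with hj | hj
  · have := finite_setOf_common_root_derivative (ξ₀ := -2) hm.1 (by
      rw [← hj, hmap]
      intro s hs
      rw [heval] at hs
      exact riley_neg_two_separable n s hs)
    rw [← hj] at this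
    simpa only [hmap, heval] using this
  · have := finite_setOf_common_root_derivative (ξ₀ := -2) hm.2.2.1 (by
      rw [← hj, Polynomial.map_neg, hmap]
      intro s hs
      rw [eval_neg, heval, neg_eq_zero] at hs
      rw [derivative_neg, eval_neg, neg_ne_zero]
      exact riley_neg_two_separable n s hs)
    rw [← hj] at this
    simpa only [Polynomial.map_neg, derivative_neg, eval_neg, neg_eq_zero, hmap, heval] using this

theorem finite_setOf_sq_add_inv_sq_mem {Z : Set ℂ} (hZ : Z.Finite) :
    {M : ℂ | M ≠ 0 ∧ M ^ 2 + M⁻¹ ^ 2 ∈ Z}.Finite := by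
  have : {M : ℂ | M ≠ 0 ∧ M ^ 2 + M⁻¹ ^ 2 ∈ Z} ⊆
      ⋃ ξ ∈ Z, ((X ^ 4 - C ξ * X ^ 2 + 1 : ℂ[X]).roots.toFinset : Set ℂ) := by
    rintro M ⟨hM, h⟩
    simp only [Set.mem_iUnion]
    refine ⟨_, h, ?_⟩
    simp only [Finset.mem_coe, Multiset.mem_toFinset, mem_roots', IsRoot.def]
    constructor
    · intro h0
      have := congrArg (eval 0) h0
      simp at this
    · simp
      field_simp
      ring
  exact (hZ.biUnion fun ξ _ => Finset.finite_toSet _).subset this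

/-- For all but finitely many `M`, the polynomial `(L - 1) * A(L, M)` has no double root. -/
theorem exists_finite_twistAPoly_separable {n : ℤ} (hn : n ≠ 0) :
    ∃ B : Set ℂ, B.Finite ∧ ∀ M ∉ B, M ≠ 0 ∧ M ^ 4 ≠ 1 ∧ ∀ L : ℂ,
      ((X - 1) * twistAPoly n (X : ℂ[X]) (C M)).eval L = 0 →
      ((X - 1) * twistAPoly n (X : ℂ[X]) (C M)).derivative.eval L ≠ 0 := by
  have hnC : (n : ℂ) ≠ 0 := by exact_mod_cast hn
  -- The exceptional `M`: zero, the fourth roots of unity, those for which the Riley polynomial has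
  -- a double root, and those for which `s = 1` is a root, i.e. `X = (2n + 1) / n`.
  refine ⟨{0} ∪ ((X ^ 4 - C 1 : ℂ[X]).roots.toFinset : Set ℂ) ∪
    {M : ℂ | M ≠ 0 ∧ M ^ 2 + M⁻¹ ^ 2 ∈ {ξ : ℂ | ∃ s, riley n s ξ = 0 ∧
      (riley n (X : ℂ[X]) (C ξ)).derivative.eval s = 0} ∪ {(2 * n + 1) / (n : ℂ)}},
    ((Set.finite_singleton 0).union (Finset.finite_toSet _)).union
      (finite_setOf_sq_add_inv_sq_mem
        ((finite_setOf_riley_common_root n).union (Set.finite_singleton _))), ?_⟩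
  intro M hM
  simp only [Set.mem_union, Set.mem_singleton_iff, not_or, Finset.mem_coe, Multiset.mem_toFinset,
    Set.mem_ofPred_eq, not_and, mem_roots', IsRoot.def] at hM
  obtain ⟨⟨hM0, hM4⟩, hM2⟩ := hM
  obtain ⟨hsep, hone⟩ := hM2 hM0
  have hM4' : M ^ 4 ≠ 1 := by
    have := hM4 (X_pow_sub_C_ne_zero (by norm_num) 1)
    simpa [sub_eq_zero] using this
  refine ⟨hM0, hM4', ?_⟩
  have hev : ∀ L : ℂ, (twistAPoly n (X : ℂ[X]) (C M)).eval L = twistAPoly n L M := by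
    intro L
    have := map_twistAPoly (evalRingHom L) n (X : ℂ[X]) (C M)
    simpa using this
  have heval : ∀ ξ s : ℂ, (riley n (X : ℂ[X]) (C ξ)).eval s = riley n s ξ := by
    intro ξ s
    have := map_riley (evalRingHom s) n (X : ℂ[X]) (C ξ)
    simpa using this
  intro L hL
  rw [derivative_mul, eval_add, eval_mul, eval_mul]
  simp only [eval_mul, eval_sub, eval_X, eval_one, hev, derivative_sub, derivative_X,
    derivative_one, sub_zero, one_mul] at hL ⊢
  by_cases hA : twistAPoly n L M = 0
  · obtain ⟨hD, s, hs, hsL⟩ := isRileyPoint_of_twistAPoly_eq_zero hn hM0 hM4' hA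
    have hL1 : L ≠ 1 := by
      rintro rfl
      have hs1 : s = 1 := by
        apply mul_right_cancel₀ hD
        rw [hsL]; ring
      rw [hs1, riley_one_left] at hs
      apply hone
      field_simp
      field_simp at hs
      linear_combination -hs
    rw [hA, zero_add]
    refine mul_ne_zero (sub_ne_zero.2 hL1) ?_
    intro hd
    obtain ⟨ε, p, q, hε, hrel⟩ := exists_twistAPoly_eq_riley ℂ hn
    have hs' : s = (L + M ^ 2) / (1 + L * M ^ 2) := by field_simp; exact hsL
    have hden : HasDerivAt (fun u : ℂ => 1 + u * M ^ 2) (M ^ 2) L := by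
      simpa using ((hasDerivAt_id L).mul_const (M ^ 2)).const_add 1
    -- The Möbius map `L ↦ s` has determinant `1 - M^4 ≠ 0`, so its derivative vanishes nowhere and
    -- simple roots in `s` stay simple in `L`.
    have hσ : HasDerivAt (fun u : ℂ => (u + M ^ 2) / (1 + u * M ^ 2))
        ((1 * (1 + L * M ^ 2) - (L + M ^ 2) * M ^ 2) / (1 + L * M ^ 2) ^ 2) L :=
      ((hasDerivAt_id L).add_const (M ^ 2)).div hden hD
    have hr := (riley n (X : ℂ[X]) (C (M ^ 2 + M⁻¹ ^ 2))).hasDerivAt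
      ((L + M ^ 2) / (1 + L * M ^ 2))
    have h1 := hr.comp L hσ
    have h2 := (((hden.pow q).const_mul (ε * M ^ p))).mul h1
    have h3 := (twistAPoly n (X : ℂ[X]) (C M)).hasDerivAt L
    rw [hd] at h3
    have heq : (fun u => (twistAPoly n (X : ℂ[X]) (C M)).eval u) =ᶠ[nhds L]
        ((fun u => ε * M ^ p * ((fun u : ℂ => 1 + u * M ^ 2) ^ q) u) *
          ((fun s => (riley n (X : ℂ[X]) (C (M ^ 2 + M⁻¹ ^ 2))).eval s) ∘
            fun u => (u + M ^ 2) / (1 + u * M ^ 2))) := by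
      have hc : ContinuousAt (fun u : ℂ => 1 + u * M ^ 2) L := hden.continuousAt
      filter_upwards [hc.eventually_ne hD] with u hu
      rw [hev, hrel u M ((u + M ^ 2) / (1 + u * M ^ 2)) hM0 hu (by field_simp)]
      rw [← heval (M ^ 2 + M⁻¹ ^ 2)]
      rfl
    have h4 := h3.unique (h2.congr_of_eventuallyEq heq)
    rw [Function.comp_apply, heval, ← hs', hs, mul_zero, zero_add] at h4
    have h5 : (riley n (X : ℂ[X]) (C (M ^ 2 + M⁻¹ ^ 2))).derivative.eval s ≠ 0 := by
      intro h
      exact hsep ⟨s, hs, h⟩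
    have h6 : (1 * (1 + L * M ^ 2) - (L + M ^ 2) * M ^ 2) / (1 + L * M ^ 2) ^ 2 ≠ 0 := by
      apply div_ne_zero _ (pow_ne_zero _ hD)
      rw [show 1 * (1 + L * M ^ 2) - (L + M ^ 2) * M ^ 2 = 1 - M ^ 4 by ring]
      exact sub_ne_zero.2 (Ne.symm hM4')
    refine mul_ne_zero (mul_ne_zero (mul_ne_zero hε (pow_ne_zero p hM0)) ?_) (mul_ne_zero h5 h6)
      h4.symm
    exact pow_ne_zero q hD
  · rcases mul_eq_zero.1 hL with h | h
    · rw [h, zero_mul, add_zero]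
      exact hA
    · exact absurd h hA

end Separability

/-! ### The explicit polynomial is the A-polynomial, uniquely up to sign. -/

section APolynomial

open MvPolynomial

/-- The Nullstellensatz for the prime ideal generated by `f`, which is its own radical. -/
theorem dvd_of_zeros_subset {σ K : Type*} [Field K] [IsAlgClosed K] [Finite σ]
    {f g : MvPolynomial σ K} (hf : Irreducible f) (h : ∀ x, eval x f = 0 → eval x g = 0) :
    f ∣ g := by
  have hp : (Ideal.span {f}).IsPrime :=
    (Ideal.span_singleton_prime hf.ne_zero).2 hf.prime
  have h1 : g ∈ vanishingIdeal K (zeroLocus K (Ideal.span {f})) := by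
    rw [mem_vanishingIdeal_iff]
    intro x hx
    rw [mem_zeroLocus_iff] at hx
    have := hx f (Ideal.mem_span_singleton_self f)
    rw [aeval_eq_eval] at this ⊢
    exact h x this
  rw [IsPrime.vanishingIdeal_zeroLocus] at h1
  exact Ideal.mem_span_singleton.1 h1

theorem dvd_of_squarefree {R : Type*} [CommRing R] [IsDomain R] [UniqueFactorizationMonoid R]
    {a b : R} (ha : Squarefree a) (h : ∀ f, Irreducible f → f ∣ a → f ∣ b) : a ∣ b := by
  induction a using UniqueFactorizationMonoid.induction_on_prime with
  | h₁ => exact absurd ha not_squarefree_zero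
  | h₂ u hu => exact hu.dvd
  | h₃ a p ha0 hp ih =>
    have hpa : ¬ p ∣ a := fun ⟨c, hc⟩ => hp.not_isUnit (ha p ⟨c, by rw [hc]; ring⟩)
    obtain ⟨c, rfl⟩ := ih (ha.of_mul_right) fun f hf hfa => h f hf (hfa.mul_left p)
    have hpc := (hp.dvd_or_dvd (h p hp.irreducible (dvd_mul_right p a))).resolve_left hpa
    rw [mul_comm p a]
    exact mul_dvd_mul_left a hpc

theorem associated_X_sub_C_of_irreducible_dvd {σ K : Type*} [Field K] {f : MvPolynomial σ K}
    (hf : Irreducible f) {i : σ} {b : K} (h : f ∣ X i - C b) : X i - C b ∣ f := by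
  obtain ⟨g, hg⟩ := h
  have hd : (X i - C b : MvPolynomial σ K).totalDegree ≤ 1 := by
    refine (totalDegree_sub _ _).trans ?_
    simp
  have h0 : (X i - C b : MvPolynomial σ K) ≠ 0 := by
    intro h0
    have h1 := congrArg (eval fun _ => b + 1) h0
    simp at h1
  have hg0 : g ≠ 0 := by rintro rfl; exact h0 (by rw [hg, mul_zero])
  rw [hg, totalDegree_mul_of_isDomain hf.ne_zero hg0] at hd
  have hunit : ∀ p : MvPolynomial σ K, p ≠ 0 → p.totalDegree = 0 → IsUnit p := by
    intro p hp hpd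
    rw [totalDegree_eq_zero_iff_eq_C] at hpd
    rw [hpd] at hp ⊢
    refine (isUnit_iff_ne_zero.2 ?_).map C
    rintro h
    rw [h, map_zero] at hp
    exact hp rfl
  have hfd : f.totalDegree ≠ 0 := fun h => hf.not_isUnit (hunit f hf.ne_zero h)
  rw [hg, (hunit g hg0 (by omega)).mul_right_dvd]

/-- The A-polynomial of a twist knot. -/
noncomputable def twistKnotAPolynomial (n : ℤ) : MvPolynomial (Fin 2) ℤ :=
  twistAPoly n (X 0) (X 1)

theorem map_twistKnotAPolynomial (n : ℤ) :
    map (Int.castRingHom ℂ) ((X 0 - 1) * twistKnotAPolynomial n) =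
      (X 0 - 1) * twistAPoly n (X 0) (X 1) := by
  rw [twistKnotAPolynomial, map_mul, map_twistAPoly]
  simp

theorem eval_twistKnotAPolynomial (n : ℤ) (x : Fin 2 → ℂ) :
    eval x ((X 0 - 1) * twistAPoly n (X 0) (X 1)) = (x 0 - 1) * twistAPoly n (x 0) (x 1) := by
  rw [map_mul, map_twistAPoly]
  simp

theorem exists_twistAPoly_ne_zero {n : ℤ} (hn : n ≠ 0) (b : ℂ) :
    ∃ L : ℂ, (L - 1) * twistAPoly n L b ≠ 0 := by
  rcases lt_or_gt_of_ne hn with hn | hn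
  · exact ⟨0, by rw [twistAPoly_zero_left_of_neg hn]; norm_num⟩
  · by_cases hb : b = 0
    · refine ⟨2, ?_⟩
      rw [hb, twistAPoly_zero_right_of_pos hn]
      norm_num
    · exact ⟨0, by rw [twistAPoly_zero_left_of_pos hn]; simp [hb]⟩

/-- Otherwise `f` would divide a product of factors `M - b`, hence be one of them up to a unit; but
the polynomial vanishes identically on no line `M = b`. -/
theorem exists_zero_of_dvd_twistAPoly {n : ℤ} (hn : n ≠ 0) {f : MvPolynomial (Fin 2) ℂ}
    (hf : Irreducible f) (hfG : f ∣ (X 0 - 1) * twistAPoly n (X 0) (X 1)) {B : Set ℂ}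
    (hB : B.Finite) : ∃ x, eval x f = 0 ∧ x 1 ∉ B := by
  by_contra! h
  have h1 : f ∣ ∏ b ∈ hB.toFinset, (X 1 - C b) := by
    apply dvd_of_zeros_subset hf
    intro x hx
    rw [map_prod]
    exact Finset.prod_eq_zero (hB.mem_toFinset.2 (h x hx)) (by simp)
  obtain ⟨b, -, hb⟩ := (hf.prime.dvd_finsetProd_iff _).1 h1
  obtain ⟨g, hg⟩ := (associated_X_sub_C_of_irreducible_dvd hf hb).trans hfG
  obtain ⟨L, hL⟩ := exists_twistAPoly_ne_zero hn b
  apply hL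
  have := congrArg (eval ![L, b]) hg
  rw [eval_twistKnotAPolynomial] at this
  simpa using this

theorem squarefree_twistAPoly {n : ℤ} (hn : n ≠ 0) :
    Squarefree ((X 0 - 1) * twistAPoly n (X 0) (X 1) : MvPolynomial (Fin 2) ℂ) := by
  have h0 : ((X 0 - 1) * twistAPoly n (X 0) (X 1) : MvPolynomial (Fin 2) ℂ) ≠ 0 := by
    intro h
    obtain ⟨L, hL⟩ := exists_twistAPoly_ne_zero hn 0
    apply hL
    have := congrArg (eval ![L, 0]) h
    rw [eval_twistKnotAPolynomial] at this
    simpa using this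
  rw [squarefree_iff_irreducible_sq_not_dvd_of_ne_zero h0]
  intro f hf hff
  obtain ⟨B, hB, h⟩ := exists_finite_twistAPoly_separable hn
  obtain ⟨x, hx, hxB⟩ := exists_zero_of_dvd_twistAPoly hn hf ((dvd_mul_right f f).trans hff) hB
  obtain ⟨-, -, h⟩ := h (x 1) hxB
  let F : MvPolynomial (Fin 2) ℂ →+* Polynomial ℂ :=
    eval₂Hom Polynomial.C ![Polynomial.X, Polynomial.C (x 1)]
  have hF : ∀ p, (F p).eval (x 0) = eval x p := by
    intro p
    have : (Polynomial.evalRingHom (x 0)).comp F = eval x := by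
      apply MvPolynomial.ringHom_ext
      · intro r; simp [F]
      · intro i; fin_cases i <;> simp [F]
    exact congrArg (fun φ : _ →+* ℂ => φ p) this
  have hFG : F ((X 0 - 1) * twistAPoly n (X 0) (X 1)) =
      (Polynomial.X - 1) * twistAPoly n Polynomial.X (Polynomial.C (x 1)) := by
    rw [map_mul, map_twistAPoly]
    simp [F]
  obtain ⟨g, hg⟩ := hff
  have hg' := congrArg F hg
  rw [hFG, map_mul, map_mul] at hg'
  rw [← hF] at hx
  refine h (x 0) ?_ ?_
  · rw [hg']; simp [hx]
  · rw [hg']; simp [hx]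

theorem twistAPoly_dvd_iff {n : ℤ} (hn : n ≠ 0) {f : MvPolynomial (Fin 2) ℂ}
    (hf : Irreducible f) : f ∣ (X 0 - 1) * twistAPoly n (X 0) (X 1) ↔
      {x : Fin 2 → ℂ | eval x f = 0} ⊆
        zeroLocus ℂ (vanishingIdeal ℂ (twistKnot n).eigenvalueSet) := by
  constructor
  · intro hfG x hx
    rw [mem_zeroLocus_iff]
    intro p hp
    rw [mem_vanishingIdeal_iff] at hp
    simp only [aeval_eq_eval] at hp ⊢
    have hB : ({0} ∪ {b : ℂ | b ^ 4 = 1}).Finite := by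
      refine (Set.finite_singleton _).union (((Polynomial.X ^ 4 - Polynomial.C 1 :
        Polynomial ℂ).roots.toFinset.finite_toSet).subset ?_)
      intro b hb
      simp only [Finset.mem_coe, Multiset.mem_toFinset, Polynomial.mem_roots',
        Polynomial.IsRoot.def]
      refine ⟨Polynomial.X_pow_sub_C_ne_zero (by norm_num) 1, ?_⟩
      have hb' : b ^ 4 = 1 := hb
      simp [hb']
    -- Away from the finitely many bad `M`, the zeros of `f` lie in the eigenvalue set itself; the
    -- product takes care of the bad ones and cannot absorb `f`.
    have hdvd : f ∣ p * ∏ b ∈ hB.toFinset, (X 1 - C b) := by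
      apply dvd_of_zeros_subset hf
      intro y hy
      rw [map_mul, map_prod]
      by_cases hyB : y 1 ∈ ({0} ∪ {b : ℂ | b ^ 4 = 1} : Set ℂ)
      · rw [Finset.prod_eq_zero (hB.mem_toFinset.2 hyB) (by simp), mul_zero]
      · rw [hp y, zero_mul]
        simp only [Set.mem_union, Set.mem_singleton_iff, Set.mem_ofPred_eq, not_or] at hyB
        obtain ⟨g, hg⟩ := hfG
        have := congrArg (eval y) hg
        rw [eval_twistKnotAPolynomial, map_mul, hy, zero_mul] at this
        refine (mem_eigenvalueSet_twistKnot hn y).2 ⟨hyB.1, ?_⟩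
        rcases mul_eq_zero.1 this with h | h
        · exact Or.inl (sub_eq_zero.1 h)
        · exact Or.inr (isRileyPoint_of_twistAPoly_eq_zero hn hyB.1 hyB.2 h).2
    rcases hf.prime.dvd_or_dvd hdvd with ⟨g, hg⟩ | ⟨g, hg⟩
    · have hx' : eval x f = 0 := hx
      rw [hg, map_mul, hx', zero_mul]
    · obtain ⟨y, hy, hyB⟩ := exists_zero_of_dvd_twistAPoly hn hf hfG hB
      have := congrArg (eval y) hg
      rw [map_mul, hy, zero_mul, map_prod, Finset.prod_eq_zero_iff] at this
      obtain ⟨b, hb, hb'⟩ := this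
      rw [hB.mem_toFinset] at hb
      rw [map_sub, eval_X, eval_C, sub_eq_zero] at hb'
      exact absurd (hb' ▸ hb) hyB
  · intro h
    apply dvd_of_zeros_subset hf
    intro x hx
    have h1 := h hx
    rw [mem_zeroLocus_iff] at h1
    have h2 := h1 ((X 0 - 1) * twistAPoly n (X 0) (X 1)) (by
      rw [mem_vanishingIdeal_iff]
      intro y hy
      rw [aeval_eq_eval, eval_twistKnotAPolynomial]
      obtain ⟨hy0, h3 | h3⟩ := (mem_eigenvalueSet_twistKnot hn y).1 hy
      · rw [h3]; ring
      · exact twistAPoly_eq_zero_of_isRileyPoint hn hy0 h3)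
    rwa [aeval_eq_eval] at h2

theorem isAPolynomial_twistKnotAPolynomial {n : ℤ} (hn : n ≠ 0)
    {m : Fin 2 →₀ ℕ} (hm : IsUnit (coeff m (twistKnotAPolynomial n))) :
    (twistKnot n).IsAPolynomial (twistKnotAPolynomial n) := by
  refine ⟨?_, ?_, ?_⟩
  · rintro c ⟨g, hg⟩
    rw [hg, coeff_C_mul] at hm
    exact isUnit_of_mul_isUnit_left hm
  · rw [map_twistKnotAPolynomial]
    exact squarefree_twistAPoly hn
  · intro f hf
    rw [map_twistKnotAPolynomial]
    exact twistAPoly_dvd_iff hn hf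

/-- An A-polynomial with a coefficient `±1` is unique up to sign. -/
theorem KnotDiagram.IsAPolynomial.eq_or_eq_neg {N : ℕ} [NeZero N] {D : KnotDiagram N}
    {A B : MvPolynomial (Fin 2) ℤ} (hA : D.IsAPolynomial A) (hB : D.IsAPolynomial B)
    {m : Fin 2 →₀ ℕ} (hm : IsUnit (coeff m A)) : B = A ∨ B = -A := by
  obtain ⟨-, hA2, hA3⟩ := hA
  obtain ⟨hB1, hB2, hB3⟩ := hB
  have h1 := dvd_of_squarefree hA2 fun f hf h => (hB3 f hf).2 ((hA3 f hf).1 h)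
  have h2 := dvd_of_squarefree hB2 fun f hf h => (hA3 f hf).2 ((hB3 f hf).1 h)
  have h0 : map (Int.castRingHom ℂ) (X 0 - 1 : MvPolynomial (Fin 2) ℤ) ≠ 0 := by
    intro h
    have := congrArg (eval 0) h
    simp at this
  rw [map_mul, map_mul] at h1 h2
  obtain ⟨u, hu⟩ := associated_of_dvd_dvd ((mul_dvd_mul_iff_left h0).1 h1)
    ((mul_dvd_mul_iff_left h0).1 h2)
  obtain ⟨c, hc, hcu⟩ := (isUnit_iff_eq_C_of_isReduced).1 u.isUnit
  rw [hcu] at hu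
  obtain ⟨ε, hε⟩ := hm
  have hcoef := congrArg (coeff m) hu
  rw [mul_comm, coeff_C_mul, coeff_map, coeff_map, ← hε] at hcoef
  have hεε : ((ε : ℤ) : ℂ) * ((ε : ℤ) : ℂ) = 1 := by
    rw [← Int.cast_mul, ← Units.val_mul, Int.units_mul_self]; simp
  -- The constant relating `A` and `B` is a priori complex. The coefficient `±1` of `A` makes it an
  -- integer, and primitivity of `B` then makes it `±1`.
  have hc' : c = ((ε * coeff m B : ℤ) : ℂ) := by
    simp only [eq_intCast] at hcoef
    push_cast
    linear_combination ((ε : ℤ) : ℂ) * hcoef - c * hεε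
  have hBA : B = A * C (ε * coeff m B) := by
    apply map_injective (Int.castRingHom ℂ) Int.cast_injective
    rw [map_mul, map_C, ← hu, hc']
    simp
  obtain ⟨ε', hε'⟩ := hB1 _ ⟨A, by rw [mul_comm]; exact hBA⟩
  rw [← hε'] at hBA
  rcases Int.units_eq_one_or ε' with h | h
  · left; rw [hBA, h]; simp
  · right; rw [hBA, h]; simp

end APolynomial

/-! ### Weights and initial forms. -/

section InitialForm

open MvPolynomial

variable {R : Type*} [CommRing R] {u v d e : ℤ} {p q g h : MvPolynomial (Fin 2) R}

/-- Every monomial of `p` has weight at most `d`, where the variables have weights `u` and `v`. -/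
def WeightLE (u v d : ℤ) (p : MvPolynomial (Fin 2) R) : Prop :=
  ∀ m ∈ p.support, u * m 0 + v * m 1 ≤ d

theorem WeightLE.mono (hp : WeightLE u v d p) (hd : d ≤ e) : WeightLE u v e p :=
  fun m hm => (hp m hm).trans hd

theorem WeightLE.zero : WeightLE u v d (0 : MvPolynomial (Fin 2) R) := by simp [WeightLE]

theorem WeightLE.add (hp : WeightLE u v d p) (hq : WeightLE u v d q) :
    WeightLE u v d (p + q) := by
  classical
  intro m hm
  rcases Finset.mem_union.1 (support_add hm) with h | h
  exacts [hp m h, hq m h]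

theorem WeightLE.neg (hp : WeightLE u v d p) : WeightLE u v d (-p) := by
  intro m hm
  rw [support_neg] at hm
  exact hp m hm

theorem WeightLE.sub (hp : WeightLE u v d p) (hq : WeightLE u v d q) :
    WeightLE u v d (p - q) := by
  rw [sub_eq_add_neg]
  exact hp.add hq.neg

theorem WeightLE.mul (hp : WeightLE u v d p) (hq : WeightLE u v e q) :
    WeightLE u v (d + e) (p * q) := by
  classical
  intro m hm
  obtain ⟨a, ha, b, hb, rfl⟩ := Finset.mem_add.1 (support_mul p q hm)
  have h1 := hp a ha
  have h2 := hq b hb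
  simp only [Finsupp.add_apply, Nat.cast_add]
  linarith

theorem WeightLE.monomial (m : Fin 2 →₀ ℕ) (c : R) (hm : u * m 0 + v * m 1 ≤ d) :
    WeightLE u v d (MvPolynomial.monomial m c) := by
  classical
  intro m' hm'
  rw [Finset.mem_singleton.1 (support_monomial_subset hm')]
  exact hm

/-- `g` is the part of weight `d` of `p`, and the other monomials of `p` have smaller weight. -/
structure HasInitialForm (u v d : ℤ) (p g : MvPolynomial (Fin 2) R) : Prop where
  le : WeightLE u v d g
  ge : WeightLE (-u) (-v) (-d) g
  sub : WeightLE u v (d - 1) (p - g)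

namespace HasInitialForm

theorem weightLE (hp : HasInitialForm u v d p g) : WeightLE u v d p := by
  rw [← sub_add_cancel p g]
  exact (hp.sub.mono (by omega)).add hp.le

/-- The initial form may be zero, as `d` need only bound the weights. This is how a term of smaller
weight drops out of a recursion. -/
theorem of_weightLE (hp : WeightLE u v e p) (hd : e < d) : HasInitialForm u v d p 0 :=
  ⟨.zero, .zero, by rw [sub_zero]; exact hp.mono (by omega)⟩

theorem monomial (m : Fin 2 →₀ ℕ) (c : R) (hm : u * m 0 + v * m 1 = d) :
    HasInitialForm u v d (MvPolynomial.monomial m c) (MvPolynomial.monomial m c) :=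
  ⟨.monomial m c hm.le, .monomial m c (by linarith), by rw [sub_self]; exact .zero⟩

theorem add (hp : HasInitialForm u v d p g) (hq : HasInitialForm u v d q h) :
    HasInitialForm u v d (p + q) (g + h) :=
  ⟨hp.le.add hq.le, hp.ge.add hq.ge, by rw [add_sub_add_comm]; exact hp.sub.add hq.sub⟩

theorem neg (hp : HasInitialForm u v d p g) : HasInitialForm u v d (-p) (-g) :=
  ⟨hp.le.neg, hp.ge.neg, by rw [show -p - -g = -(p - g) by ring]; exact hp.sub.neg⟩

theorem minus (hp : HasInitialForm u v d p g) (hq : HasInitialForm u v d q h) :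
    HasInitialForm u v d (p - q) (g - h) := by
  rw [sub_eq_add_neg, sub_eq_add_neg]
  exact hp.add hq.neg

theorem mul (hp : HasInitialForm u v d p g) (hq : HasInitialForm u v e q h) :
    HasInitialForm u v (d + e) (p * q) (g * h) := by
  refine ⟨hp.le.mul hq.le, ?_, ?_⟩
  · rw [neg_add]
    exact hp.ge.mul hq.ge
  · rw [show p * q - g * h = (p - g) * q + g * (q - h) by ring]
    exact ((hp.sub.mul hq.weightLE).mono (by omega)).add ((hp.le.mul hq.sub).mono (by omega))

theorem coeff_eq (hp : HasInitialForm u v d p g) {m : Fin 2 →₀ ℕ} (hm : u * m 0 + v * m 1 = d) :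
    coeff m p = coeff m g := by
  by_contra h
  have h1 := hp.sub m (by rw [mem_support_iff, coeff_sub]; exact sub_ne_zero.2 h)
  omega

theorem mem_support_iff (hp : HasInitialForm u v d p g) {m : Fin 2 →₀ ℕ} :
    m ∈ g.support ↔ m ∈ p.support ∧ u * m 0 + v * m 1 = d := by
  constructor
  · intro hm
    have h1 := hp.le m hm
    have h2 := hp.ge m hm
    have h3 : u * m 0 + v * m 1 = d := by linarith
    refine ⟨?_, h3⟩
    rw [MvPolynomial.mem_support_iff] at hm ⊢
    rwa [hp.coeff_eq h3]
  · rintro ⟨hm, h⟩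
    rw [MvPolynomial.mem_support_iff] at hm ⊢
    rwa [← hp.coeff_eq h]

theorem sum_monomial (hp : HasInitialForm u v d p g) :
    ∑ m ∈ p.support with u * m 0 + v * m 1 = d, Polynomial.monomial (m 0) (coeff m p) =
      aeval ![Polynomial.X, 1] g := by
  classical
  have hs : (p.support.filter fun m => u * m 0 + v * m 1 = d) = g.support := by
    ext m
    rw [Finset.mem_filter, hp.mem_support_iff]
  rw [hs, aeval_def, eval₂_eq']
  refine Finset.sum_congr rfl fun m hm => ?_
  rw [hp.coeff_eq (hp.mem_support_iff.1 hm).2]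
  simp [Fin.prod_univ_two, ← Polynomial.C_mul_X_pow_eq_monomial]

/-- On a line that is not vertical the `L`-exponent determines the monomial, so nothing is lost by
putting `M = 1`. -/
theorem coeff_eq_coeff_aeval (hp : HasInitialForm u v d p g) (hv : v ≠ 0) {m : Fin 2 →₀ ℕ}
    (hm : u * m 0 + v * m 1 = d) :
    coeff m p = (aeval ![Polynomial.X, 1] g : Polynomial R).coeff (m 0) := by
  classical
  rw [← hp.sum_monomial, Polynomial.finsetSum_coeff]
  rw [Finset.sum_eq_single m]
  · simp
  · intro m' hm' hne
    rw [Polynomial.coeff_monomial, if_neg]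
    intro h0
    apply hne
    have h1 := (Finset.mem_filter.1 hm').2
    have h2 : m' 1 = m 1 := by
      rw [h0] at h1
      exact_mod_cast mul_left_cancel₀ hv (by linarith : v * (m' 1 : ℤ) = v * m 1)
    ext i
    fin_cases i
    exacts [h0, h2]
  · intro h
    rw [Finset.mem_filter, not_and, imp_not_comm] at h
    rw [MvPolynomial.notMem_support_iff.1 (h hm), map_zero, Polynomial.coeff_zero]

end HasInitialForm

theorem hasInitialForm_zero_left (p : MvPolynomial (Fin 2) R) :
    HasInitialForm (-1) 0 0 p (aeval ![0, X 1] p) := by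
  induction p using MvPolynomial.induction_on' with
  | add p q hp hq => rw [map_add]; exact hp.add hq
  | monomial m c =>
    by_cases h : m 0 = 0
    · have := HasInitialForm.monomial (u := -1) (v := 0) (d := 0) m c (by simp [h])
      convert this using 1
      rw [aeval_monomial, monomial_eq, Finsupp.prod_fintype _ _ (by simp),
        Finsupp.prod_fintype _ _ (by simp)]
      simp [Fin.prod_univ_two, h, algebraMap_eq]
    · rw [aeval_monomial, Finsupp.prod_fintype _ _ (by simp)]
      simp only [Fin.prod_univ_two, Matrix.cons_val_zero, zero_pow h, zero_mul, mul_zero]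
      exact .of_weightLE (.monomial (d := -1) m c (by omega)) (by omega)

theorem hasInitialForm_zero_right (p : MvPolynomial (Fin 2) R) :
    HasInitialForm 0 (-1) 0 p (aeval ![X 0, 0] p) := by
  induction p using MvPolynomial.induction_on' with
  | add p q hp hq => rw [map_add]; exact hp.add hq
  | monomial m c =>
    by_cases h : m 1 = 0
    · have := HasInitialForm.monomial (u := 0) (v := -1) (d := 0) m c (by simp [h])
      convert this using 1
      rw [aeval_monomial, monomial_eq, Finsupp.prod_fintype _ _ (by simp),
        Finsupp.prod_fintype _ _ (by simp)]
      simp [Fin.prod_univ_two, h, algebraMap_eq]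
    · rw [aeval_monomial, Finsupp.prod_fintype _ _ (by simp)]
      simp only [Fin.prod_univ_two, Matrix.cons_val_one, Matrix.cons_val_fin_one, zero_pow h,
        mul_zero]
      exact .of_weightLE (.monomial (d := -1) m c (by omega)) (by omega)

/-- The Lucas sequence with parameters `t` and `s`. -/
def lucasSeq {R : Type*} [CommRing R] (t s : R) : ℕ → R
  | 0 => 0
  | 1 => 1
  | j + 2 => t * lucasSeq t s (j + 1) - s * lucasSeq t s j

theorem lucasSeq_add_two (t s : R) (j : ℕ) : lucasSeq t s (j + 2) =
    t * lucasSeq t s (j + 1) - s * lucasSeq t s j := rfl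

theorem lucasSeq_zero_right (t : R) (j : ℕ) : lucasSeq t 0 (j + 1) = t ^ j := by
  induction j with
  | zero => simp [lucasSeq]
  | succ j ih => rw [lucasSeq_add_two, ih]; ring

theorem lucasSeq_mul (c t s : R) (j : ℕ) :
    lucasSeq (c * t) (c ^ 2 * s) (j + 1) = c ^ j * lucasSeq t s (j + 1) ∧
      c * lucasSeq (c * t) (c ^ 2 * s) j = c ^ j * lucasSeq t s j := by
  induction j with
  | zero => simp [lucasSeq]
  | succ j ih =>
    refine ⟨?_, by rw [ih.1]; ring⟩
    rw [lucasSeq_add_two, lucasSeq_add_two]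
    linear_combination c * t * ih.1 - c * s * ih.2

theorem twistQ_eq_lucasSeq (L M : R) (j : ℕ) :
    twistQ L M j = lucasSeq (twistT L M) (twistW L M ^ 2) j := by
  induction j using Nat.twoStepInduction with
  | zero => rfl
  | one => rfl
  | more j h1 h2 => rw [twistQ_add_two, h1, h2, lucasSeq_add_two]

/-- With weights `d` for `t` and `2d` for `s` the recursion is homogeneous, so it passes to initial
forms. -/
theorem HasInitialForm.lucasSeq {t s t' s' : MvPolynomial (Fin 2) R}
    (ht : HasInitialForm u v d t t') (hs : HasInitialForm u v (2 * d) s s') (j : ℕ) :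
    HasInitialForm u v ((j - 1) * d) (lucasSeq t s j) (lucasSeq t' s' j) := by
  induction j using Nat.twoStepInduction with
  | zero => exact ⟨.zero, .zero, by rw [_root_.lucasSeq, _root_.lucasSeq, sub_self]; exact .zero⟩
  | one => exact HasInitialForm.monomial 0 1 (by simp)
  | more j h1 h2 =>
    rw [lucasSeq_add_two, lucasSeq_add_two]
    have h3 := ht.mul h2
    have h4 := hs.mul h1
    rw [show d + ((j + 1 : ℕ) - 1) * d = ((j + 2 : ℕ) - 1) * d by push_cast; ring] at h3
    rw [show 2 * d + ((j : ℤ) - 1) * d = ((j + 2 : ℕ) - 1) * d by push_cast; ring] at h4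
    exact h3.minus h4

end InitialForm

/-! ### Initial forms of the A-polynomial on its sides. -/

section TwistInitialForm

open MvPolynomial

variable {u v d e d' : ℤ} {p q g h t s f : MvPolynomial (Fin 2) ℤ}

theorem HasInitialForm.term (c : ℤ) (a b : ℕ) (hd : u * a + v * b ≤ d) :
    HasInitialForm u v d (C c * X 0 ^ a * X 1 ^ b)
      (if u * a + v * b = d then C c * X 0 ^ a * X 1 ^ b else 0) := by
  have hm : (C c * X 0 ^ a * X 1 ^ b : MvPolynomial (Fin 2) ℤ) =
      MvPolynomial.monomial (Finsupp.single 0 a + Finsupp.single 1 b) c := by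
    rw [monomial_add_single, ← C_mul_X_pow_eq_monomial]
  rw [hm]
  split_ifs with h
  · exact .monomial _ c (by simpa using h)
  · exact .of_weightLE (.monomial (d := u * a + v * b) _ c (by simp)) (lt_of_le_of_ne hd h)

theorem HasInitialForm.pow (hp : HasInitialForm u v d p g) (j : ℕ) :
    HasInitialForm u v (j * d) (p ^ j) (g ^ j) := by
  induction j with
  | zero => exact HasInitialForm.monomial 0 1 (by simp)
  | succ j ih =>
    rw [pow_succ, pow_succ, Nat.cast_succ, add_one_mul]
    exact ih.mul hp

/-- It suffices to bound the weights of six monomials; the other three lie between `L` and `L M^8`.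
-/
theorem hasInitialForm_twistT (h4 : v * 4 ≤ d) (h0 : 0 ≤ d) (h10 : u ≤ d)
    (h18 : u + v * 8 ≤ d) (h24 : u * 2 + v * 4 ≤ d) (h28 : u * 2 + v * 8 ≤ d) :
    HasInitialForm (R := ℤ) u v d (twistT (X 0) (X 1)) (
      (if 0 = d then 1 else 0) + (if v * 4 = d then X 1 ^ 4 else 0) +
      (if u = d then -X 0 else 0) + (if u + v * 2 = d then C 2 * X 0 * X 1 ^ 2 else 0) +
      (if u + v * 4 = d then C 2 * X 0 * X 1 ^ 4 else 0) +
      (if u + v * 6 = d then C 2 * X 0 * X 1 ^ 6 else 0) +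
      (if u + v * 8 = d then -(X 0 * X 1 ^ 8) else 0) +
      (if u * 2 + v * 4 = d then X 0 ^ 2 * X 1 ^ 4 else 0) +
      (if u * 2 + v * 8 = d then X 0 ^ 2 * X 1 ^ 8 else 0)) := by
  have H := (((((((((HasInitialForm.term (u := u) (v := v) (d := d) 1 0 0 (by simpa)).add
    (.term 1 0 4 (by push_cast; linarith))).add (.term (-1) 1 0 (by push_cast; linarith))).add
    (.term 2 1 2 (by push_cast; linarith))).add (.term 2 1 4 (by push_cast; linarith))).add
    (.term 2 1 6 (by push_cast; linarith))).add (.term (-1) 1 8 (by push_cast; linarith))).add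
    (.term 1 2 4 (by push_cast; linarith))).add (.term 1 2 8 (by push_cast; linarith)))
  convert H using 1
  · simp only [twistT, map_neg, map_one, map_ofNat]
    ring
  · simp

theorem HasInitialForm.one_add (a b : ℕ) (h : u * a + v * b ≤ d) (h0 : 0 ≤ d) :
    HasInitialForm (R := ℤ) u v d (1 + X 0 ^ a * X 1 ^ b)
      ((if 0 = d then 1 else 0) + if u * a + v * b = d then X 0 ^ a * X 1 ^ b else 0) := by
  have H := (HasInitialForm.term (u := u) (v := v) (d := d) 1 0 0 (by simpa)).add (.term 1 a b h)
  convert H using 1 <;> simp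

theorem hasInitialForm_twistAPoly_of_pos {n : ℤ} (hn : 0 < n)
    (ht : HasInitialForm u v d (twistT (X 0) (X 1)) t)
    (hs : HasInitialForm (R := ℤ) u v (2 * d) (twistW (X 0) (X 1) ^ 2) s)
    (he : HasInitialForm u v d ((1 + X 0 * X 1 ^ 6) * (1 + X 0 * X 1 ^ 2)) f) :
    HasInitialForm u v (n * d) (twistKnotAPolynomial n)
      (-(lucasSeq t s (n.natAbs + 1) - f * lucasSeq t s n.natAbs)) := by
  have hk : (n.natAbs : ℤ) = n := by rw [Int.natCast_natAbs, abs_of_pos hn]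
  have h1 := ht.lucasSeq hs (n.natAbs + 1)
  have h2 := he.mul (ht.lucasSeq hs n.natAbs)
  rw [Nat.cast_succ, hk, add_sub_cancel_right] at h1
  rw [hk, show d + (n - 1) * d = n * d by ring] at h2
  rw [twistKnotAPolynomial, twistAPoly, if_pos hn, twistQ_eq_lucasSeq, twistQ_eq_lucasSeq]
  exact (h1.minus h2).neg

theorem hasInitialForm_twistAPoly_of_neg {n : ℤ} (hn : n < 0)
    (ht : HasInitialForm u v d (twistT (X 0) (X 1)) t)
    (hs : HasInitialForm (R := ℤ) u v (2 * d) (twistW (X 0) (X 1) ^ 2) s)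
    (hf : HasInitialForm u v d' (1 + X 0 * X 1 ^ 6) f)
    (hg : HasInitialForm u v (d' + d) (X 1 ^ 4 * (1 + X 0 * X 1 ^ 2) ^ 3) g) :
    HasInitialForm u v (d' + (-n - 1) * d) (twistKnotAPolynomial n)
      (f * lucasSeq t s n.natAbs - g * lucasSeq t s (n.natAbs - 1)) := by
  have hk : (n.natAbs : ℤ) = -n := by rw [Int.natCast_natAbs, abs_of_neg hn]
  have hk' : ((n.natAbs - 1 : ℕ) : ℤ) = -n - 1 := by omega
  have h1 := hf.mul (ht.lucasSeq hs n.natAbs)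
  have h2 := hg.mul (ht.lucasSeq hs (n.natAbs - 1))
  rw [hk] at h1
  rw [hk', show d' + d + (-n - 1 - 1) * d = d' + (-n - 1) * d by ring] at h2
  rw [twistKnotAPolynomial, twistAPoly, if_neg (by omega), twistQ_eq_lucasSeq, twistQ_eq_lucasSeq]
  exact h1.minus h2

theorem twistW_sq_eq : twistW (X 0) (X 1) ^ 2 =
    (C 1 * X 0 ^ 0 * X 1 ^ 4 * (1 + X 0 ^ 1 * X 1 ^ 2) ^ 4 : MvPolynomial (Fin 2) ℤ) := by
  simp only [twistW, map_one]
  ring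

/-- Weights for which the squared denominator of the clasp trace does not contribute. -/
theorem HasInitialForm.twistW_zero (he : u + v * 2 ≤ e) (h0 : 0 ≤ e) (hd : v * 4 + 4 * e < 2 * d) :
    HasInitialForm (R := ℤ) u v (2 * d) (twistW (X 0) (X 1) ^ 2) 0 := by
  have h1 := (HasInitialForm.term (u := u) (v := v) (d := v * 4) 1 0 4 (by simp)).mul
    ((HasInitialForm.one_add (u := u) (v := v) (d := e) 1 2 (by simpa) h0).pow 4)
  rw [twistW_sq_eq]
  exact .of_weightLE h1.weightLE (by push_cast; linarith)

theorem weightLE_mul_one_add_pow_three (he : u + v * 2 ≤ e) (h0 : 0 ≤ e) :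
    WeightLE u v (v * 4 + 3 * e)
      (X 1 ^ 4 * (1 + X 0 * X 1 ^ 2) ^ 3 : MvPolynomial (Fin 2) ℤ) := by
  have h1 := (HasInitialForm.term (u := u) (v := v) (d := v * 4) 1 0 4 (by simp)).mul
    ((HasInitialForm.one_add (u := u) (v := v) (d := e) 1 2 (by simpa) h0).pow 3)
  simpa using h1.weightLE

theorem HasInitialForm.one_add_two (he : u + v * 2 ≤ e) (h0 : 0 ≤ e) :
    HasInitialForm (R := ℤ) u v e (1 + X 0 * X 1 ^ 2)
      ((if 0 = e then 1 else 0) + if u + v * 2 = e then X 0 * X 1 ^ 2 else 0) := by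
  simpa using HasInitialForm.one_add (u := u) (v := v) (d := e) 1 2 (by simpa) h0

theorem HasInitialForm.one_add_six (he : u + v * 6 ≤ e) (h0 : 0 ≤ e) :
    HasInitialForm (R := ℤ) u v e (1 + X 0 * X 1 ^ 6)
      ((if 0 = e then 1 else 0) + if u + v * 6 = e then X 0 * X 1 ^ 6 else 0) := by
  simpa using HasInitialForm.one_add (u := u) (v := v) (d := e) 1 6 (by simpa) h0

/-- For weights normal to slope 4, both `W²` and the factor `(1 + L M^6)(1 + L M²)` are too light.
Only the `n`-th power of the initial form of `T` survives. -/
theorem hasInitialForm_upper_of_pos {n : ℤ} (hn : 0 < n) :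
    HasInitialForm (-4) 1 (n * 4) (twistKnotAPolynomial n)
      (-(X 1 ^ 4 - X 0 * X 1 ^ 8) ^ n.natAbs) := by
  have hT : HasInitialForm (R := ℤ) (-4) 1 4 (twistT (X 0) (X 1)) _ := hasInitialForm_twistT (by norm_num)
    (by norm_num) (by norm_num) (by norm_num) (by norm_num) (by norm_num)
  have hE := ((HasInitialForm.one_add_six (u := -4) (v := 1) (e := 2) (by norm_num)
    (by norm_num)).mul (.one_add_two (e := 0) (by norm_num) le_rfl)).weightLE
  have := hasInitialForm_twistAPoly_of_pos hn hT (.twistW_zero (e := 0) (by norm_num)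
    (by norm_num) (by norm_num)) (.of_weightLE hE (by norm_num))
  simpa [lucasSeq_zero_right, ← sub_eq_add_neg] using this

theorem hasInitialForm_lower_of_pos {n : ℤ} (hn : 0 < n) :
    HasInitialForm 4 (-1) (n * 4) (twistKnotAPolynomial n)
      (-(-X 0 + X 0 ^ 2 * X 1 ^ 4) ^ n.natAbs) := by
  have hT : HasInitialForm (R := ℤ) 4 (-1) 4 (twistT (X 0) (X 1)) _ := hasInitialForm_twistT (by norm_num)
    (by norm_num) (by norm_num) (by norm_num) (by norm_num) (by norm_num)
  have hE := ((HasInitialForm.one_add_six (u := 4) (v := -1) (e := 0) (by norm_num)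
    (by norm_num)).mul (.one_add_two (e := 2) (by norm_num) (by norm_num))).weightLE
  have := hasInitialForm_twistAPoly_of_pos hn hT (.twistW_zero (e := 2) (by norm_num)
    (by norm_num) (by norm_num)) (.of_weightLE hE (by norm_num))
  simpa [lucasSeq_zero_right] using this

/-- Here `(1 + L M^6)(1 + L M²)` has the same weight as `T` and contributes `L² M^8`. This cancels
against the corresponding term of one factor `T` and leaves `L M^8`. -/
theorem hasInitialForm_top_of_pos {n : ℤ} (hn : 0 < n) :
    HasInitialForm 0 1 (n * 8) (twistKnotAPolynomial n)
      (X 0 * X 1 ^ 8 * (-(X 0 * X 1 ^ 8) + X 0 ^ 2 * X 1 ^ 8) ^ (n.natAbs - 1)) := by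
  have hT : HasInitialForm (R := ℤ) 0 1 8 (twistT (X 0) (X 1)) _ := hasInitialForm_twistT (by norm_num)
    (by norm_num) (by norm_num) (by norm_num) (by norm_num) (by norm_num)
  have hE := ((HasInitialForm.one_add_six (u := 0) (v := 1) (e := 6) (by norm_num)
    (by norm_num)).mul (.one_add_two (e := 2) (by norm_num) (by norm_num)))
  have := hasInitialForm_twistAPoly_of_pos hn hT (.twistW_zero (e := 2) (by norm_num)
    (by norm_num) (by norm_num)) hE
  convert this using 1
  obtain ⟨j, hj⟩ : ∃ j, n.natAbs = j + 1 := ⟨n.natAbs - 1, by omega⟩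
  simp only [hj, lucasSeq_zero_right, Nat.add_sub_cancel]
  norm_num
  ring

theorem hasInitialForm_twistW_sq_right : HasInitialForm (R := ℤ) 1 0 (2 * 2)
    (twistW (X 0) (X 1) ^ 2) ((X 0 ^ 2 * X 1 ^ 4) ^ 2 * X 1 ^ 4) := by
  have hW := (HasInitialForm.term (u := 1) (v := 0) (d := 0) 1 0 4 (by norm_num)).mul
    ((HasInitialForm.one_add_two (u := 1) (v := 0) (e := 1) (by norm_num) (by norm_num)).pow 4)
  convert hW using 1
  · norm_num
  · simp [twistW]; ring
  · simp; ring

/-- For the weights `(1, 0)` the term `W²` does contribute. After taking out powers of `L² M^4` the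
recursion is the one at `L = 0`, and by `twistQ_zero_left` the combination collapses to a monomial.
-/
theorem hasInitialForm_right_of_pos {n : ℤ} (hn : 0 < n) :
    HasInitialForm 1 0 (n * 2) (twistKnotAPolynomial n)
      (-(X 0 ^ 2 * X 1 ^ 4) ^ n.natAbs) := by
  have hT : HasInitialForm (R := ℤ) 1 0 2 (twistT (X 0) (X 1)) _ := hasInitialForm_twistT (by norm_num)
    (by norm_num) (by norm_num) (by norm_num) (by norm_num) (by norm_num)
  have h2 := HasInitialForm.one_add_two (u := 1) (v := 0) (e := 1) (by norm_num) (by norm_num)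
  have hE := (HasInitialForm.one_add_six (u := 1) (v := 0) (e := 1) (by norm_num)
    (by norm_num)).mul h2
  have := hasInitialForm_twistAPoly_of_pos hn hT hasInitialForm_twistW_sq_right hE
  convert this using 1
  obtain ⟨j, hj⟩ : ∃ j, n.natAbs = j + 1 := ⟨n.natAbs - 1, by omega⟩
  have h3 := lucasSeq_mul (X 0 ^ 2 * X 1 ^ 4 : MvPolynomial (Fin 2) ℤ) (1 + X 1 ^ 4) (X 1 ^ 4)
  have h4 := (twistQ_zero_left (X 1 : MvPolynomial (Fin 2) ℤ) (j + 1)).1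
  have hT0 : twistT 0 (X 1 : MvPolynomial (Fin 2) ℤ) = 1 + X 1 ^ 4 := by simp [twistT]
  have hW0 : twistW 0 (X 1 : MvPolynomial (Fin 2) ℤ) ^ 2 = X 1 ^ 4 := by simp [twistW]; ring
  rw [twistQ_eq_lucasSeq, twistQ_eq_lucasSeq, hT0, hW0] at h4
  rw [hj]
  norm_num
  rw [show (X 0 ^ 2 * X 1 ^ 4 + X 0 ^ 2 * X 1 ^ 8 : MvPolynomial (Fin 2) ℤ) =
    X 0 ^ 2 * X 1 ^ 4 * (1 + X 1 ^ 4) by ring, mul_comm (_ ^ 2) (X 1 ^ 4 : MvPolynomial (Fin 2) ℤ),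
    mul_comm (X 1 ^ 4) (_ ^ 2), (h3 (j + 1)).1, (h3 j).1]
  linear_combination (X 0 ^ 2 * X 1 ^ 4) ^ (j + 1) * h4

theorem hasInitialForm_upper_of_neg {n : ℤ} (hn : n < 0) :
    HasInitialForm (-4) 1 (2 + (-n - 1) * 4) (twistKnotAPolynomial n)
      (X 0 * X 1 ^ 6 * (X 1 ^ 4 - X 0 * X 1 ^ 8) ^ (n.natAbs - 1)) := by
  have hT : HasInitialForm (R := ℤ) (-4) 1 4 (twistT (X 0) (X 1)) _ := hasInitialForm_twistT (by norm_num)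
    (by norm_num) (by norm_num) (by norm_num) (by norm_num) (by norm_num)
  have := hasInitialForm_twistAPoly_of_neg hn hT (.twistW_zero (e := 0) (by norm_num)
    (by norm_num) (by norm_num)) (.one_add_six (e := 2) (by norm_num) (by norm_num))
    (.of_weightLE (weightLE_mul_one_add_pow_three (e := 0) (by norm_num) le_rfl) (by norm_num))
  obtain ⟨j, hj⟩ : ∃ j, n.natAbs = j + 1 := ⟨n.natAbs - 1, by omega⟩
  simpa [lucasSeq_zero_right, hj, ← sub_eq_add_neg] using this

theorem hasInitialForm_lower_of_neg {n : ℤ} (hn : n < 0) :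
    HasInitialForm 4 (-1) ((-n - 1) * 4) (twistKnotAPolynomial n)
      ((-X 0 + X 0 ^ 2 * X 1 ^ 4) ^ (n.natAbs - 1)) := by
  have hT : HasInitialForm (R := ℤ) 4 (-1) 4 (twistT (X 0) (X 1)) _ := hasInitialForm_twistT (by norm_num)
    (by norm_num) (by norm_num) (by norm_num) (by norm_num) (by norm_num)
  have := hasInitialForm_twistAPoly_of_neg hn hT (.twistW_zero (e := 2) (by norm_num)
    (by norm_num) (by norm_num)) (.one_add_six (e := 0) (by norm_num) (by norm_num))
    (.of_weightLE (weightLE_mul_one_add_pow_three (e := 2) (by norm_num) (by norm_num))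
      (by norm_num))
  obtain ⟨j, hj⟩ : ∃ j, n.natAbs = j + 1 := ⟨n.natAbs - 1, by omega⟩
  simpa [lucasSeq_zero_right, hj] using this

theorem hasInitialForm_top_of_neg {n : ℤ} (hn : n < 0) :
    HasInitialForm 0 1 (6 + (-n - 1) * 8) (twistKnotAPolynomial n)
      (X 0 * X 1 ^ 6 * (-(X 0 * X 1 ^ 8) + X 0 ^ 2 * X 1 ^ 8) ^ (n.natAbs - 1)) := by
  have hT : HasInitialForm (R := ℤ) 0 1 8 (twistT (X 0) (X 1)) _ := hasInitialForm_twistT (by norm_num)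
    (by norm_num) (by norm_num) (by norm_num) (by norm_num) (by norm_num)
  have := hasInitialForm_twistAPoly_of_neg hn hT (.twistW_zero (e := 2) (by norm_num)
    (by norm_num) (by norm_num)) (.one_add_six (e := 6) (by norm_num) (by norm_num))
    (.of_weightLE (weightLE_mul_one_add_pow_three (e := 2) (by norm_num) (by norm_num))
      (by norm_num))
  obtain ⟨j, hj⟩ : ∃ j, n.natAbs = j + 1 := ⟨n.natAbs - 1, by omega⟩
  simpa [lucasSeq_zero_right, hj] using this

theorem hasInitialForm_right_of_neg {n : ℤ} (hn : n < 0) :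
    HasInitialForm 1 0 (1 + (-n - 1) * 2) (twistKnotAPolynomial n)
      (X 0 * X 1 ^ 6 * (X 0 ^ 2 * X 1 ^ 8) ^ (n.natAbs - 1)) := by
  have hT : HasInitialForm (R := ℤ) 1 0 2 (twistT (X 0) (X 1)) _ := hasInitialForm_twistT (by norm_num)
    (by norm_num) (by norm_num) (by norm_num) (by norm_num) (by norm_num)
  have h2 := HasInitialForm.one_add_two (u := 1) (v := 0) (e := 1) (by norm_num) (by norm_num)
  have hF := HasInitialForm.one_add_six (u := 1) (v := 0) (e := 1) (by norm_num) (by norm_num)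
  have hX := HasInitialForm.term (u := 1) (v := 0) (d := 0) 1 0 4 (by norm_num)
  have hG : HasInitialForm (R := ℤ) 1 0 (1 + 2) (X 1 ^ 4 * (1 + X 0 * X 1 ^ 2) ^ 3)
      (X 0 * X 1 ^ 6 * (X 0 ^ 2 * X 1 ^ 4)) := by
    convert hX.mul (h2.pow 3) using 1
    · norm_num
    · simp
    · simp; ring
  have := hasInitialForm_twistAPoly_of_neg hn hT hasInitialForm_twistW_sq_right hF hG
  convert this using 1
  obtain ⟨j, hj⟩ : ∃ j, n.natAbs = j + 1 := ⟨n.natAbs - 1, by omega⟩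
  have h3 := lucasSeq_mul (X 0 ^ 2 * X 1 ^ 4 : MvPolynomial (Fin 2) ℤ) (1 + X 1 ^ 4) (X 1 ^ 4) j
  have h4 := (twistQ_zero_left (X 1 : MvPolynomial (Fin 2) ℤ) j).2
  have hT0 : twistT 0 (X 1 : MvPolynomial (Fin 2) ℤ) = 1 + X 1 ^ 4 := by simp [twistT]
  have hW0 : twistW 0 (X 1 : MvPolynomial (Fin 2) ℤ) ^ 2 = X 1 ^ 4 := by simp [twistW]; ring
  rw [twistQ_eq_lucasSeq, twistQ_eq_lucasSeq, hT0, hW0] at h4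
  rw [hj, Nat.add_sub_cancel]
  norm_num
  rw [show (X 0 ^ 2 * X 1 ^ 4 + X 0 ^ 2 * X 1 ^ 8 : MvPolynomial (Fin 2) ℤ) =
    X 0 ^ 2 * X 1 ^ 4 * (1 + X 1 ^ 4) by ring, h3.1]
  have h5 : (X 0 ^ 2 * X 1 ^ 8 : MvPolynomial (Fin 2) ℤ) ^ j =
      (X 0 ^ 2 * X 1 ^ 4) ^ j * X 1 ^ (4 * j) := by
    rw [mul_pow, mul_pow, ← pow_mul, ← pow_mul, ← pow_mul]; ring
  rw [h5]
  linear_combination -X 0 * X 1 ^ 6 * (X 0 ^ 2 * X 1 ^ 4) ^ j * h4 + X 0 * X 1 ^ 6 * h3.2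

theorem hasInitialForm_left_of_pos {n : ℤ} (hn : 0 < n) :
    HasInitialForm (-1) 0 0 (twistKnotAPolynomial n) (-X 1 ^ (4 * n.natAbs)) := by
  have h := hasInitialForm_zero_left (twistKnotAPolynomial n)
  rwa [twistKnotAPolynomial, ← AlgHom.coe_toRingHom, map_twistAPoly, AlgHom.coe_toRingHom, aeval_X,
    aeval_X, Matrix.cons_val_zero, Matrix.cons_val_one, Matrix.cons_val_fin_one,
    twistAPoly_zero_left_of_pos hn] at h

theorem hasInitialForm_left_of_neg {n : ℤ} (hn : n < 0) :
    HasInitialForm (-1) 0 0 (twistKnotAPolynomial n) 1 := by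
  have h := hasInitialForm_zero_left (twistKnotAPolynomial n)
  rwa [twistKnotAPolynomial, ← AlgHom.coe_toRingHom, map_twistAPoly, AlgHom.coe_toRingHom, aeval_X,
    aeval_X, Matrix.cons_val_zero, Matrix.cons_val_one, Matrix.cons_val_fin_one,
    twistAPoly_zero_left_of_neg hn] at h

theorem hasInitialForm_bottom_of_pos {n : ℤ} (hn : 0 < n) :
    HasInitialForm 0 (-1) 0 (twistKnotAPolynomial n) (X 0 * (1 - X 0) ^ (n.natAbs - 1)) := by
  have h := hasInitialForm_zero_right (twistKnotAPolynomial n)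
  rwa [twistKnotAPolynomial, ← AlgHom.coe_toRingHom, map_twistAPoly, AlgHom.coe_toRingHom, aeval_X,
    aeval_X, Matrix.cons_val_zero, Matrix.cons_val_one, Matrix.cons_val_fin_one,
    twistAPoly_zero_right_of_pos hn] at h

theorem hasInitialForm_bottom_of_neg {n : ℤ} (hn : n < 0) :
    HasInitialForm 0 (-1) 0 (twistKnotAPolynomial n) ((1 - X 0) ^ (n.natAbs - 1)) := by
  have h := hasInitialForm_zero_right (twistKnotAPolynomial n)
  rwa [twistKnotAPolynomial, ← AlgHom.coe_toRingHom, map_twistAPoly, AlgHom.coe_toRingHom, aeval_X,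
    aeval_X, Matrix.cons_val_zero, Matrix.cons_val_one, Matrix.cons_val_fin_one,
    twistAPoly_zero_right_of_neg hn] at h

end TwistInitialForm

/-! ### Exposed faces of hexagons and Newton polygons. -/

section NewtonPolygon

open MvPolynomial

theorem exists_linear_of_continuousLinearMap (l : StrongDual ℝ (ℝ × ℝ)) :
    ∃ a b : ℝ, ∀ x, l x = a * x.1 + b * x.2 := by
  refine ⟨l (1, 0), l (0, 1), fun x => ?_⟩
  have : x = x.1 • ((1, 0) : ℝ × ℝ) + x.2 • ((0, 1) : ℝ × ℝ) := by ext <;> simp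
  conv_lhs => rw [this]
  rw [map_add, map_smul, map_smul, smul_eq_mul, smul_eq_mul]
  ring

/-- A functional in the normal cone of a vertex `z` of `H` that is maximal at two points of `H`
is proportional to one of the two normals spanning the cone. -/
theorem face_eq_of_mem_cone {E : Type*} {H S : Set E} {f g l : E → ℝ} {d e a b : ℝ}
    (hf : ∀ x ∈ H, f x ≤ d) (hg : ∀ x ∈ H, g x ≤ e)
    (hz : ∃ z ∈ H, f z = d ∧ g z = e) (hinj : ∀ x y, f x = f y → g x = g y → x = y)
    (ha : 0 ≤ a) (hb : 0 ≤ b) (hl : ∀ x, l x = a * f x + b * g x)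
    (hS : S = {x ∈ H | ∀ y ∈ H, l y ≤ l x}) {p q : E} (hp : p ∈ S) (hq : q ∈ S) (hpq : p ≠ q) :
    S = H ∨ S = {x ∈ H | f x = d} ∨ S = {x ∈ H | g x = e} := by
  obtain ⟨z, hzH, hzf, hzg⟩ := hz
  have key : ∀ x, x ∈ S ↔ x ∈ H ∧ a * (d - f x) = 0 ∧ b * (e - g x) = 0 := by
    intro x
    rw [hS]
    constructor
    · rintro ⟨hx, h⟩
      have h1 := h z hzH
      have h2 := mul_nonneg ha (sub_nonneg.2 (hf x hx))
      have h3 := mul_nonneg hb (sub_nonneg.2 (hg x hx))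
      rw [hl, hl, hzf, hzg] at h1
      exact ⟨hx, by linarith, by linarith⟩
    · rintro ⟨hx, h1, h2⟩
      refine ⟨hx, fun y hy => ?_⟩
      have h3 := mul_nonneg ha (sub_nonneg.2 (hf y hy))
      have h4 := mul_nonneg hb (sub_nonneg.2 (hg y hy))
      rw [hl, hl]
      linarith
  rcases eq_or_ne a 0 with rfl | ha'
  · rcases eq_or_ne b 0 with rfl | hb'
    · left
      ext x
      simp [key]
    · right; right
      ext x
      simp only [key, zero_mul, mul_eq_zero, hb', false_or, true_and, sub_eq_zero, Set.mem_ofPred_eq]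
      exact and_congr_right fun _ => eq_comm
  · rcases eq_or_ne b 0 with rfl | hb'
    · right; left
      ext x
      simp only [key, zero_mul, mul_eq_zero, ha', false_or, and_true, sub_eq_zero, Set.mem_ofPred_eq]
      exact and_congr_right fun _ => eq_comm
    · exfalso
      simp only [key, mul_eq_zero, ha', hb', false_or, sub_eq_zero] at hp hq
      exact hpq (hinj p q (hp.2.1.symm.trans hq.2.1) (hp.2.2.symm.trans hq.2.2))

/-- The height of a point over the line of slope `r` through the origin. -/
def lineHeight (r : ℝ) (x : ℝ × ℝ) : ℝ := x.2 - r * x.1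

theorem eq_of_lineHeight_eq {r s : ℝ} (h : r ≠ s) {x y : ℝ × ℝ}
    (hr : lineHeight r x = lineHeight r y) (hs : lineHeight s x = lineHeight s y) : x = y := by
  unfold lineHeight at hr hs
  have h1 : x.1 = y.1 := mul_left_cancel₀ (sub_ne_zero.2 h) (by linarith)
  ext
  · exact h1
  · rw [h1] at hr; linarith

/-- An exposed face with more than one point of a hexagon with three pairs of parallel sides. -/
theorem exposed_hexagon {H S : Set (ℝ × ℝ)} {r₁ r₂ r₃ c₁ c₂ c₃ d₁ d₂ d₃ : ℝ} (h12 : r₁ < r₂)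
    (h23 : r₂ < r₃) (hc₁ : ∀ x ∈ H, c₁ ≤ lineHeight r₁ x) (hc₂ : ∀ x ∈ H, c₂ ≤ lineHeight r₂ x)
    (hc₃ : ∀ x ∈ H, c₃ ≤ lineHeight r₃ x) (hd₁ : ∀ x ∈ H, lineHeight r₁ x ≤ d₁)
    (hd₂ : ∀ x ∈ H, lineHeight r₂ x ≤ d₂) (hd₃ : ∀ x ∈ H, lineHeight r₃ x ≤ d₃)
    (h₀ : ∃ z ∈ H, lineHeight r₃ z = d₃ ∧ lineHeight r₁ z = c₁)
    (h₁ : ∃ z ∈ H, lineHeight r₁ z = c₁ ∧ lineHeight r₂ z = c₂)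
    (h₂ : ∃ z ∈ H, lineHeight r₂ z = c₂ ∧ lineHeight r₃ z = c₃)
    (h₃ : ∃ z ∈ H, lineHeight r₃ z = c₃ ∧ lineHeight r₁ z = d₁)
    (h₄ : ∃ z ∈ H, lineHeight r₁ z = d₁ ∧ lineHeight r₂ z = d₂)
    (h₅ : ∃ z ∈ H, lineHeight r₂ z = d₂ ∧ lineHeight r₃ z = d₃)
    (hS : IsExposed ℝ H S) {p q : ℝ × ℝ} (hp : p ∈ S) (hq : q ∈ S) (hpq : p ≠ q) :
    S = H ∨ ∃ i : Fin 3, S = {x ∈ H | lineHeight (![r₁, r₂, r₃] i) x = ![c₁, c₂, c₃] i} ∨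
      S = {x ∈ H | lineHeight (![r₁, r₂, r₃] i) x = ![d₁, d₂, d₃] i} := by
  obtain ⟨l, hl⟩ := hS ⟨p, hp⟩
  obtain ⟨a, b, hab⟩ := exists_linear_of_continuousLinearMap l
  have h13 := h12.trans h23
  have inj : ∀ {r s : ℝ}, r ≠ s → ∀ {f g : ℝ × ℝ → ℝ},
      (f = lineHeight r ∨ f = fun x => -lineHeight r x) →
      (g = lineHeight s ∨ g = fun x => -lineHeight s x) →
      ∀ x y, f x = f y → g x = g y → x = y := by
    intro r s hrs f g hf hg x y hx hy
    refine eq_of_lineHeight_eq hrs ?_ ?_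
    · rcases hf with rfl | rfl
      exacts [hx, neg_inj.1 hx]
    · rcases hg with rfl | rfl
      exacts [hy, neg_inj.1 hy]
  have low : ∀ {r c : ℝ}, (∀ x ∈ H, c ≤ lineHeight r x) → ∀ x ∈ H, -lineHeight r x ≤ -c :=
    fun h x hx => neg_le_neg (h x hx)
  have fin : ∀ {r s c d : ℝ} {i j : Fin 3}, r = ![r₁, r₂, r₃] i → s = ![r₁, r₂, r₃] j →
      (c = ![c₁, c₂, c₃] i ∨ c = ![d₁, d₂, d₃] i) → (d = ![c₁, c₂, c₃] j ∨ d = ![d₁, d₂, d₃] j) →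
      (S = H ∨ S = {x ∈ H | lineHeight r x = c} ∨ S = {x ∈ H | lineHeight s x = d}) →
      S = H ∨ ∃ i : Fin 3, S = {x ∈ H | lineHeight (![r₁, r₂, r₃] i) x = ![c₁, c₂, c₃] i} ∨
      S = {x ∈ H | lineHeight (![r₁, r₂, r₃] i) x = ![d₁, d₂, d₃] i} := by
    rintro r s c d i j rfl rfl hc hd (h | h | h)
    · exact Or.inl h
    · rcases hc with rfl | rfl
      exacts [Or.inr ⟨i, Or.inl h⟩, Or.inr ⟨i, Or.inr h⟩]
    · rcases hd with rfl | rfl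
      exacts [Or.inr ⟨j, Or.inl h⟩, Or.inr ⟨j, Or.inr h⟩]
  have dpos : ∀ {r s : ℝ}, r < s → 0 ≤ (s - r)⁻¹ := fun h => inv_nonneg.2 (sub_nonneg.2 h.le)
  -- Any linear functional in terms of the heights for two slopes. The signs of `a + r_i b` for the
  -- three slopes then tell which of the six normal cones contains it.
  have comb : ∀ {r s : ℝ}, r < s → ∀ x : ℝ × ℝ, l x = (s - r)⁻¹ * (a + s * b) * lineHeight r x -
      (s - r)⁻¹ * (a + r * b) * lineHeight s x := by
    intro r s hrs x
    have := sub_ne_zero.2 hrs.ne'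
    rw [hab, lineHeight, lineHeight]
    field_simp
    ring
  rcases le_total 0 (a + r₁ * b) with k1 | k1 <;> rcases le_total 0 (a + r₃ * b) with k3 | k3
  · refine fin (i := 2) (j := 0) rfl rfl (Or.inl rfl) (Or.inr rfl) ?_
    have := face_eq_of_mem_cone (low hc₃) hd₁ (by simpa using h₃)
      (inj h13.ne' (Or.inr rfl) (Or.inl rfl)) (mul_nonneg (dpos h13) k1) (mul_nonneg (dpos h13) k3)
      (fun x => by rw [comb h13]; ring) hl hp hq hpq
    simpa using this
  · rcases le_total 0 (a + r₂ * b) with k2 | k2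
    · refine fin (i := 1) (j := 2) rfl rfl (Or.inl rfl) (Or.inl rfl) ?_
      have := face_eq_of_mem_cone (low hc₂) (low hc₃) (by simpa using h₂)
        (inj h23.ne (Or.inr rfl) (Or.inr rfl)) (mul_nonneg (dpos h23) (neg_nonneg.2 k3))
        (mul_nonneg (dpos h23) k2) (fun x => by rw [comb h23]; ring) hl hp hq hpq
      simpa using this
    · refine fin (i := 0) (j := 1) rfl rfl (Or.inl rfl) (Or.inl rfl) ?_
      have := face_eq_of_mem_cone (low hc₁) (low hc₂) (by simpa using h₁)
        (inj h12.ne (Or.inr rfl) (Or.inr rfl)) (mul_nonneg (dpos h12) (neg_nonneg.2 k2))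
        (mul_nonneg (dpos h12) k1) (fun x => by rw [comb h12]; ring) hl hp hq hpq
      simpa using this
  · rcases le_total 0 (a + r₂ * b) with k2 | k2
    · refine fin (i := 0) (j := 1) rfl rfl (Or.inr rfl) (Or.inr rfl) ?_
      have := face_eq_of_mem_cone hd₁ hd₂ h₄
        (inj h12.ne (Or.inl rfl) (Or.inl rfl)) (mul_nonneg (dpos h12) k2)
        (mul_nonneg (dpos h12) (neg_nonneg.2 k1)) (fun x => by rw [comb h12]; ring) hl hp hq hpq
      exact this
    · refine fin (i := 1) (j := 2) rfl rfl (Or.inr rfl) (Or.inr rfl) ?_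
      have := face_eq_of_mem_cone hd₂ hd₃ h₅
        (inj h23.ne (Or.inl rfl) (Or.inl rfl)) (mul_nonneg (dpos h23) k3)
        (mul_nonneg (dpos h23) (neg_nonneg.2 k2)) (fun x => by rw [comb h23]; ring) hl hp hq hpq
      exact this
  · refine fin (i := 2) (j := 0) rfl rfl (Or.inr rfl) (Or.inl rfl) ?_
    have := face_eq_of_mem_cone hd₃ (low hc₁) (by simpa using h₀)
      (inj h13.ne' (Or.inl rfl) (Or.inr rfl)) (mul_nonneg (dpos h13) (neg_nonneg.2 k1))
      (mul_nonneg (dpos h13) (neg_nonneg.2 k3)) (fun x => by rw [comb h13]; ring) hl hp hq hpq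
    simpa using this

variable {A : MvPolynomial (Fin 2) ℤ}

theorem mem_newtonPolygon {m : Fin 2 →₀ ℕ} (hm : m ∈ A.support) :
    exponentPoint m ∈ newtonPolygon A :=
  subset_convexHull ℝ _ ⟨m, hm, rfl⟩

theorem WeightLE.le_of_mem_newtonPolygon {u v d : ℤ} (h : WeightLE u v d A) {x : ℝ × ℝ}
    (hx : x ∈ newtonPolygon A) : (u : ℝ) * x.1 + v * x.2 ≤ d := by
  have hc : Convex ℝ {x : ℝ × ℝ | (u : ℝ) * x.1 + v * x.2 ≤ d} := by
    refine convex_halfSpace_le (f := fun x : ℝ × ℝ => (u : ℝ) * x.1 + v * x.2) ⟨?_, ?_⟩ _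
    · intro x y; simp only [Prod.fst_add, Prod.snd_add]; ring
    · intro c x; simp only [Prod.smul_fst, Prod.smul_snd, smul_eq_mul]; ring
  refine convexHull_min ?_ hc hx
  rintro _ ⟨m, hm, rfl⟩
  have := h m hm
  simp only [exponentPoint, Set.mem_ofPred_eq]
  exact_mod_cast this

theorem exponentPoint_injective : Function.Injective exponentPoint := by
  intro m m' h
  simp only [exponentPoint, Prod.mk.injEq, Nat.cast_inj] at h
  ext i
  fin_cases i
  exacts [h.1, h.2]

theorem hasSlope_of_lineHeight_eq {p q : Fin 2 →₀ ℕ} (hpq : p ≠ q) {r : ℚ}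
    (h : lineHeight r (exponentPoint p) = lineHeight r (exponentPoint q)) : HasSlope p q r := by
  simp only [lineHeight, exponentPoint] at h
  have h' : (p 1 : ℚ) - r * p 0 = q 1 - r * q 0 := by exact_mod_cast h
  refine ⟨fun h0 => hpq ?_, by linarith⟩
  rw [h0] at h'
  have h1 : p 1 = q 1 := by exact_mod_cast sub_left_inj.1 h'
  ext i
  fin_cases i
  exacts [h0, h1]

end NewtonPolygon

/-! ### From initial forms to edges and edge polynomials. -/

section EdgePolynomial

open MvPolynomial

variable {A g : MvPolynomial (Fin 2) ℤ}

open Classical in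
/-- `F` is an edge of slope `r` of the Newton polygon of `A`, with edge polynomial `f`. -/
structure IsEdgeFace (A : MvPolynomial (Fin 2) ℤ) (r : ℤ) (F : Set (ℝ × ℝ))
    (f : Polynomial ℤ) : Prop where
  isEdgePolynomial : IsEdgePolynomial A r f
  sum_eq : ∀ p q : Fin 2 →₀ ℕ, p 0 < q 0 →
    segment ℝ (exponentPoint p) (exponentPoint q) = F →
    ∑ m ∈ A.support with exponentPoint m ∈ segment ℝ (exponentPoint p) (exponentPoint q),
      Polynomial.monomial ((m 0 - p 0) / (r : ℚ).den) (coeff m A) = f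

theorem mem_segment_of_lineHeight_eq {r : ℝ} {x y z : ℝ × ℝ} (hxy : x.1 < y.1)
    (hx : lineHeight r x = lineHeight r z) (hy : lineHeight r y = lineHeight r z)
    (h₁ : x.1 ≤ z.1) (h₂ : z.1 ≤ y.1) : z ∈ segment ℝ x y := by
  have h : 0 < y.1 - x.1 := sub_pos.2 hxy
  refine ⟨(y.1 - z.1) / (y.1 - x.1), (z.1 - x.1) / (y.1 - x.1),
    div_nonneg (by linarith) h.le, div_nonneg (by linarith) h.le, by field_simp; ring, ?_⟩
  unfold lineHeight at hx hy
  have h2 : x.2 = z.2 - r * z.1 + r * x.1 := by linarith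
  have h3 : y.2 = z.2 - r * z.1 + r * y.1 := by linarith
  ext
  · simp only [Prod.fst_add, Prod.smul_fst, smul_eq_mul]
    field_simp
    ring
  · simp only [Prod.snd_add, Prod.smul_snd, smul_eq_mul, h2, h3]
    field_simp
    ring

theorem le_fst_of_mem_segment {x y z : ℝ × ℝ} (hxy : x.1 ≤ y.1) (hz : z ∈ segment ℝ x y) :
    x.1 ≤ z.1 := by
  obtain ⟨a, b, ha, hb, hab, rfl⟩ := hz
  simp only [Prod.fst_add, Prod.smul_fst, smul_eq_mul]
  have h : x.1 = a * x.1 + b * x.1 := by rw [← add_mul, hab, one_mul]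
  linarith [mul_le_mul_of_nonneg_left hxy hb]

/-- The functional with weights `u = -v r` and `v` exposes the face, the sign of `v` telling whether
it is an upper or a lower side. As the slope is an integer, `t` counts the `L`-exponent from the
left end point, so the edge polynomial is the initial form at `M = 1` divided by a power of the
variable. -/
theorem HasInitialForm.isEdgeFace {u v d r c : ℤ} {F : Set (ℝ × ℝ)} {f : Polynomial ℤ}
    {p₀ q₀ : Fin 2 →₀ ℕ} (hA : HasInitialForm u v d A g) (hv : v ≠ 0) (hu : u = -(v * r))
    (hd : d = v * c) (hF : F = {x ∈ newtonPolygon A | lineHeight r x = c})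
    (hp₀ : p₀ ∈ A.support) (hq₀ : q₀ ∈ A.support) (hp₀d : u * p₀ 0 + v * p₀ 1 = d)
    (hq₀d : u * q₀ 0 + v * q₀ 1 = d) (hlt : p₀ 0 < q₀ 0)
    (hface : ∀ x ∈ F, (p₀ 0 : ℝ) ≤ x.1 ∧ x.1 ≤ q₀ 0)
    (hf : aeval ![Polynomial.X, 1] g = Polynomial.X ^ p₀ 0 * f) : IsEdgeFace A r F f := by
  classical
  have hv' : (v : ℝ) ≠ 0 := Int.cast_ne_zero.2 hv
  have hw : ∀ x : ℝ × ℝ, (u : ℝ) * x.1 + v * x.2 = v * lineHeight r x := by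
    intro x
    rw [hu, lineHeight]
    push_cast
    ring
  have hmem : ∀ m ∈ A.support, (exponentPoint m ∈ F ↔ u * m 0 + v * m 1 = d) := by
    intro m hm
    have h1 := hw (exponentPoint m)
    rw [hF, Set.mem_ofPred_eq, and_iff_right (mem_newtonPolygon hm), ← mul_right_inj' hv', ← h1, hd]
    simp only [exponentPoint]
    exact_mod_cast Iff.rfl
  have hpF := (hmem p₀ hp₀).2 hp₀d
  have hqF := (hmem q₀ hq₀).2 hq₀d
  have hconv : Convex ℝ F := by
    rw [hF]
    refine (convex_convexHull ℝ _).inter (?_ : Convex ℝ {x : ℝ × ℝ | lineHeight r x = c})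
    refine convex_hyperplane (f := lineHeight r) ⟨?_, ?_⟩ _
    · intro x y; simp only [lineHeight, Prod.fst_add, Prod.snd_add]; ring
    · intro k x; simp only [lineHeight, Prod.smul_fst, Prod.smul_snd, smul_eq_mul]; ring
  have hltR : (p₀ 0 : ℝ) < q₀ 0 := Nat.cast_lt.2 hlt
  have hseg : segment ℝ (exponentPoint p₀) (exponentPoint q₀) = F := by
    refine (hconv.segment_subset hpF hqF).antisymm fun x hx => ?_
    obtain ⟨h1, h2⟩ := hface x hx
    rw [hF] at hpF hqF hx
    exact mem_segment_of_lineHeight_eq hltR (hpF.2.trans hx.2.symm) (hqF.2.trans hx.2.symm) h1 h2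
  -- An edge is given by its end points; those of any segment equal to `F` have the same left
  -- abscissa, so the edge polynomial depends on `F` alone.
  have hsum : ∀ p q : Fin 2 →₀ ℕ, p 0 < q 0 →
      segment ℝ (exponentPoint p) (exponentPoint q) = F →
      ∑ m ∈ A.support with exponentPoint m ∈ segment ℝ (exponentPoint p) (exponentPoint q),
        Polynomial.monomial ((m 0 - p 0) / (r : ℚ).den) (coeff m A) = f := by
    intro p q hpq hF'
    have hp0 : p 0 = p₀ 0 := by
      apply le_antisymm
      · rw [← hF'] at hpF
        have : (p 0 : ℝ) ≤ p₀ 0 :=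
          le_fst_of_mem_segment (x := exponentPoint p) (y := exponentPoint q)
            (Nat.cast_le.2 hpq.le) hpF
        exact_mod_cast this
      · have : (p₀ 0 : ℝ) ≤ p 0 := (hface _ (hF' ▸ left_mem_segment ℝ (exponentPoint p) (exponentPoint q))).1
        exact_mod_cast this
    apply mul_left_cancel₀ (pow_ne_zero (p₀ 0) Polynomial.X_ne_zero)
    rw [← hf, ← hA.sum_monomial, Finset.mul_sum, hF']
    refine Finset.sum_congr (Finset.filter_congr fun m hm => hmem m hm) fun m hm => ?_
    rw [Finset.mem_filter] at hm
    have h1 : p₀ 0 ≤ m 0 := by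
      have : (p₀ 0 : ℝ) ≤ m 0 := (hface _ ((hmem m hm.1).2 hm.2)).1
      exact_mod_cast this
    rw [Polynomial.X_pow_mul_monomial, hp0, Rat.den_intCast, Nat.div_one, Nat.sub_add_cancel h1]
  refine ⟨⟨p₀, q₀, ⟨fun h => hlt.ne (by rw [h]), ?_⟩, ?_, hlt, (hsum p₀ q₀ hlt hseg).symm⟩, hsum⟩
  · rw [hseg]
    intro _
    refine ⟨(u : ℝ) • ContinuousLinearMap.fst ℝ ℝ ℝ + (v : ℝ) • ContinuousLinearMap.snd ℝ ℝ ℝ, ?_⟩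
    rw [hF]
    ext x
    simp only [Set.mem_ofPred_eq, add_apply, smul_apply,
      ContinuousLinearMap.coe_fst', ContinuousLinearMap.coe_snd', smul_eq_mul]
    have hle := fun y hy => hA.weightLE.le_of_mem_newtonPolygon (x := y) hy
    refine and_congr_right fun hx => ⟨fun h y hy => ?_, fun h => ?_⟩
    · refine (hle y hy).trans_eq ?_
      rw [hw, h, hd]
      push_cast
      ring
    · rw [hF] at hpF
      have h1 := h _ hpF.1
      have h2 := hle x hx
      rw [hw, hpF.2, hw] at h1
      rw [hw, hd] at h2
      push_cast at h2
      exact mul_left_cancel₀ hv' (le_antisymm h2 h1)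
  · rw [hF] at hpF hqF
    refine hasSlope_of_lineHeight_eq (fun h => hlt.ne (by rw [h])) ?_
    rw [Rat.cast_intCast, hpF.2, hqF.2]

theorem setOf_isEdgePolynomial {r : ℤ} {F₁ F₂ : Set (ℝ × ℝ)} {f₁ f₂ : Polynomial ℤ}
    (h₁ : IsEdgeFace A r F₁ f₁) (h₂ : IsEdgeFace A r F₂ f₂)
    (h : ∀ p q, IsNewtonEdge A p q → HasSlope p q r →
      segment ℝ (exponentPoint p) (exponentPoint q) = F₁ ∨
      segment ℝ (exponentPoint p) (exponentPoint q) = F₂) :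
    {f | IsEdgePolynomial A r f} = {f₁, f₂} := by
  ext f
  simp only [Set.mem_ofPred_eq, Set.mem_insert_iff, Set.mem_singleton_iff]
  constructor
  · rintro ⟨p, q, hpq, hr, hlt, rfl⟩
    rcases h p q hpq hr with hF | hF
    · exact Or.inl (h₁.sum_eq p q hlt hF)
    · exact Or.inr (h₂.sum_eq p q hlt hF)
  · rintro (rfl | rfl)
    exacts [h₁.isEdgePolynomial, h₂.isEdgePolynomial]

/-- For the steep sides, whose initial form is found from the shape of the support and not from the
recursion. -/
theorem hasInitialForm_of_two {u v d : ℤ} {p q : Fin 2 →₀ ℕ} (hpq : p ≠ q)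
    (h : WeightLE u v d A) (hp : u * p 0 + v * p 1 = d) (hq : u * q 0 + v * q 1 = d)
    (h2 : ∀ m ∈ A.support, u * m 0 + v * m 1 = d → m = p ∨ m = q) :
    HasInitialForm u v d A (monomial p (coeff p A) + monomial q (coeff q A)) := by
  classical
  have h3 := (HasInitialForm.monomial p (coeff p A) hp).add
    (HasInitialForm.monomial q (coeff q A) hq)
  refine ⟨h3.le, h3.ge, fun m hm => ?_⟩
  have h4 := (h.sub h3.le) m hm
  rw [mem_support_iff, coeff_sub, coeff_add, coeff_monomial, coeff_monomial] at hm
  by_contra h5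
  have h6 : u * m 0 + v * m 1 = d := by linarith
  apply hm
  by_cases hmA : m ∈ A.support
  · rcases h2 m hmA h6 with rfl | rfl
    · simp [hpq.symm]
    · simp [hpq]
  · have h7 := notMem_support_iff.1 hmA
    rw [h7]
    split_ifs with h8 h9 h9
    · rw [h8, h9, h7]; simp
    · rw [h8, h7]; simp
    · rw [h9, h7]; simp
    · simp

/-- Edges of a Newton polygon with the shape of a hexagon with three pairs of parallel sides. -/
theorem edge_of_hexagon {r c d : Fin 3 → ℤ} (h01 : r 0 < r 1) (h12 : r 1 < r 2)
    (hc : ∀ i, ∀ m ∈ A.support, c i ≤ (m 1 : ℤ) - r i * m 0)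
    (hd : ∀ i, ∀ m ∈ A.support, (m 1 : ℤ) - r i * m 0 ≤ d i)
    (h₀ : ∃ m ∈ A.support, (m 1 : ℤ) - r 2 * m 0 = d 2 ∧ (m 1 : ℤ) - r 0 * m 0 = c 0)
    (h₁ : ∃ m ∈ A.support, (m 1 : ℤ) - r 0 * m 0 = c 0 ∧ (m 1 : ℤ) - r 1 * m 0 = c 1)
    (h₂ : ∃ m ∈ A.support, (m 1 : ℤ) - r 1 * m 0 = c 1 ∧ (m 1 : ℤ) - r 2 * m 0 = c 2)
    (h₃ : ∃ m ∈ A.support, (m 1 : ℤ) - r 2 * m 0 = c 2 ∧ (m 1 : ℤ) - r 0 * m 0 = d 0)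
    (h₄ : ∃ m ∈ A.support, (m 1 : ℤ) - r 0 * m 0 = d 0 ∧ (m 1 : ℤ) - r 1 * m 0 = d 1)
    (h₅ : ∃ m ∈ A.support, (m 1 : ℤ) - r 1 * m 0 = d 1 ∧ (m 1 : ℤ) - r 2 * m 0 = d 2)
    {p q : Fin 2 →₀ ℕ} (hpq : IsNewtonEdge A p q) :
    segment ℝ (exponentPoint p) (exponentPoint q) = newtonPolygon A ∨
    ∃ i, segment ℝ (exponentPoint p) (exponentPoint q) =
        {x ∈ newtonPolygon A | lineHeight (r i) x = c i} ∨
      segment ℝ (exponentPoint p) (exponentPoint q) =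
        {x ∈ newtonPolygon A | lineHeight (r i) x = d i} := by
  have hlow : ∀ i, ∀ x ∈ newtonPolygon A, (c i : ℝ) ≤ lineHeight (r i) x := by
    intro i x hx
    have h : WeightLE (r i) (-1) (-c i) A := fun m hm => by linarith [hc i m hm]
    have := h.le_of_mem_newtonPolygon hx
    push_cast at this
    rw [lineHeight]
    linarith
  have hupp : ∀ i, ∀ x ∈ newtonPolygon A, lineHeight (r i) x ≤ d i := by
    intro i x hx
    have h : WeightLE (-r i) 1 (d i) A := fun m hm => by linarith [hd i m hm]
    have := h.le_of_mem_newtonPolygon hx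
    push_cast at this
    rw [lineHeight]
    linarith
  have hv : ∀ {i j : Fin 3} {a b : ℤ}, (∃ m ∈ A.support, (m 1 : ℤ) - r i * m 0 = a ∧
      (m 1 : ℤ) - r j * m 0 = b) → ∃ z ∈ newtonPolygon A,
      lineHeight (r i) z = a ∧ lineHeight (r j) z = b := by
    rintro i j a b ⟨m, hm, h1, h2⟩
    refine ⟨_, mem_newtonPolygon hm, ?_, ?_⟩
    · simp only [lineHeight, exponentPoint]; exact_mod_cast h1
    · simp only [lineHeight, exponentPoint]; exact_mod_cast h2
  rcases exposed_hexagon (Int.cast_lt.2 h01) (Int.cast_lt.2 h12) (hlow 0) (hlow 1) (hlow 2)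
    (hupp 0) (hupp 1) (hupp 2) (hv h₀) (hv h₁) (hv h₂) (hv h₃) (hv h₄) (hv h₅) hpq.2
    (left_mem_segment ℝ _ _) (right_mem_segment ℝ _ _) (exponentPoint_injective.ne hpq.1)
    with h | ⟨i, h⟩
  · exact Or.inl h
  · right
    refine ⟨i, ?_⟩
    fin_cases i <;> exact h

end EdgePolynomial

/-! ### Support and vertices of the A-polynomial. -/

section TwistKnotNewtonPolygon

open MvPolynomial

/-- The exponent of `L ^ a * M ^ b`. -/
noncomputable def bidegree (a b : ℕ) : Fin 2 →₀ ℕ := Finsupp.single 0 a + Finsupp.single 1 b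

@[simp] theorem bidegree_zero (a b : ℕ) : bidegree a b 0 = a := by simp [bidegree]

@[simp] theorem bidegree_one (a b : ℕ) : bidegree a b 1 = b := by simp [bidegree]

theorem eq_bidegree {m : Fin 2 →₀ ℕ} {a b : ℕ} (h₀ : m 0 = a) (h₁ : m 1 = b) :
    m = bidegree a b := by
  ext i
  fin_cases i
  · simpa using h₀
  · simpa using h₁

theorem X_pow_mul_X_pow_eq (a b : ℕ) :
    (X 0 ^ a * X 1 ^ b : MvPolynomial (Fin 2) ℤ) = monomial (bidegree a b) 1 := by
  rw [bidegree, monomial_add_single, ← C_mul_X_pow_eq_monomial, map_one, one_mul]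

theorem aeval_monomial_bidegree (a b : ℕ) (c : ℤ) :
    aeval ![Polynomial.X, 1] (monomial (bidegree a b) c) =
      (Polynomial.C c * Polynomial.X ^ a : Polynomial ℤ) := by
  rw [aeval_monomial, Finsupp.prod_fintype _ _ (by simp)]
  simp [Fin.prod_univ_two]

theorem coeff_X_sub_one_pow_self (k : ℕ) :
    ((Polynomial.X - 1 : Polynomial ℤ) ^ k).coeff k = 1 := by
  have h := (Polynomial.monic_X_sub_C (1 : ℤ)).pow k
  have h2 := h.coeff_natDegree
  rwa [(Polynomial.monic_X_sub_C (1 : ℤ)).natDegree_pow, Polynomial.natDegree_X_sub_C, mul_one,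
    map_one] at h2

theorem coeff_X_sub_one_pow_zero (k : ℕ) :
    ((Polynomial.X - 1 : Polynomial ℤ) ^ k).coeff 0 = (-1) ^ k := by
  simp [Polynomial.coeff_zero_eq_eval_zero]

theorem coeff_X_pow_mul_self (n : ℕ) (p : Polynomial ℤ) :
    (Polynomial.X ^ n * p).coeff n = p.coeff 0 := by
  simpa using Polynomial.coeff_X_pow_mul p n 0

/-- Serves to show that the polygon is not itself a segment: three suitable vertices are not
collinear. -/
theorem det_eq_zero_of_mem_segment {x y z₁ z₂ z₃ : ℝ × ℝ} (h₁ : z₁ ∈ segment ℝ x y)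
    (h₂ : z₂ ∈ segment ℝ x y) (h₃ : z₃ ∈ segment ℝ x y) :
    (z₂.1 - z₁.1) * (z₃.2 - z₁.2) = (z₃.1 - z₁.1) * (z₂.2 - z₁.2) := by
  rw [segment_eq_image'] at h₁ h₂ h₃
  obtain ⟨t₁, -, rfl⟩ := h₁
  obtain ⟨t₂, -, rfl⟩ := h₂
  obtain ⟨t₃, -, rfl⟩ := h₃
  simp only [Prod.fst_add, Prod.snd_add, Prod.smul_fst, Prod.smul_snd, Prod.fst_sub, Prod.snd_sub,
    smul_eq_mul]
  ring

theorem natAbs_natCast_add_one (j : ℕ) : ((j : ℤ) + 1).natAbs = j + 1 := by omega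

theorem natAbs_neg_natCast_add_one (j : ℕ) : (-((j : ℤ) + 1)).natAbs = j + 1 := by omega

/-- The bounds are the weights of the initial forms. The last two clauses, that the first and last
columns hold a single monomial, are what produces the steep sides. -/
theorem support_twistKnotAPolynomial_of_pos (j : ℕ) {m : Fin 2 →₀ ℕ}
    (hm : m ∈ (twistKnotAPolynomial (j + 1)).support) :
    m 1 ≤ 4 * m 0 + 4 * (j + 1) ∧ 4 * m 0 ≤ m 1 + 4 * (j + 1) ∧ m 1 ≤ 8 * (j + 1) ∧
      m 0 ≤ 2 * (j + 1) ∧ (m 0 = 0 → m 1 = 4 * (j + 1)) ∧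
      (m 0 = 2 * (j + 1) → m 1 = 4 * (j + 1)) := by
  have hn : (0 : ℤ) < j + 1 := by positivity
  have h1 := (hasInitialForm_upper_of_pos hn).weightLE m hm
  have h2 := (hasInitialForm_lower_of_pos hn).weightLE m hm
  have h3 := (hasInitialForm_top_of_pos hn).weightLE m hm
  have h4 := (hasInitialForm_right_of_pos hn).weightLE m hm
  refine ⟨by omega, by omega, by omega, by omega, fun h => ?_, fun h => ?_⟩
  · have h5 := (hasInitialForm_left_of_pos hn).mem_support_iff.2 ⟨hm, by simp [h]⟩
    rw [support_neg, support_X_pow, Finset.mem_singleton, natAbs_natCast_add_one] at h5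
    rw [h5]
    simp
  · have h5 := (hasInitialForm_right_of_pos hn).mem_support_iff.2 ⟨hm, by omega⟩
    rw [support_neg, mul_pow, ← pow_mul, ← pow_mul, X_pow_mul_X_pow_eq, natAbs_natCast_add_one] at h5
    rw [Finset.mem_singleton.1 (support_monomial_subset h5)]
    simp

theorem support_twistKnotAPolynomial_of_neg (j : ℕ) {m : Fin 2 →₀ ℕ}
    (hm : m ∈ (twistKnotAPolynomial (-(j + 1))).support) :
    m 1 ≤ 4 * m 0 + (4 * j + 2) ∧ 4 * m 0 ≤ m 1 + 4 * j ∧ m 1 ≤ 8 * j + 6 ∧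
      m 0 ≤ 2 * j + 1 ∧ (m 0 = 0 → m 1 = 0) ∧ (m 0 = 2 * j + 1 → m 1 = 8 * j + 6) := by
  have hn : (-(j + 1) : ℤ) < 0 := by omega
  have h1 := (hasInitialForm_upper_of_neg hn).weightLE m hm
  have h2 := (hasInitialForm_lower_of_neg hn).weightLE m hm
  have h3 := (hasInitialForm_top_of_neg hn).weightLE m hm
  have h4 := (hasInitialForm_right_of_neg hn).weightLE m hm
  refine ⟨by omega, by omega, by omega, by omega, fun h => ?_, fun h => ?_⟩
  · have h5 := (hasInitialForm_left_of_neg hn).mem_support_iff.2 ⟨hm, by simp [h]⟩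
    rw [support_one, Finset.mem_singleton] at h5
    rw [h5]
    simp
  · have h5 := (hasInitialForm_right_of_neg hn).mem_support_iff.2 ⟨hm, by omega⟩
    rw [mul_pow, ← pow_mul, ← pow_mul, natAbs_neg_natCast_add_one, Nat.add_sub_cancel,
      show (X 0 * X 1 ^ 6 * (X 0 ^ (2 * j) * X 1 ^ (8 * j)) : MvPolynomial (Fin 2) ℤ) =
        X 0 ^ (2 * j + 1) * X 1 ^ (8 * j + 6) by ring, X_pow_mul_X_pow_eq] at h5
    rw [Finset.mem_singleton.1 (support_monomial_subset h5)]
    simp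

section Pos

theorem aeval_upper_of_pos (j : ℕ) : aeval ![Polynomial.X, 1]
    (-(X 1 ^ 4 - X 0 * X 1 ^ 8) ^ ((j : ℤ) + 1).natAbs : MvPolynomial (Fin 2) ℤ) =
      (-(1 - Polynomial.X) ^ (j + 1) : Polynomial ℤ) := by
  simp [natAbs_natCast_add_one]

theorem aeval_lower_of_pos (j : ℕ) : aeval ![Polynomial.X, 1]
    (-(-X 0 + X 0 ^ 2 * X 1 ^ 4) ^ ((j : ℤ) + 1).natAbs : MvPolynomial (Fin 2) ℤ) =
      (Polynomial.X ^ (j + 1) * -(Polynomial.X - 1) ^ (j + 1) : Polynomial ℤ) := by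
  rw [mul_neg, ← mul_pow]
  simp only [natAbs_natCast_add_one, map_neg, map_pow, map_add, map_mul, aeval_X]
  congr 2
  simp
  ring

theorem aeval_top (j : ℕ) (b : ℕ) : aeval ![Polynomial.X, 1]
    (X 0 * X 1 ^ b * (-(X 0 * X 1 ^ 8) + X 0 ^ 2 * X 1 ^ 8) ^ j : MvPolynomial (Fin 2) ℤ) =
      (Polynomial.X ^ (j + 1) * (Polynomial.X - 1) ^ j : Polynomial ℤ) := by
  rw [pow_succ' Polynomial.X j, mul_assoc Polynomial.X, ← mul_pow]
  simp only [map_neg, map_pow, map_add, map_mul, aeval_X]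
  simp
  ring

variable (j : ℕ)

/-- Here and below, a vertex coefficient is read off as an extreme coefficient on a side through the
vertex. All turn out to be `±1`, so the vertices do occur. -/
theorem coeff_zero_of_pos :
    coeff (bidegree 0 (4 * (j + 1))) (twistKnotAPolynomial (j + 1)) = -1 := by
  rw [(hasInitialForm_upper_of_pos (by positivity)).coeff_eq_coeff_aeval one_ne_zero
    (by simp; ring), aeval_upper_of_pos, bidegree_zero, Polynomial.coeff_zero_eq_eval_zero]
  simp

theorem coeff_one_of_pos : coeff (bidegree 1 0) (twistKnotAPolynomial (j + 1)) = 1 := by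
  rw [(hasInitialForm_bottom_of_pos (by positivity)).coeff_eq_coeff_aeval (by norm_num) (by simp)]
  simp only [map_mul, map_pow, map_sub, map_one, aeval_X, Matrix.cons_val_zero, bidegree_zero]
  rw [← zero_add 1, Polynomial.coeff_X_mul, Polynomial.coeff_zero_eq_eval_zero]
  simp

theorem coeff_bottom_of_pos :
    coeff (bidegree (j + 1) 0) (twistKnotAPolynomial (j + 1)) = -(-1) ^ (j + 1) := by
  rw [(hasInitialForm_lower_of_pos (by positivity)).coeff_eq_coeff_aeval (by norm_num)
    (by simp; ring), aeval_lower_of_pos, bidegree_zero, coeff_X_pow_mul_self, Polynomial.coeff_neg, coeff_X_sub_one_pow_zero]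

theorem coeff_right_of_pos :
    coeff (bidegree (2 * (j + 1)) (4 * (j + 1))) (twistKnotAPolynomial (j + 1)) = -1 := by
  rw [(hasInitialForm_lower_of_pos (by positivity)).coeff_eq_coeff_aeval (by norm_num)
    (by simp; ring), aeval_lower_of_pos, bidegree_zero, two_mul,
    Polynomial.coeff_X_pow_mul, Polynomial.coeff_neg, coeff_X_sub_one_pow_self]

theorem coeff_top_right_of_pos :
    coeff (bidegree (2 * j + 1) (8 * (j + 1))) (twistKnotAPolynomial (j + 1)) = 1 := by
  rw [(hasInitialForm_top_of_pos (by positivity)).coeff_eq_coeff_aeval (by norm_num)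
    (by simp; ring), natAbs_natCast_add_one, Nat.add_sub_cancel, aeval_top, bidegree_zero,
    show 2 * j + 1 = j + (j + 1) by ring, Polynomial.coeff_X_pow_mul, coeff_X_sub_one_pow_self]

theorem coeff_top_of_pos :
    coeff (bidegree (j + 1) (8 * (j + 1))) (twistKnotAPolynomial (j + 1)) = (-1) ^ j := by
  rw [(hasInitialForm_top_of_pos (by positivity)).coeff_eq_coeff_aeval (by norm_num)
    (by simp; ring), natAbs_natCast_add_one, Nat.add_sub_cancel, aeval_top, bidegree_zero,
    coeff_X_pow_mul_self, coeff_X_sub_one_pow_zero]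

end Pos

section Neg

theorem aeval_upper_of_neg (j : ℕ) : aeval ![Polynomial.X, 1]
    (X 0 * X 1 ^ 6 * (X 1 ^ 4 - X 0 * X 1 ^ 8) ^ ((-((j : ℤ) + 1)).natAbs - 1) :
      MvPolynomial (Fin 2) ℤ) = (Polynomial.X ^ 1 * (1 - Polynomial.X) ^ j : Polynomial ℤ) := by
  rw [natAbs_neg_natCast_add_one]
  simp

theorem aeval_lower_of_neg (j : ℕ) : aeval ![Polynomial.X, 1]
    ((-X 0 + X 0 ^ 2 * X 1 ^ 4) ^ ((-((j : ℤ) + 1)).natAbs - 1) : MvPolynomial (Fin 2) ℤ) =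
      (Polynomial.X ^ j * (Polynomial.X - 1) ^ j : Polynomial ℤ) := by
  rw [← mul_pow]
  simp only [natAbs_neg_natCast_add_one, map_neg, map_pow, map_add, map_mul, aeval_X]
  congr 1
  simp
  ring

variable (j : ℕ)

theorem neg_natCast_add_one_lt_zero : (-((j : ℤ) + 1)) < 0 := by omega

theorem aeval_bottom_of_neg : aeval ![Polynomial.X, 1]
    ((1 - X 0) ^ ((-((j : ℤ) + 1)).natAbs - 1) : MvPolynomial (Fin 2) ℤ) =
      ((-1) ^ j * (Polynomial.X - 1) ^ j : Polynomial ℤ) := by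
  rw [← mul_pow]
  rw [natAbs_neg_natCast_add_one]
  simp

theorem coeff_zero_of_neg : coeff (bidegree 0 0) (twistKnotAPolynomial (-(j + 1))) = 1 := by
  rw [(hasInitialForm_bottom_of_neg (neg_natCast_add_one_lt_zero j)).coeff_eq_coeff_aeval
    (by norm_num) (by simp), aeval_bottom_of_neg, bidegree_zero,
    Polynomial.coeff_zero_eq_eval_zero]
  simp [← mul_pow]

theorem coeff_bottom_of_neg :
    coeff (bidegree j 0) (twistKnotAPolynomial (-(j + 1))) = (-1) ^ j := by
  rw [(hasInitialForm_bottom_of_neg (neg_natCast_add_one_lt_zero j)).coeff_eq_coeff_aeval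
    (by norm_num) (by simp), aeval_bottom_of_neg, bidegree_zero,
    show ((-1) ^ j : Polynomial ℤ) = Polynomial.C ((-1) ^ j) by simp, Polynomial.coeff_C_mul,
    coeff_X_sub_one_pow_self, mul_one]

theorem coeff_lower_of_neg :
    coeff (bidegree (2 * j) (4 * j)) (twistKnotAPolynomial (-(j + 1))) = 1 := by
  rw [(hasInitialForm_lower_of_neg (neg_natCast_add_one_lt_zero j)).coeff_eq_coeff_aeval
    (by norm_num) (by simp; ring), aeval_lower_of_neg, bidegree_zero, two_mul,
    Polynomial.coeff_X_pow_mul, coeff_X_sub_one_pow_self]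

theorem coeff_top_right_of_neg :
    coeff (bidegree (2 * j + 1) (8 * j + 6)) (twistKnotAPolynomial (-(j + 1))) = 1 := by
  rw [(hasInitialForm_top_of_neg (neg_natCast_add_one_lt_zero j)).coeff_eq_coeff_aeval
    (by norm_num) (by simp; ring), natAbs_neg_natCast_add_one, Nat.add_sub_cancel, aeval_top,
    bidegree_zero, show 2 * j + 1 = j + (j + 1) by ring, Polynomial.coeff_X_pow_mul,
    coeff_X_sub_one_pow_self]

theorem coeff_top_of_neg :
    coeff (bidegree (j + 1) (8 * j + 6)) (twistKnotAPolynomial (-(j + 1))) = (-1) ^ j := by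
  rw [(hasInitialForm_top_of_neg (neg_natCast_add_one_lt_zero j)).coeff_eq_coeff_aeval
    (by norm_num) (by simp; ring), natAbs_neg_natCast_add_one, Nat.add_sub_cancel, aeval_top,
    bidegree_zero, coeff_X_pow_mul_self, coeff_X_sub_one_pow_zero]

theorem coeff_upper_of_neg :
    coeff (bidegree 1 (4 * j + 6)) (twistKnotAPolynomial (-(j + 1))) = 1 := by
  rw [(hasInitialForm_upper_of_neg (neg_natCast_add_one_lt_zero j)).coeff_eq_coeff_aeval
    (by norm_num) (by simp; ring), aeval_upper_of_neg, bidegree_zero]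
  rw [coeff_X_pow_mul_self, Polynomial.coeff_zero_eq_eval_zero]
  simp

end Neg

end TwistKnotNewtonPolygon

/-! ### The sides of the hexagon and their polynomials. -/

section TwistKnotEdges

open MvPolynomial

theorem WeightLE.of_forall {A : MvPolynomial (Fin 2) ℤ} {u v d : ℤ}
    (h : ∀ m ∈ A.support, u * m 0 + v * m 1 ≤ d) : WeightLE u v d A := h

section Pos

variable (j : ℕ)

theorem bidegree_mem_support_of_pos :
    (bidegree 0 (4 * (j + 1)) ∈ (twistKnotAPolynomial (j + 1)).support ∧
    bidegree 1 0 ∈ (twistKnotAPolynomial (j + 1)).support ∧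
    bidegree (j + 1) 0 ∈ (twistKnotAPolynomial (j + 1)).support) ∧
    bidegree (2 * (j + 1)) (4 * (j + 1)) ∈ (twistKnotAPolynomial (j + 1)).support ∧
    bidegree (2 * j + 1) (8 * (j + 1)) ∈ (twistKnotAPolynomial (j + 1)).support ∧
    bidegree (j + 1) (8 * (j + 1)) ∈ (twistKnotAPolynomial (j + 1)).support := by
  simp only [mem_support_iff, coeff_zero_of_pos, coeff_one_of_pos, coeff_bottom_of_pos,
    coeff_right_of_pos, coeff_top_right_of_pos, coeff_top_of_pos]
  simp

/-- The inequalities that cut out the Newton polygon. -/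
theorem newtonPolygon_bounds_of_pos {x : ℝ × ℝ}
    (hx : x ∈ newtonPolygon (twistKnotAPolynomial (j + 1))) :
    0 ≤ x.1 ∧ x.1 ≤ 2 * (j + 1) ∧ 0 ≤ x.2 ∧ x.2 ≤ 8 * (j + 1) := by
  have h1 := (WeightLE.of_forall (u := -1) (v := 0) (d := 0) (A := twistKnotAPolynomial (j + 1))
    fun m hm => by omega).le_of_mem_newtonPolygon hx
  have h2 := (WeightLE.of_forall (u := 1) (v := 0) (d := 2 * (j + 1))
    (A := twistKnotAPolynomial (j + 1)) fun m hm => by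
      have := support_twistKnotAPolynomial_of_pos j hm; omega).le_of_mem_newtonPolygon hx
  have h3 := (WeightLE.of_forall (u := 0) (v := -1) (d := 0) (A := twistKnotAPolynomial (j + 1))
    fun m hm => by omega).le_of_mem_newtonPolygon hx
  have h4 := (WeightLE.of_forall (u := 0) (v := 1) (d := 8 * (j + 1))
    (A := twistKnotAPolynomial (j + 1)) fun m hm => by
      have := support_twistKnotAPolynomial_of_pos j hm; omega).le_of_mem_newtonPolygon hx
  push_cast at h1 h2 h3 h4
  exact ⟨by linarith, by linarith, by linarith, by linarith⟩

/-- In the column `L^0` the only monomial gives equality, and from `L^1` on the `M`-exponent is not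
even needed. The other steep bounds also treat the extreme column separately. -/
theorem lower_bound_of_pos {m : Fin 2 →₀ ℕ} (hm : m ∈ (twistKnotAPolynomial (j + 1)).support) :
    4 * ((j : ℤ) + 1) ≤ m 1 + 4 * (j + 1) * m 0 := by
  obtain ⟨-, -, -, -, h, -⟩ := support_twistKnotAPolynomial_of_pos j hm
  rcases Nat.eq_zero_or_pos (m 0) with h0 | h0
  · have := h h0
    rw [h0, this]
    push_cast
    linarith
  · have : (1 : ℤ) ≤ m 0 := by exact_mod_cast h0
    nlinarith

theorem upper_bound_of_pos {m : Fin 2 →₀ ℕ} (hm : m ∈ (twistKnotAPolynomial (j + 1)).support) :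
    (m 1 : ℤ) + 4 * (j + 1) * m 0 ≤ 8 * (j + 1) ^ 2 + 4 * (j + 1) := by
  obtain ⟨-, -, h1, h2, -, h⟩ := support_twistKnotAPolynomial_of_pos j hm
  rcases h2.eq_or_lt with h0 | h0
  · have := h h0
    rw [h0, this]
    push_cast
    linarith
  · have h3 : (m 0 : ℤ) ≤ 2 * j + 1 := by omega
    have h4 : (m 1 : ℤ) ≤ 8 * (j + 1) := by omega
    nlinarith

theorem edge_of_pos {p q : Fin 2 →₀ ℕ} (h : IsNewtonEdge (twistKnotAPolynomial (j + 1)) p q) :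
    ∃ i : Fin 3, segment ℝ (exponentPoint p) (exponentPoint q) =
        {x ∈ newtonPolygon (twistKnotAPolynomial (j + 1)) |
          lineHeight ((![-4 * ((j : ℤ) + 1), 0, 4] : Fin 3 → ℤ) i) x =
            ((![4 * ((j : ℤ) + 1), 0, -4 * (j + 1)] : Fin 3 → ℤ) i)} ∨
      segment ℝ (exponentPoint p) (exponentPoint q) =
        {x ∈ newtonPolygon (twistKnotAPolynomial (j + 1)) |
          lineHeight ((![-4 * ((j : ℤ) + 1), 0, 4] : Fin 3 → ℤ) i) x =
            ((![8 * ((j : ℤ) + 1) ^ 2 + 4 * (j + 1), 8 * (j + 1), 4 * (j + 1)] : Fin 3 → ℤ) i)} := by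
  obtain ⟨⟨v0, v1, v2⟩, v3, v4, v5⟩ := bidegree_mem_support_of_pos j
  refine (edge_of_hexagon ?_ ?_ ?_ ?_ ?_ ?_ ?_ ?_ ?_ ?_ h).resolve_left ?_
  · simp
  · simp
  · intro i m hm
    have h1 := support_twistKnotAPolynomial_of_pos j hm
    have h2 := lower_bound_of_pos j hm
    fin_cases i <;> simp <;> linarith
  · intro i m hm
    have h1 := support_twistKnotAPolynomial_of_pos j hm
    have h2 := upper_bound_of_pos j hm
    fin_cases i <;> simp <;> linarith
  · exact ⟨_, v0, by simp, by simp⟩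
  · exact ⟨_, v1, by simp, by simp⟩
  · exact ⟨_, v2, by simp, by simp⟩
  · exact ⟨_, v3, by simp; ring, by simp; ring⟩
  · exact ⟨_, v4, by simp; ring, by simp⟩
  · exact ⟨_, v5, by simp, by simp; ring⟩
  · intro hS
    -- The vertices `(0, 4n)`, `(1, 0)` and `(2n, 4n)` are not collinear.
    have := det_eq_zero_of_mem_segment (hS ▸ mem_newtonPolygon v0) (hS ▸ mem_newtonPolygon v1)
      (hS ▸ mem_newtonPolygon v3)
    simp [exponentPoint] at this
    nlinarith [Nat.cast_nonneg (α := ℝ) j]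

theorem isEdgeFace_left_of_pos : IsEdgeFace (twistKnotAPolynomial (j + 1)) (-4 * ((j : ℤ) + 1))
    {x ∈ newtonPolygon (twistKnotAPolynomial (j + 1)) |
      lineHeight ((-4 * ((j : ℤ) + 1) : ℤ)) x = (4 * ((j : ℤ) + 1) : ℤ)} (Polynomial.X - 1) := by
  obtain ⟨⟨v0, v1, -⟩, -⟩ := bidegree_mem_support_of_pos j
  have hne : bidegree 0 (4 * (j + 1)) ≠ bidegree 1 0 := by
    intro h; simpa using congrArg (fun m : Fin 2 →₀ ℕ => m 0) h
  have hI := hasInitialForm_of_two (u := -4 * ((j : ℤ) + 1)) (v := -1) (d := -(4 * (j + 1)))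
    (A := twistKnotAPolynomial (j + 1)) hne
    (fun m hm => by linarith [lower_bound_of_pos j hm]) (by simp) (by simp)
    (fun m hm h => by
      obtain ⟨-, -, -, -, h0, -⟩ := support_twistKnotAPolynomial_of_pos j hm
      rcases Nat.eq_zero_or_pos (m 0) with h1 | h1
      · exact Or.inl (eq_bidegree h1 (h0 h1))
      · right
        have h2 : (1 : ℤ) ≤ m 0 := by exact_mod_cast h1
        have h3 : (m 0 : ℤ) ≤ 1 := by nlinarith
        have h4 : (m 0 : ℤ) = 1 := le_antisymm h3 h2
        rw [h4] at h
        exact eq_bidegree (by exact_mod_cast h4) (by linarith))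
  refine hI.isEdgeFace (by norm_num) (by ring) (by ring) rfl v0 v1 (by simp) (by simp)
    (by simp) ?_ ?_
  · rintro x ⟨hx, hl⟩
    obtain ⟨h1, h2, h3, h4⟩ := newtonPolygon_bounds_of_pos j hx
    rw [lineHeight] at hl
    push_cast at hl
    have hj : (0 : ℝ) < j + 1 := by positivity
    simp only [bidegree_zero, Nat.cast_zero, Nat.cast_one]
    exact ⟨h1, le_of_mul_le_mul_left (by linarith) hj⟩
  · rw [coeff_zero_of_pos, coeff_one_of_pos, map_add, aeval_monomial_bidegree,
      aeval_monomial_bidegree]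
    simp
    ring

theorem isEdgeFace_right_of_pos : IsEdgeFace (twistKnotAPolynomial (j + 1)) (-4 * ((j : ℤ) + 1))
    {x ∈ newtonPolygon (twistKnotAPolynomial (j + 1)) |
      lineHeight ((-4 * ((j : ℤ) + 1) : ℤ)) x = (8 * ((j : ℤ) + 1) ^ 2 + 4 * (j + 1) : ℤ)}
    (-(Polynomial.X - 1)) := by
  obtain ⟨-, v3, v4, -⟩ := bidegree_mem_support_of_pos j
  have hne : bidegree (2 * j + 1) (8 * (j + 1)) ≠ bidegree (2 * (j + 1)) (4 * (j + 1)) := by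
    intro h
    have := congrArg (fun m : Fin 2 →₀ ℕ => m 0) h
    simp at this
    omega
  have hI := hasInitialForm_of_two (u := 4 * ((j : ℤ) + 1)) (v := 1)
    (d := 8 * (j + 1) ^ 2 + 4 * (j + 1)) (A := twistKnotAPolynomial (j + 1)) hne
    (fun m hm => by linarith [upper_bound_of_pos j hm]) (by simp; ring) (by simp; ring)
    (fun m hm h => by
      obtain ⟨-, -, h0, h5, -, h6⟩ := support_twistKnotAPolynomial_of_pos j hm
      rcases h5.eq_or_lt with h1 | h1
      · exact Or.inr (eq_bidegree h1 (h6 h1))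
      · left
        have h2 : (m 0 : ℤ) ≤ 2 * j + 1 := by omega
        have h0' : (m 1 : ℤ) ≤ 8 * (j + 1) := by omega
        have h3 : 2 * (j : ℤ) + 1 ≤ m 0 := by nlinarith
        have h4 : (m 0 : ℤ) = 2 * j + 1 := le_antisymm h2 h3
        rw [h4] at h
        exact eq_bidegree (by exact_mod_cast h4) (by zify; linarith))
  refine hI.isEdgeFace (by norm_num) (by ring) (by ring) rfl v4 v3 (by simp; ring) (by simp; ring)
    (by simp; omega) ?_ ?_
  · rintro x ⟨hx, hl⟩
    obtain ⟨h1, h2, h3, h4⟩ := newtonPolygon_bounds_of_pos j hx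
    rw [lineHeight] at hl
    push_cast at hl
    have hj : (0 : ℝ) < j + 1 := by positivity
    simp only [bidegree_zero]
    push_cast
    exact ⟨le_of_mul_le_mul_left (by linarith) hj, h2⟩
  · rw [coeff_top_right_of_pos, coeff_right_of_pos, map_add, aeval_monomial_bidegree,
      aeval_monomial_bidegree, bidegree_zero]
    simp
    ring

theorem isEdgeFace_lower_of_pos : IsEdgeFace (twistKnotAPolynomial (j + 1)) 4
    {x ∈ newtonPolygon (twistKnotAPolynomial (j + 1)) |
      lineHeight ((4 : ℤ)) x = (-4 * ((j : ℤ) + 1) : ℤ)} (-(Polynomial.X - 1) ^ (j + 1)) := by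
  obtain ⟨⟨-, -, v2⟩, v3, -⟩ := bidegree_mem_support_of_pos j
  refine (hasInitialForm_lower_of_pos (n := j + 1) (by positivity)).isEdgeFace (by norm_num)
    (by ring) (by ring) rfl v2 v3 (by simp; ring) (by simp; ring) (by simp) ?_ ?_
  · rintro x ⟨hx, hl⟩
    obtain ⟨h1, h2, h3, h4⟩ := newtonPolygon_bounds_of_pos j hx
    rw [lineHeight] at hl
    push_cast at hl
    simp only [bidegree_zero]
    push_cast
    exact ⟨by linarith, h2⟩
  · rw [aeval_lower_of_pos, bidegree_zero]

theorem isEdgeFace_upper_of_pos : IsEdgeFace (twistKnotAPolynomial (j + 1)) 4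
    {x ∈ newtonPolygon (twistKnotAPolynomial (j + 1)) |
      lineHeight ((4 : ℤ)) x = (4 * ((j : ℤ) + 1) : ℤ)} (-(1 - Polynomial.X) ^ (j + 1)) := by
  obtain ⟨⟨v0, -⟩, -, -, v5⟩ := bidegree_mem_support_of_pos j
  refine (hasInitialForm_upper_of_pos (n := j + 1) (by positivity)).isEdgeFace (by norm_num)
    (by ring) (by ring) rfl v0 v5 (by simp; ring) (by simp; ring) (by simp) ?_ ?_
  · rintro x ⟨hx, hl⟩
    obtain ⟨h1, h2, h3, h4⟩ := newtonPolygon_bounds_of_pos j hx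
    rw [lineHeight] at hl
    push_cast at hl
    simp only [bidegree_zero]
    push_cast
    exact ⟨h1, by linarith⟩
  · rw [aeval_upper_of_pos, bidegree_zero, pow_zero, one_mul]

end Pos

section Neg

variable (j : ℕ)

theorem bidegree_mem_support_of_neg :
    (bidegree 0 0 ∈ (twistKnotAPolynomial (-(j + 1))).support ∧
    bidegree j 0 ∈ (twistKnotAPolynomial (-(j + 1))).support ∧
    bidegree (2 * j) (4 * j) ∈ (twistKnotAPolynomial (-(j + 1))).support) ∧
    bidegree (2 * j + 1) (8 * j + 6) ∈ (twistKnotAPolynomial (-(j + 1))).support ∧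
    bidegree (j + 1) (8 * j + 6) ∈ (twistKnotAPolynomial (-(j + 1))).support ∧
    bidegree 1 (4 * j + 6) ∈ (twistKnotAPolynomial (-(j + 1))).support := by
  simp only [mem_support_iff, coeff_zero_of_neg, coeff_bottom_of_neg, coeff_lower_of_neg,
    coeff_top_right_of_neg, coeff_top_of_neg, coeff_upper_of_neg]
  simp

theorem lower_bound_of_neg {m : Fin 2 →₀ ℕ} (hm : m ∈ (twistKnotAPolynomial (-(j + 1))).support) :
    (4 * (j : ℤ) + 6) * m 0 - 8 * j * (j + 1) ≤ m 1 := by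
  obtain ⟨-, h1, -, h2, -, h⟩ := support_twistKnotAPolynomial_of_neg j hm
  rcases h2.eq_or_lt with h0 | h0
  · have := h h0
    rw [h0, this]
    push_cast
    linarith
  · have h3 : (m 0 : ℤ) ≤ 2 * j := by omega
    have h4 : (4 * m 0 : ℤ) ≤ m 1 + 4 * j := by omega
    nlinarith

theorem upper_bound_of_neg {m : Fin 2 →₀ ℕ} (hm : m ∈ (twistKnotAPolynomial (-(j + 1))).support) :
    (m 1 : ℤ) ≤ (4 * j + 6) * m 0 := by
  obtain ⟨h1, -, -, -, h, -⟩ := support_twistKnotAPolynomial_of_neg j hm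
  rcases Nat.eq_zero_or_pos (m 0) with h0 | h0
  · have := h h0
    rw [h0, this]
    simp
  · have h2 : (1 : ℤ) ≤ m 0 := by exact_mod_cast h0
    have h4 : (m 1 : ℤ) ≤ 4 * m 0 + (4 * j + 2) := by omega
    nlinarith

/-- The inequalities that cut out the Newton polygon. -/
theorem newtonPolygon_bounds_of_neg {x : ℝ × ℝ}
    (hx : x ∈ newtonPolygon (twistKnotAPolynomial (-(j + 1)))) :
    (0 ≤ x.2 ∧ x.2 ≤ 8 * j + 6) ∧ (4 * (j : ℝ) + 6) * x.1 - 8 * j * (j + 1) ≤ x.2 ∧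
      x.2 ≤ (4 * j + 6) * x.1 ∧ x.2 ≤ 4 * x.1 + (4 * j + 2) ∧ 4 * x.1 ≤ x.2 + 4 * j := by
  have h1 := (WeightLE.of_forall (u := -4) (v := 1) (d := 4 * j + 2)
    (A := twistKnotAPolynomial (-(j + 1))) fun m hm => by
      have := support_twistKnotAPolynomial_of_neg j hm; omega).le_of_mem_newtonPolygon hx
  have h2 := (WeightLE.of_forall (u := 4) (v := -1) (d := 4 * j)
    (A := twistKnotAPolynomial (-(j + 1))) fun m hm => by
      have := support_twistKnotAPolynomial_of_neg j hm; omega).le_of_mem_newtonPolygon hx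
  have h3 := (WeightLE.of_forall (u := 0) (v := -1) (d := 0) (A := twistKnotAPolynomial (-(j + 1)))
    fun m hm => by omega).le_of_mem_newtonPolygon hx
  have h4 := (WeightLE.of_forall (u := 0) (v := 1) (d := 8 * j + 6)
    (A := twistKnotAPolynomial (-(j + 1))) fun m hm => by
      have := support_twistKnotAPolynomial_of_neg j hm; omega).le_of_mem_newtonPolygon hx
  have h5 := (WeightLE.of_forall (u := 4 * (j : ℤ) + 6) (v := -1) (d := 8 * j * (j + 1))
    (A := twistKnotAPolynomial (-(j + 1))) fun m hm => by
      linarith [lower_bound_of_neg j hm]).le_of_mem_newtonPolygon hx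
  have h6 := (WeightLE.of_forall (u := -(4 * (j : ℤ) + 6)) (v := 1) (d := 0)
    (A := twistKnotAPolynomial (-(j + 1))) fun m hm => by
      linarith [upper_bound_of_neg j hm]).le_of_mem_newtonPolygon hx
  push_cast at h1 h2 h3 h4 h5 h6
  exact ⟨⟨by linarith, by linarith⟩, by linarith, by linarith, by linarith, by linarith⟩

theorem edge_of_neg {p q : Fin 2 →₀ ℕ} (h : IsNewtonEdge (twistKnotAPolynomial (-(j + 1))) p q) :
    ∃ i : Fin 3, segment ℝ (exponentPoint p) (exponentPoint q) =
        {x ∈ newtonPolygon (twistKnotAPolynomial (-(j + 1))) |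
          lineHeight ((![0, 4, 4 * (j : ℤ) + 6] : Fin 3 → ℤ) i) x =
            ((![0, -4 * (j : ℤ), -8 * j * (j + 1)] : Fin 3 → ℤ) i)} ∨
      segment ℝ (exponentPoint p) (exponentPoint q) =
        {x ∈ newtonPolygon (twistKnotAPolynomial (-(j + 1))) |
          lineHeight ((![0, 4, 4 * (j : ℤ) + 6] : Fin 3 → ℤ) i) x =
            ((![8 * (j : ℤ) + 6, 4 * j + 2, 0] : Fin 3 → ℤ) i)} := by
  obtain ⟨⟨v0, v1, v2⟩, v3, v4, v5⟩ := bidegree_mem_support_of_neg j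
  have key := edge_of_hexagon (A := twistKnotAPolynomial (-(j + 1)))
    (r := ![0, 4, 4 * (j : ℤ) + 6]) (c := ![0, -4 * (j : ℤ), -8 * j * (j + 1)])
    (d := ![8 * (j : ℤ) + 6, 4 * j + 2, 0]) (by simp) (by simp; omega)
    (by
      intro i m hm
      have h1 := support_twistKnotAPolynomial_of_neg j hm
      have h2 := lower_bound_of_neg j hm
      fin_cases i <;> simp <;> linarith)
    (by
      intro i m hm
      have h1 := support_twistKnotAPolynomial_of_neg j hm
      have h2 := upper_bound_of_neg j hm
      fin_cases i <;> simp <;> linarith)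
    ⟨_, v0, by simp, by simp⟩ ⟨_, v1, by simp, by simp⟩ ⟨_, v2, by simp; ring, by simp; ring⟩
    ⟨_, v3, by simp; ring, by simp⟩ ⟨_, v4, by simp, by simp; ring⟩
    ⟨_, v5, by simp; ring, by simp⟩ h
  rcases key with hS | key
  · rcases Nat.eq_zero_or_pos j with rfl | hj
    -- For `n = -1` the polygon is a segment and coincides with its own steep face, since both steep
    -- bounds are `0`.
    · refine ⟨2, Or.inr ?_⟩
      rw [hS]
      ext x
      refine ⟨fun hx => ⟨hx, ?_⟩, fun hx => hx.1⟩
      obtain ⟨-, h5, h6, -⟩ := newtonPolygon_bounds_of_neg 0 hx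
      simp [lineHeight] at h5 h6 ⊢
      linarith
    · exfalso
      have := det_eq_zero_of_mem_segment (hS ▸ mem_newtonPolygon v0) (hS ▸ mem_newtonPolygon v1)
        (hS ▸ mem_newtonPolygon v3)
      simp [exponentPoint] at this
      rcases this with h0 | h0
      · exact hj.ne' h0
      · linarith [Nat.cast_nonneg (α := ℝ) j]
  · exact key

theorem isEdgeFace_left_of_neg : IsEdgeFace (twistKnotAPolynomial (-(j + 1))) (4 * (j : ℤ) + 6)
    {x ∈ newtonPolygon (twistKnotAPolynomial (-(j + 1))) |
      lineHeight ((4 * (j : ℤ) + 6 : ℤ)) x = (0 : ℤ)} (Polynomial.X + 1) := by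
  obtain ⟨⟨v0, -⟩, -, -, v5⟩ := bidegree_mem_support_of_neg j
  have hne : bidegree 0 0 ≠ bidegree 1 (4 * j + 6) := by
    intro h; simpa using congrArg (fun m : Fin 2 →₀ ℕ => m 0) h
  have hI := hasInitialForm_of_two (u := -(4 * (j : ℤ) + 6)) (v := 1) (d := 0)
    (A := twistKnotAPolynomial (-(j + 1))) hne
    (fun m hm => by linarith [upper_bound_of_neg j hm]) (by simp) (by simp)
    (fun m hm h => by
      obtain ⟨h5, -, -, -, h0, -⟩ := support_twistKnotAPolynomial_of_neg j hm
      rcases Nat.eq_zero_or_pos (m 0) with h1 | h1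
      · exact Or.inl (eq_bidegree h1 (h0 h1))
      · right
        have h2 : (1 : ℤ) ≤ m 0 := by exact_mod_cast h1
        have h5' : (m 1 : ℤ) ≤ 4 * m 0 + (4 * j + 2) := by omega
        have h3 : (m 0 : ℤ) ≤ 1 := by nlinarith
        have h4 : (m 0 : ℤ) = 1 := le_antisymm h3 h2
        rw [h4] at h
        exact eq_bidegree (by exact_mod_cast h4) (by zify; linarith))
  refine hI.isEdgeFace (by norm_num) (by ring) (by ring) rfl v0 v5 (by simp) (by simp)
    (by simp) ?_ ?_
  · rintro x ⟨hx, hl⟩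
    obtain ⟨⟨h1, h2⟩, h3, h4, h5, h6⟩ := newtonPolygon_bounds_of_neg j hx
    rw [lineHeight] at hl
    push_cast at hl
    have hj : (0 : ℝ) < 4 * j + 6 := by positivity
    have hj' : (0 : ℝ) < 4 * j + 2 := by positivity
    simp only [bidegree_zero, Nat.cast_zero, Nat.cast_one]
    exact ⟨le_of_mul_le_mul_left (by linarith) hj, le_of_mul_le_mul_left (by linarith) hj'⟩
  · rw [coeff_zero_of_neg, coeff_upper_of_neg, map_add, aeval_monomial_bidegree,
      aeval_monomial_bidegree]
    simp
    ring

theorem isEdgeFace_right_of_neg : IsEdgeFace (twistKnotAPolynomial (-(j + 1))) (4 * (j : ℤ) + 6)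
    {x ∈ newtonPolygon (twistKnotAPolynomial (-(j + 1))) |
      lineHeight ((4 * (j : ℤ) + 6 : ℤ)) x = (-8 * (j : ℤ) * (j + 1) : ℤ)}
    (Polynomial.X + 1) := by
  obtain ⟨⟨-, -, v2⟩, v3, -⟩ := bidegree_mem_support_of_neg j
  have hne : bidegree (2 * j) (4 * j) ≠ bidegree (2 * j + 1) (8 * j + 6) := by
    intro h
    simpa using congrArg (fun m : Fin 2 →₀ ℕ => m 0) h
  have hI := hasInitialForm_of_two (u := 4 * (j : ℤ) + 6) (v := -1)
    (d := 8 * j * (j + 1)) (A := twistKnotAPolynomial (-(j + 1))) hne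
    (fun m hm => by linarith [lower_bound_of_neg j hm]) (by simp; ring) (by simp; ring)
    (fun m hm h => by
      obtain ⟨-, h0, -, h5, -, h6⟩ := support_twistKnotAPolynomial_of_neg j hm
      rcases h5.eq_or_lt with h1 | h1
      · exact Or.inr (eq_bidegree h1 (h6 h1))
      · left
        have h2 : (m 0 : ℤ) ≤ 2 * j := by omega
        have h0' : (4 * m 0 : ℤ) ≤ m 1 + 4 * j := by omega
        have h3 : 2 * (j : ℤ) ≤ m 0 := by nlinarith
        have h4 : (m 0 : ℤ) = 2 * j := le_antisymm h2 h3
        rw [h4] at h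
        exact eq_bidegree (by exact_mod_cast h4) (by zify; linarith))
  refine hI.isEdgeFace (by norm_num) (by ring) (by ring) rfl v2 v3 (by simp; ring) (by simp; ring)
    (by simp) ?_ ?_
  · rintro x ⟨hx, hl⟩
    obtain ⟨⟨h1, h2⟩, h3, h4, h5, h6⟩ := newtonPolygon_bounds_of_neg j hx
    rw [lineHeight] at hl
    push_cast at hl
    have hj : (0 : ℝ) < 4 * j + 6 := by positivity
    have hj' : (0 : ℝ) < 4 * j + 2 := by positivity
    simp only [bidegree_zero]
    push_cast
    exact ⟨le_of_mul_le_mul_left (by linarith) hj', le_of_mul_le_mul_left (by linarith) hj⟩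
  · rw [coeff_top_right_of_neg, coeff_lower_of_neg, map_add, aeval_monomial_bidegree,
      aeval_monomial_bidegree, bidegree_zero]
    simp
    ring

/-- For `j = 0` the sides of slope 4 shrink to points, hence the hypothesis. -/
theorem isEdgeFace_lower_of_neg (hj : 0 < j) : IsEdgeFace (twistKnotAPolynomial (-(j + 1))) 4
    {x ∈ newtonPolygon (twistKnotAPolynomial (-(j + 1))) |
      lineHeight ((4 : ℤ)) x = (-4 * (j : ℤ) : ℤ)} ((Polynomial.X - 1) ^ j) := by
  obtain ⟨⟨-, v1, v2⟩, -⟩ := bidegree_mem_support_of_neg j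
  refine (hasInitialForm_lower_of_neg (neg_natCast_add_one_lt_zero j)).isEdgeFace (by norm_num)
    (by ring) (by ring) rfl v1 v2 (by simp; ring) (by simp; ring) (by simp; omega) ?_ ?_
  · rintro x ⟨hx, hl⟩
    obtain ⟨⟨h1, h2⟩, h3, h4, h5, h6⟩ := newtonPolygon_bounds_of_neg j hx
    rw [lineHeight] at hl
    push_cast at hl
    have hj' : (0 : ℝ) < 4 * j + 2 := by positivity
    simp only [bidegree_zero]
    push_cast
    exact ⟨by linarith, le_of_mul_le_mul_left (by linarith) hj'⟩
  · rw [aeval_lower_of_neg, bidegree_zero]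

theorem isEdgeFace_upper_of_neg (hj : 0 < j) : IsEdgeFace (twistKnotAPolynomial (-(j + 1))) 4
    {x ∈ newtonPolygon (twistKnotAPolynomial (-(j + 1))) |
      lineHeight ((4 : ℤ)) x = (4 * (j : ℤ) + 2 : ℤ)} ((1 - Polynomial.X) ^ j) := by
  obtain ⟨-, -, v4, v5⟩ := bidegree_mem_support_of_neg j
  refine (hasInitialForm_upper_of_neg (neg_natCast_add_one_lt_zero j)).isEdgeFace (by norm_num)
    (by ring) (by ring) rfl v5 v4 (by simp; ring) (by simp; ring) (by simp; omega) ?_ ?_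
  · rintro x ⟨hx, hl⟩
    obtain ⟨⟨h1, h2⟩, h3, h4, h5, h6⟩ := newtonPolygon_bounds_of_neg j hx
    rw [lineHeight] at hl
    push_cast at hl
    have hj' : (0 : ℝ) < 4 * j + 2 := by positivity
    simp only [bidegree_zero]
    push_cast
    exact ⟨le_of_mul_le_mul_left (by linarith) hj', by linarith⟩
  · rw [aeval_upper_of_neg, bidegree_zero]

end Neg

end TwistKnotEdges

/-! ### Sorting edges by slope. -/

section TwistKnotEdgePolynomials

theorem HasSlope.unique {p q : Fin 2 →₀ ℕ} {r s : ℚ} (hr : HasSlope p q r) (hs : HasSlope p q s) :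
    r = s := by
  have h : ((q 0 : ℚ) - p 0) ≠ 0 := sub_ne_zero.2 (by exact_mod_cast hr.1.symm)
  exact mul_right_cancel₀ h (hr.2.symm.trans hs.2)

theorem IsNewtonEdge.hasSlope {A : MvPolynomial (Fin 2) ℤ} {p q : Fin 2 →₀ ℕ} {r c : ℤ}
    (h : IsNewtonEdge A p q) (hF : segment ℝ (exponentPoint p) (exponentPoint q) =
      {x ∈ newtonPolygon A | lineHeight r x = c}) : HasSlope p q r := by
  have hp := left_mem_segment ℝ (exponentPoint p) (exponentPoint q)
  have hq := right_mem_segment ℝ (exponentPoint p) (exponentPoint q)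
  rw [hF] at hp hq
  refine hasSlope_of_lineHeight_eq h.1 ?_
  rw [Rat.cast_intCast, hp.2, hq.2]

section Pos

variable (j : ℕ)

theorem exists_hasSlope_of_pos {p q : Fin 2 →₀ ℕ}
    (h : IsNewtonEdge (twistKnotAPolynomial (j + 1)) p q) :
    ∃ i : Fin 3, HasSlope p q ((![-4 * ((j : ℤ) + 1), 0, 4] : Fin 3 → ℤ) i) := by
  obtain ⟨i, hi | hi⟩ := edge_of_pos j h
  exacts [⟨i, h.hasSlope hi⟩, ⟨i, h.hasSlope hi⟩]

theorem edgePolynomials_steep_of_pos :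
    {f | IsEdgePolynomial (twistKnotAPolynomial (j + 1)) ((-4 * ((j : ℤ) + 1) : ℤ)) f} =
      {Polynomial.X - 1, -(Polynomial.X - 1)} := by
  refine setOf_isEdgePolynomial (isEdgeFace_left_of_pos j) (isEdgeFace_right_of_pos j)
    fun p q h hr => ?_
  obtain ⟨i, hi⟩ := edge_of_pos j h
  have hs := hr.unique (hi.elim (h.hasSlope ·) (h.hasSlope ·))
  rw [Int.cast_inj] at hs
  fin_cases i
  · exact hi
  · simp at hs; omega
  · simp at hs; omega

theorem edgePolynomials_four_of_pos :
    {f | IsEdgePolynomial (twistKnotAPolynomial (j + 1)) ((4 : ℤ)) f} =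
      {-(Polynomial.X - 1) ^ (j + 1), -(1 - Polynomial.X) ^ (j + 1)} := by
  refine setOf_isEdgePolynomial (isEdgeFace_lower_of_pos j) (isEdgeFace_upper_of_pos j)
    fun p q h hr => ?_
  obtain ⟨i, hi⟩ := edge_of_pos j h
  have hs := hr.unique (hi.elim (h.hasSlope ·) (h.hasSlope ·))
  rw [Int.cast_inj] at hs
  fin_cases i
  · simp at hs; omega
  · simp at hs
  · exact hi

end Pos

section Neg

variable (j : ℕ)

theorem exists_hasSlope_of_neg {p q : Fin 2 →₀ ℕ}
    (h : IsNewtonEdge (twistKnotAPolynomial (-(j + 1))) p q) :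
    ∃ i : Fin 3, HasSlope p q ((![0, 4, 4 * (j : ℤ) + 6] : Fin 3 → ℤ) i) := by
  obtain ⟨i, hi | hi⟩ := edge_of_neg j h
  exacts [⟨i, h.hasSlope hi⟩, ⟨i, h.hasSlope hi⟩]

theorem hasSlope_six_of_trefoil {p q : Fin 2 →₀ ℕ}
    (h : IsNewtonEdge (twistKnotAPolynomial (-1)) p q) : HasSlope p q 6 := by
  have hH : ∀ x ∈ newtonPolygon (twistKnotAPolynomial (-1)), lineHeight 6 x = 0 := by
    intro x hx
    obtain ⟨-, h5, h6, -⟩ := newtonPolygon_bounds_of_neg 0 (x := x) (by simpa using hx)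
    simp [lineHeight] at h5 h6 ⊢
    linarith
  have hsub := h.2.subset
  refine hasSlope_of_lineHeight_eq h.1 ?_
  rw [Rat.cast_ofNat, hH _ (hsub (left_mem_segment ℝ _ _)), hH _ (hsub (right_mem_segment ℝ _ _))]

theorem edgePolynomials_steep_of_neg :
    {f | IsEdgePolynomial (twistKnotAPolynomial (-(j + 1))) ((4 * (j : ℤ) + 6 : ℤ)) f} =
      {Polynomial.X + 1} := by
  have key := setOf_isEdgePolynomial (isEdgeFace_left_of_neg j) (isEdgeFace_right_of_neg j)
    fun p q h hr => by
      obtain ⟨i, hi⟩ := edge_of_neg j h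
      have hs := hr.unique (hi.elim (h.hasSlope ·) (h.hasSlope ·))
      rw [Int.cast_inj] at hs
      fin_cases i
      · simp at hs; omega
      · simp at hs; omega
      -- The smaller height belongs to the right side here, so the two alternatives come in the
      -- opposite order.
      · exact hi.symm
  rw [key, Set.pair_eq_singleton]

theorem edgePolynomials_four_of_neg (hj : 0 < j) :
    {f | IsEdgePolynomial (twistKnotAPolynomial (-(j + 1))) ((4 : ℤ)) f} =
      {(Polynomial.X - 1) ^ j, (1 - Polynomial.X) ^ j} := by
  refine setOf_isEdgePolynomial (isEdgeFace_lower_of_neg j hj) (isEdgeFace_upper_of_neg j hj)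
    fun p q h hr => ?_
  obtain ⟨i, hi⟩ := edge_of_neg j h
  have hs := hr.unique (hi.elim (h.hasSlope ·) (h.hasSlope ·))
  rw [Int.cast_inj] at hs
  fin_cases i
  · simp at hs
  · exact hi
  · simp at hs; omega

end Neg

end TwistKnotEdgePolynomials

theorem theorem1p4 (n : ℤ) (hn : n ≠ 0) :
    ∃ A : MvPolynomial (Fin 2) ℤ,
      (twistKnot n).IsAPolynomial A ∧
      (∀ B, (twistKnot n).IsAPolynomial B → B = A ∨ B = -A) ∧
      (0 < n →
        MvPolynomial.coeff (Finsupp.single 1 (4 * n.toNat)) A = -1 ∧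
        (∀ p q, IsNewtonEdge A p q →
          HasSlope p q 0 ∨ HasSlope p q (-4 * n) ∨ HasSlope p q 4) ∧
        {f | IsEdgePolynomial A (-4 * n) f} = {Polynomial.X - 1, -(Polynomial.X - 1)} ∧
        (Even n → {f | IsEdgePolynomial A 4 f} = {-(Polynomial.X - 1) ^ n.toNat}) ∧
        (Odd n → {f | IsEdgePolynomial A 4 f} = {(Polynomial.X - 1) ^ n.toNat, -(Polynomial.X - 1) ^ n.toNat})) ∧
      (n < 0 →
        MvPolynomial.coeff 0 A = 1 ∧
        (∀ p q, IsNewtonEdge A p q →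
          HasSlope p q 0 ∨ HasSlope p q (-4 * n + 2) ∨ HasSlope p q 4) ∧
        {f | IsEdgePolynomial A (-4 * n + 2) f} = {Polynomial.X + 1} ∧
        (n = -1 → ∀ p q, IsNewtonEdge A p q → HasSlope p q (-4 * n + 2)) ∧
        (n < -1 → Even n → {f | IsEdgePolynomial A 4 f} =
          {(Polynomial.X - 1) ^ (-n - 1).toNat, -(Polynomial.X - 1) ^ (-n - 1).toNat}) ∧
        (n < -1 → Odd n → {f | IsEdgePolynomial A 4 f} = {(Polynomial.X - 1) ^ (-n - 1).toNat})) := by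
  rcases lt_or_gt_of_ne hn with hneg | hpos
  · obtain ⟨j, rfl⟩ : ∃ j : ℕ, n = -((j : ℤ) + 1) := ⟨(-n - 1).toNat, by omega⟩
    have h0 : MvPolynomial.coeff 0 (twistKnotAPolynomial (-(j + 1))) = 1 := by
      have h := coeff_zero_of_neg j
      rwa [bidegree, Finsupp.single_zero, Finsupp.single_zero, add_zero] at h
    have hA := isAPolynomial_twistKnotAPolynomial hn (h0 ▸ isUnit_one)
    have hr : (-4 * ((-((j : ℤ) + 1) : ℤ) : ℚ) + 2) = ((4 * (j : ℤ) + 6 : ℤ) : ℚ) := by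
      push_cast; ring
    have h4 : (4 : ℚ) = ((4 : ℤ) : ℚ) := by norm_num
    have hj : (-(-((j : ℤ) + 1)) - 1).toNat = j := by omega
    rw [hr, hj, h4]
    refine ⟨_, hA, fun B hB => hA.eq_or_eq_neg hB (h0 ▸ isUnit_one), fun h => absurd h (by omega),
      fun _ => ⟨h0, fun p q h => ?_, edgePolynomials_steep_of_neg j, fun h1 p q h => ?_,
      fun h1 he => ?_, fun h1 ho => ?_⟩⟩
    · obtain ⟨i, hi⟩ := exists_hasSlope_of_neg j h
      fin_cases i
      · exact Or.inl (by simpa using hi)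
      · exact Or.inr (Or.inr hi)
      · exact Or.inr (Or.inl hi)
    · obtain rfl : j = 0 := by omega
      have := hasSlope_six_of_trefoil (by simpa using h)
      simpa using this
    -- The exponent is `j = -n - 1`, of parity opposite to `n`. The polynomials `(X - 1)^j` and `(1
    -- - X)^j` of the two parallel sides are opposite for odd `j` and equal for even `j`.
    · have hodd : Odd j := by
        rw [even_neg, Int.even_add_one, Int.not_even_iff_odd] at he
        exact_mod_cast he
      rw [edgePolynomials_four_of_neg j (by omega), ← neg_sub Polynomial.X 1, hodd.neg_pow]
    · have heven : Even j := by
        rw [← Int.not_even_iff_odd, even_neg, Int.even_add_one, not_not] at ho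
        exact_mod_cast ho
      rw [edgePolynomials_four_of_neg j (by omega), ← neg_sub Polynomial.X 1, heven.neg_pow,
        Set.pair_eq_singleton]
  · obtain ⟨j, rfl⟩ : ∃ j : ℕ, n = (j : ℤ) + 1 := ⟨(n - 1).toNat, by omega⟩
    have hj : ((j : ℤ) + 1).toNat = j + 1 := by omega
    have h0 : MvPolynomial.coeff (Finsupp.single 1 (4 * (j + 1)))
        (twistKnotAPolynomial (j + 1)) = -1 := by
      rw [← coeff_zero_of_pos j, bidegree]
      simp
    have hu : IsUnit (MvPolynomial.coeff (Finsupp.single 1 (4 * (j + 1)))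
        (twistKnotAPolynomial (j + 1))) := h0 ▸ isUnit_one.neg
    have hA := isAPolynomial_twistKnotAPolynomial hn hu
    have hr : (-4 * (((j : ℤ) + 1 : ℤ) : ℚ)) = ((-4 * ((j : ℤ) + 1) : ℤ) : ℚ) := by
      push_cast; ring
    have h4 : (4 : ℚ) = ((4 : ℤ) : ℚ) := by norm_num
    rw [hr, hj, h4]
    refine ⟨_, hA, fun B hB => hA.eq_or_eq_neg hB hu,
      fun _ => ⟨h0, fun p q h => ?_, edgePolynomials_steep_of_pos j, fun he => ?_, fun ho => ?_⟩,
      fun h => absurd h (by omega)⟩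
    · obtain ⟨i, hi⟩ := exists_hasSlope_of_pos j h
      fin_cases i
      · exact Or.inr (Or.inl hi)
      · exact Or.inl (by simpa using hi)
      · exact Or.inr (Or.inr hi)
    · have heven : Even (j + 1) := by exact_mod_cast he
      rw [edgePolynomials_four_of_pos j, ← neg_sub Polynomial.X 1, heven.neg_pow,
        Set.pair_eq_singleton]
    · have hodd : Odd (j + 1) := by exact_mod_cast ho
      rw [edgePolynomials_four_of_pos j, ← neg_sub Polynomial.X 1, hodd.neg_pow, neg_neg,
        Set.pair_comm]
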